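/- Let $p$ be a prime, $d\ge 1$, and let $R_1,\dots,R_d\in\mathbb F_p[x^{\pm1}]$ be multiplicatively independent, i.e. the products $R_1^{a_1}\cdots R_d^{a_d}$, $a\in\mathbb N^d$, are pairwise distinct. Write an element $\zeta=(\zeta_k)_{k\in\mathbb Z^{d+1}}$ of $\mathbb F_p^{\mathbb Z^{d+1}}$ as the formal series $\sum_k\zeta_k\underline x^{-k}$, on which the Laurent polynomials in $x_1,\dots,x_{d+1}$ act by multiplication. Let $\mathcal J$ be the ideal of $\mathbb F_p[x_1^{\pm1},\dots,x_{d+1}^{\pm1}]$ generated by $x_{j+1}-R_j(x_1)$, $j=1,\dots,d$, and let $G_{\mathcal J}=\{\zeta\in\mathbb F_p^{\mathbb Z^{d+1}}: P\zeta=0\ \ \forall P\in\mathcal J\}$, a compact abelian group with normalized Haar measure $\mu$ (it carries the natural invertible extension of the $\mathbb N^d$-action on $\mathbb F_p^{\mathbb Z}$ generated by the multiplications by $R_1,\dots,R_d$). For $\ell\in\mathbb Z^d$ let $T^\ell f=f\circ\sigma_2^{\ell_1}\cdots\sigma_{d+1}^{\ell_d}$, where the shift $\sigma_i$ is the multiplication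 by $x_i$ on $G_{\mathcal J}$. Let $(D_n)$ be a Følner sequence of finite sets in $\mathbb N^d$: $D_n\neq\emptyset$ for $n$ large, and $|(D_n+q)\,\triangle\, D_n|/|D_n|\to0$ for every $q\in\mathbb Z^d$. Let $f:G_{\mathcal J}\to\mathbb R$ have an absolutely convergent Fourier series, $f=\sum_\chi c_\chi\chi$ with $\sum_\chi|c_\chi|<\infty$ (sum over the continuous characters $\chi$ of $G_{\mathcal J}$), and $\int f\,d\mu=0$. Then the spectral measure of $f$, i.e. the finite positive measure on $\mathbb T^d$ with Fourier coefficients $\int_{\mathbb T^d} e^{-2\pi i\langle\ell,t\rangle}\,d\nu_f(t)=\langle T^\ell f,f\rangle_{L^2(\mu)}$, $\ell\in\mathbb Z^d$, has a continuous density $\varphi_f\ge 0$, and $$\sigma^2(f):=\lim_{n\to\infty}\frac1{|D_n|}\Big\|\sum_{\ell\in D_n}T^\ell f\Big\|_2^2=\varphi_f(0).$$ If moreover $\log\operatorname{diam}D_n=O(|D_n|^\delta)$ as $n\to\infty$ for every $\delta>0$, then $|D_n|^{-1/2}\sum_{\ell\in D_n}T^\ell f$ converges in distribution, with respect to $\mu$,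 to $\mathcal N(0,\sigma^2(f))$ (the Dirac mass at $0$ if $\sigma^2(f)=0$). -/

import Mathlib

open MeasureTheory ProbabilityTheory Filter Topology

noncomputable section

namespace ShiftCLT

/-- The ring of Laurent polynomials in `m` variables with coefficients in `𝔽_p`; the coefficient
of the monomial with exponent vector `k` is `P.coeff k`. -/
abbrev LPoly (p m : ℕ) : Type := AddMonoidAlgebra (ZMod p) (Fin m → ℤ)

/-- The compact group `𝔽_p ^ (ℤ^m)`, with the product topology. The element `ζ` stands for the
formal series `∑ ζ_k x^(-k)`. -/
abbrev FullGroup (p m : ℕ) : Type := (Fin m → ℤ) → ZMod p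

/-- The product `P ζ` of a Laurent polynomial and a formal series: its coefficient at `x^(-k)` is
`∑ j, P_j ζ_(k+j)`. -/
def polyMul {p m : ℕ} (P : LPoly p m) (ζ : FullGroup p m) : FullGroup p m :=
  fun k => P.coeff.sum fun j c => c * ζ (k + j)

/-- The shift-invariant closed subgroup `G_J = {ζ | P ζ = 0 for all P ∈ J}` of an ideal `J`. -/
def idealSubgroup {p m : ℕ} (J : Ideal (LPoly p m)) : AddSubgroup (FullGroup p m) where
  carrier := {ζ | ∀ P ∈ J, polyMul P ζ = 0}
  zero_mem' := by
    intro P _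
    funext k
    simp [polyMul]
  add_mem' := by
    intro a b ha hb P hP
    funext k
    have h1 := congrFun (ha P hP) k
    have h2 := congrFun (hb P hP) k
    simp only [polyMul, Pi.zero_apply, Pi.add_apply, mul_add] at h1 h2 ⊢
    rw [Finsupp.sum_add, h1, h2, add_zero]
  neg_mem' := by
    intro a ha P hP
    funext k
    have h1 := congrFun (ha P hP) k
    simp only [polyMul, Pi.zero_apply, Pi.neg_apply, mul_neg] at h1 ⊢
    rw [Finsupp.sum_neg, h1, neg_zero]

/-- The Laurent polynomial `R(x_1)` in `d + 1` variables, for `R` in one variable. The variables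
`x_1, ..., x_(d+1)` have the indices `0, ..., d`. -/
def inFirstVar {p : ℕ} (d : ℕ) (R : LaurentPolynomial (ZMod p)) : LPoly p (d + 1) :=
  AddMonoidAlgebra.mapDomain (fun n : ℤ => (Pi.single 0 n : Fin (d + 1) → ℤ)) R

/-- The ideal generated by the polynomials `x_(j+1) - R_j(x_1)`, `j = 1, ..., d`. -/
def extIdeal {p d : ℕ} (R : Fin d → LaurentPolynomial (ZMod p)) : Ideal (LPoly p (d + 1)) :=
  Ideal.span (Set.range fun j : Fin d =>
    (AddMonoidAlgebra.single (Pi.single j.succ 1) 1 : LPoly p (d + 1)) - inFirstVar d (R j))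

/-- The group of the natural invertible extension of the `ℕ^d`-action on `𝔽_p^ℤ` generated by the
multiplications by `R_1, ..., R_d`. -/
abbrev ExtGroup {p d : ℕ} (R : Fin d → LaurentPolynomial (ZMod p)) : Type :=
  idealSubgroup (extIdeal R)

theorem polyMul_shift {p m : ℕ} (P : LPoly p m) (ζ : FullGroup p m) (v : Fin m → ℤ) :
    polyMul P (fun k => ζ (k + v)) = fun k => polyMul P ζ (k + v) := by
  funext k
  simp only [polyMul]
  congr 1
  funext j c
  rw [add_right_comm]

/-- The `ℤ^d`-action on the extension: `ℓ` acts as `σ_2^(ℓ_1) ⋯ σ_(d+1)^(ℓ_d)`, where `σ_i` is the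
shift of the `i`-th coordinate, that is the multiplication by `x_i`. -/
def shiftAct {p d : ℕ} (R : Fin d → LaurentPolynomial (ZMod p)) (l : Fin d → ℤ)
    (ζ : ExtGroup R) : ExtGroup R :=
  ⟨fun k => (ζ : FullGroup p (d + 1)) (k + Fin.cons 0 l), fun P hP => by
    rw [polyMul_shift]
    funext k
    exact congrFun (ζ.2 P hP) _⟩

theorem isClosed_idealSubgroup {p m : ℕ} (J : Ideal (LPoly p m)) :
    IsClosed (idealSubgroup J : Set (FullGroup p m)) := by
  have h : (idealSubgroup J : Set (FullGroup p m)) =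
      ⋂ P ∈ J, ⋂ k : Fin m → ℤ, {ζ | polyMul P ζ k = 0} := by
    ext ζ
    simp only [Set.mem_iInter, Set.mem_ofPred_eq]
    exact ⟨fun h P hP k => congrFun (h P hP) k, fun h P hP => funext (h P hP)⟩
  rw [h]
  refine isClosed_biInter fun P _ => isClosed_iInter fun k => isClosed_eq ?_ continuous_const
  exact continuous_finsetSum _ fun j _ => continuous_const.mul (continuous_apply (k + j))

instance instCompactSpaceExtGroup {p d : ℕ} [NeZero p] (R : Fin d → LaurentPolynomial (ZMod p)) :
    CompactSpace (ExtGroup R) :=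
  isCompact_iff_compactSpace.mp (isClosed_idealSubgroup (extIdeal R)).isCompact

instance instBorelSpaceZMod (p : ℕ) : BorelSpace (ZMod p) :=
  ⟨by rw [borel_eq_top_of_discrete]; rfl⟩

/-- The normalized Haar measure of the extension. -/
def haar {p d : ℕ} [NeZero p] (R : Fin d → LaurentPolynomial (ZMod p)) : Measure (ExtGroup R) :=
  Measure.addHaarMeasure ⊤

instance instIsProbabilityMeasureHaar {p d : ℕ} [NeZero p]
    (R : Fin d → LaurentPolynomial (ZMod p)) : IsProbabilityMeasure (haar R) :=
  ⟨by simpa [haar] using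
    Measure.addHaarMeasure_self (K₀ := (⊤ : TopologicalSpace.PositiveCompacts (ExtGroup R)))⟩

/-- The regular functions: real functions of zero mean with an absolutely convergent Fourier
series `f = ∑ c_χ χ`, the sum over the continuous characters `χ` of the group. -/
def IsRegular {p d : ℕ} [NeZero p] (R : Fin d → LaurentPolynomial (ZMod p))
    (f : ExtGroup R → ℝ) : Prop :=
  (∃ c : {χ : AddChar (ExtGroup R) Circle // Continuous χ} → ℂ,
    (Summable fun χ => ‖c χ‖) ∧
      ∀ x, HasSum (fun χ => c χ * ((χ.1 x : Circle) : ℂ)) ((f x : ℝ) : ℂ)) ∧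
  ∫ x, f x ∂(haar R) = 0

/-- `ν` is the spectral measure of `f`: the finite measure on the torus with the Fourier
coefficients `∫ e^(-2πi⟨l,t⟩) dν(t) = ⟨T^l f, f⟩`. -/
def IsSpectralMeasure {p d : ℕ} [NeZero p] (R : Fin d → LaurentPolynomial (ZMod p))
    (f : ExtGroup R → ℝ) (ν : Measure (UnitAddTorus (Fin d))) : Prop :=
  IsFiniteMeasure ν ∧ ∀ l : Fin d → ℤ,
    ∫ t, UnitAddTorus.mFourier (-l) t ∂ν =
      ((∫ x, f (shiftAct R l x) * f x ∂(haar R) : ℝ) : ℂ)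

/-- `φ` is the continuous density of the spectral measure of `f` with respect to the normalized
Haar measure of the torus. Such a `φ` is determined by `f`. -/
def IsSpectralDensity {p d : ℕ} [NeZero p] (R : Fin d → LaurentPolynomial (ZMod p))
    (f : ExtGroup R → ℝ) (φ : UnitAddTorus (Fin d) → ℝ) : Prop :=
  Continuous φ ∧ (∀ t, 0 ≤ φ t) ∧
    IsSpectralMeasure R f ((Measure.pi fun _ : Fin d => AddCircle.haarAddCircle).withDensity
      fun t => ENNReal.ofReal (φ t))

/-- The `R_j` are multiplicatively independent: distinct exponent vectors give distinct products
`R_1^(a_1) ⋯ R_d^(a_d)`. -/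
def MulIndependent {p d : ℕ} (R : Fin d → LaurentPolynomial (ZMod p)) : Prop :=
  Function.Injective fun a : Fin d → ℕ => ∏ j, R j ^ a j

end ShiftCLT

end

/-! Duality turns the dynamics into arithmetic. The continuous characters of the extension form the
ring `DualRing R` (`dualEquiv`). Multiplicative independence forces every `R_j` to be nonzero, and
evaluation at `(x, R_1, ..., R_d)` embeds this ring into `𝔽_p(x)` (`mem_extIdeal_iff`,
`dualEmbedding_injective`). There `T^ℓ` becomes multiplication by `R^ℓ`, and independence makes this
action free on nonzero elements (`dualMonomial_mul_injective`).

Freeness alone settles the variance. For coefficients with finite `ℓ¹` norm and `c_0 = 0`, every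
orbit is visited without repetition, so the correlations are absolutely summable, with sum at most
the square of that norm (`summable_norm_corr`). Their Fourier series is the continuous spectral
density, and Følner averages of the correlations converge to its value at `0`
(`tendsto_sum_sum_sub_div_card`). The same bound, uniform in `D_n`, controls truncation in `L²`, so
the limit theorem need only be shown for trigonometric polynomials.

For these the method of moments applies. The `r`-th moment of the sum over `D` is a weighted count
of the `r`-tuples with zero sum in the set `B` of frequencies, where `|B| = O(|D|)`
(`integral_sum_char_pow`). Such a tuple splits into minimal zero-sum blocks. Blocks `{b, -b}` alone
would give the Gaussian recursion `m_(r+2) = (r+1) m_2 m_r`. Longer blocks are negligible if, for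
each length `k ≥ 3`, there are at most `|D|^(5/4)` of them, since pairings would allow `|D|^(k/2)`
(`exists_norm_zeroSumWeight_sub_le`).

The arithmetic input is `sUnitBound`: up to scaling, a minimal zero sum with boundedly many terms,
built from fixed primes and of degree at most `M`, has only a power of `log M` many possibilities.
Put `l_j = Q t_j'/t_j`, a polynomial from a fixed finite set. Differentiating `∑ t_j = 0` gives the
shorter relations `∑ (l_j - l_i) t_j = 0`, whose blocks link all indices unless the `l_j` coincide
(`ratio_mem_pow_card`). If they coincide, the `t_j` are `p`-th powers up to a common factor
(`exists_eq_mul_pow`), and taking roots divides the degree by `p`; the logarithm counts these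
descents. In the orbit over `D` the degree is linear in the diameter, so the condition on `log diam
D_n` is what makes the count small enough. -/

namespace ShiftCLT

/-! ### Minimal zero sums and decomposition into blocks -/

section MinZero

variable {ι A : Type*} [AddCommGroup A]

/-- The family `t` has zero sum over `I`, and no nonempty proper subset of `I` has this property. -/
def MinZero (t : ι → A) (I : Finset ι) : Prop :=
  I.Nonempty ∧ ∑ i ∈ I, t i = 0 ∧ ∀ J ⊂ I, J.Nonempty → ∑ i ∈ J, t i ≠ 0

theorem exists_minZero_subset (t : ι → A) {I : Finset ι} (hI : I.Nonempty)
    (h : ∑ i ∈ I, t i = 0) : ∃ B ⊆ I, MinZero t B := by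
  classical
  induction I using Finset.strongInduction with
  | H I ih =>
    by_cases hmin : ∀ J ⊂ I, J.Nonempty → ∑ i ∈ J, t i ≠ 0
    · exact ⟨I, subset_rfl, hI, h, hmin⟩
    · push Not at hmin
      obtain ⟨J, hJI, hJ, hJ0⟩ := hmin
      obtain ⟨B, hB, hBm⟩ := ih J hJI hJ hJ0
      exact ⟨B, hB.trans hJI.subset, hBm⟩

/-- If a proper part sums to zero, so does its complement, and one of the two contains `i`; descend
into that one. -/
theorem exists_minZero_mem (t : ι → A) {I : Finset ι} {i : ι} (hi : i ∈ I)
    (h : ∑ i ∈ I, t i = 0) : ∃ B ⊆ I, i ∈ B ∧ MinZero t B := by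
  classical
  induction I using Finset.strongInduction with
  | H I ih =>
    by_cases hmin : ∀ J ⊂ I, J.Nonempty → ∑ i ∈ J, t i ≠ 0
    · exact ⟨I, subset_rfl, hi, ⟨i, hi⟩, h, hmin⟩
    · push Not at hmin
      obtain ⟨J, hJI, hJ, hJ0⟩ := hmin
      by_cases hiJ : i ∈ J
      · obtain ⟨B, hB, hBm⟩ := ih J hJI hiJ hJ0
        exact ⟨B, hB.trans hJI.subset, hBm⟩
      · have hs : ∑ i ∈ I \ J, t i = 0 := by
          have := Finset.sum_sdiff (f := t) hJI.subset
          rw [hJ0, add_zero, h] at this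
          exact this
        obtain ⟨B, hB, hBm⟩ := ih (I \ J) (Finset.sdiff_ssubset hJI.subset hJ)
          (Finset.mem_sdiff.2 ⟨hi, hiJ⟩) hs
        exact ⟨B, hB.trans Finset.sdiff_subset, hBm⟩

/-- A set of indices that is a union of blocks carries a zero sum. -/
theorem sum_inter_eq_zero_of_blocks [DecidableEq ι] (s : ι → A) (H : Finset ι) {I : Finset ι}
    (h : ∑ i ∈ I, s i = 0) (hH : ∀ B ⊆ I, MinZero s B → (∃ k ∈ B, k ∈ H) → B ⊆ H) :
    ∑ i ∈ I ∩ H, s i = 0 := by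
  induction I using Finset.strongInduction with
  | H I ih =>
    rcases I.eq_empty_or_nonempty with rfl | hI
    · simp
    obtain ⟨B, hB, hBm⟩ := exists_minZero_subset s hI h
    have hs : ∑ i ∈ I \ B, s i = 0 := by
      have := Finset.sum_sdiff (f := s) hB
      rw [hBm.2.1, add_zero, h] at this
      exact this
    have h1 := ih (I \ B) (Finset.sdiff_ssubset hB hBm.1) hs
      fun C hC => hH C (hC.trans Finset.sdiff_subset)
    have h2 : ∑ i ∈ B ∩ H, s i = 0 := by
      by_cases hk : ∃ k ∈ B, k ∈ H
      · rw [Finset.inter_eq_left.2 (hH B hB hBm hk)]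
        exact hBm.2.1
      · push Not at hk
        rw [Finset.disjoint_iff_inter_eq_empty.1 (Finset.disjoint_left.2 hk), Finset.sum_empty]
    have h3 : I ∩ H = (I \ B) ∩ H ∪ B ∩ H := by
      rw [← Finset.union_inter_distrib_right, Finset.sdiff_union_of_subset hB]
    rw [h3, Finset.sum_union, h1, h2, add_zero]
    exact Finset.disjoint_of_subset_left Finset.inter_subset_left
      (Finset.disjoint_of_subset_right Finset.inter_subset_left Finset.sdiff_disjoint)

end MinZero

/-! ### Logarithmic derivatives in characteristic `p` -/

section Smooth

open Polynomial

variable {p : ℕ} [Fact p.Prime]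

/-- A logarithmic derivative has at most simple poles, at the primes of `t`, and these divide `Q`.
The induction adds one prime factor at a time through the product rule. -/
theorem dvd_mul_derivative {F : Type*} [Field F] {Q : F[X]} (t : F[X]) (n : ℕ)
    (h : t ∣ Q ^ n) : t ∣ Q * derivative t := by
  induction t using UniqueFactorizationMonoid.induction_on_prime with
  | h₁ => simp
  | h₂ x hx => exact hx.dvd
  | h₃ a q ha hq ih =>
    obtain ⟨b, hb⟩ := ih ((dvd_mul_left a q).trans h)
    obtain ⟨c, hc⟩ := hq.dvd_of_dvd_pow ((dvd_mul_right q a).trans h)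
    refine ⟨c * derivative q + b, ?_⟩
    rw [derivative_mul]
    linear_combination derivative q * a * hc + q * hb

/-- Polynomials of which all logarithmic derivatives agree are `p`-th powers up to a common
factor. -/
theorem exists_eq_mul_pow {ι : Type*} {I : Finset ι} (hI : I.Nonempty) (t : ι → (ZMod p)[X])
    (h0 : ∀ i ∈ I, t i ≠ 0)
    (h : ∀ i ∈ I, ∀ j ∈ I, derivative (t i) * t j = derivative (t j) * t i) :
    ∃ (g : (ZMod p)[X]) (w : ι → (ZMod p)[X]), g ≠ 0 ∧ ∀ i ∈ I, t i = g * w i ^ p := by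
  classical
  let _ : NormalizationMonoid (ZMod p)[X] := inferInstance
  let _ : StrongNormalizedGCDMonoid (ZMod p)[X] :=
    (UniqueFactorizationMonoid.toStrongNormalizedGCDMonoid _)
  obtain ⟨u, hu, hgcd⟩ := Finset.extract_gcd t hI
  set g := I.gcd t
  obtain ⟨i₀, hi₀⟩ := hI
  have hg : g ≠ 0 := fun hg => h0 i₀ hi₀ (by rw [hu i₀ hi₀, hg, zero_mul])
  refine ⟨g, fun i => contract p (u i), hg, fun i hi => ?_⟩
  -- After division by the gcd, `u i` divides `(u i)' * u j` for every `j`. The `u j` are jointly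
  -- coprime, so `u i` divides its own derivative, which must then vanish.
  have hd : derivative (u i) = 0 := by
    rw [← dvd_derivative_iff]
    have h1 : u i ∣ I.gcd fun j => derivative (u i) * u j := by
      refine Finset.dvd_gcd fun j hj => ?_
      have h2 := h i hi j hj
      rw [hu i hi, hu j hj, derivative_mul, derivative_mul] at h2
      have h3 : g ^ 2 * (derivative (u i) * u j) = g ^ 2 * (u i * derivative (u j)) := by
        linear_combination h2
      exact ⟨_, mul_left_cancel₀ (pow_ne_zero 2 hg) h3⟩
    have h4 := h1.trans (Finset.gcd_mul_left' (s := I) (f := u) (derivative (u i))).dvd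
    rwa [hgcd, mul_one] at h4
  -- Vanishing derivative means a polynomial in `X ^ p`; Frobenius fixes the coefficients in `𝔽_p`,
  -- so this is a `p`-th power.
  rw [← ZMod.expand_card, expand_contract p hd (Fact.out : p.Prime).ne_zero]
  exact hu i hi

end Smooth

/-! ### Minimal `S`-unit equations over `𝔽_p(x)` -/

section SUnits

open Polynomial Pointwise

variable {p : ℕ} [Fact p.Prime]

/-- A minimal zero-sum family of nonzero polynomials of degree at most `M`, all of whose prime
factors divide `Q`. -/
def IsSUnitTuple {ι : Type} (Q : (ZMod p)[X]) (M : ℕ) (t : ι → (ZMod p)[X]) (I : Finset ι) : Prop :=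
  MinZero t I ∧ ∀ i ∈ I, t i ≠ 0 ∧ (∃ n, t i ∣ Q ^ n) ∧ (t i).natDegree ≤ M

theorem finite_natDegree_le (F : Type*) [Field F] [Finite F] (n : ℕ) :
    {f : F[X] | f.natDegree ≤ n}.Finite := by
  have : Finite (degreeLT F (n + 1)) := Finite.of_equiv _ (degreeLTEquiv F (n + 1)).toEquiv.symm
  refine (Set.toFinite (degreeLT F (n + 1) : Set F[X])).subset fun f hf => ?_
  simp only [SetLike.mem_coe, mem_degreeLT]
  exact (degree_le_of_natDegree_le hf).trans_lt (by exact_mod_cast Nat.lt_succ_self n)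

theorem minZero_singleton_of_eq_zero {ι A : Type*} [AddCommGroup A] {s : ι → A} {B : Finset ι}
    (hB : MinZero s B) {j : ι} (hj : j ∈ B) (h0 : s j = 0) : B = {j} := by
  by_contra hne
  have hss : ({j} : Finset ι) ⊂ B :=
    Finset.ssubset_iff_subset_ne.2 ⟨Finset.singleton_subset_iff.2 hj, fun h => hne h.symm⟩
  exact hB.2.2 {j} hss (Finset.singleton_nonempty j) (by simpa using h0)

/-- If `∑ t_j = 0` is minimal, the `l_j` are not all equal, and `∑ (l_j - l_i) t_j = 0` for all `i`,
then the blocks of the latter relations connect all indices. -/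
theorem ratio_mem_pow_card {L K : Type*} [CommRing L] [IsDomain L] [Field K] [DecidableEq K]
    {φ : L →+* K} (hφ : Function.Injective φ)
    {ι : Type*} {I : Finset ι} {t l : ι → L} (ht : MinZero t I) (ht0 : ∀ i ∈ I, t i ≠ 0)
    (hl : ∃ i ∈ I, ∃ j ∈ I, l i ≠ l j)
    (hrel : ∀ i ∈ I, ∑ j ∈ I, (l j - l i) * t j = 0)
    {F : Finset K} (hF1 : 1 ∈ F)
    (hblock : ∀ i ∈ I, ∀ B ⊆ I, (∀ j ∈ B, l j ≠ l i) → MinZero (fun j => (l j - l i) * t j) B →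
      ∀ j ∈ B, ∀ k ∈ B, φ (t j) / φ (t k) ∈ F) :
    ∀ i ∈ I, ∀ j ∈ I, φ (t j) / φ (t i) ∈ F ^ I.card := by
  classical
  intro i hi
  have hφ0 : ∀ j ∈ I, φ (t j) ≠ 0 := fun j hj =>
    (map_ne_zero_iff φ hφ).2 (ht0 j hj)
  -- The indices whose ratio to `t i` is a product of `n` elements of `F`; this includes all indices
  -- reached from `i` through at most `n` blocks.
  let H : ℕ → Finset ι := fun n => I.filter fun j => φ (t j) / φ (t i) ∈ F ^ n
  have hmono : ∀ n, H n ⊆ H (n + 1) := fun n j hj => by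
    simp only [H, Finset.mem_filter] at hj ⊢
    exact ⟨hj.1, Finset.pow_subset_pow_right hF1 n.le_succ hj.2⟩
  have hsub : ∀ n, H n ⊆ I := fun n => Finset.filter_subset _ _
  have hiH : ∀ n, i ∈ H n := fun n => by
    simp only [H, Finset.mem_filter]
    refine ⟨hi, ?_⟩
    rw [div_self (hφ0 i hi)]
    exact Finset.one_mem_pow hF1
  have hstep : ∀ n, H n ≠ I → H n ≠ H (n + 1) := by
    -- If the growth stops early, `H n` is a union of blocks for each of the relations, so every
    -- relation holds with its sum restricted to `H n`.
    intro n hn heq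
    have hclosed : ∀ k ∈ I, ∑ j ∈ H n, (l j - l k) * t j = 0 := by
      intro k hk
      have := sum_inter_eq_zero_of_blocks (fun j => (l j - l k) * t j) (H n) (hrel k hk) ?_
      · rwa [Finset.inter_eq_right.2 (hsub n)] at this
      · rintro B hB hBm ⟨m, hmB, hmH⟩
        by_cases hz : ∃ j ∈ B, l j = l k
        · obtain ⟨j, hj, hjk⟩ := hz
          have hBj := minZero_singleton_of_eq_zero hBm hj (by simp [hjk])
          subst hBj
          rw [Finset.mem_singleton] at hmB
          subst hmB
          exact Finset.singleton_subset_iff.2 hmH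
        · push Not at hz
          intro j hj
          rw [heq]
          have h1 := hblock k hk B hB hz hBm j hj m hmB
          have h2 := (Finset.mem_filter.1 hmH).2
          simp only [H, Finset.mem_filter]
          refine ⟨hB hj, ?_⟩
          have h3 : φ (t j) / φ (t i) = φ (t m) / φ (t i) * (φ (t j) / φ (t m)) := by
            have := hφ0 m (hB hmB)
            have := hφ0 i hi
            field_simp
          rw [h3, pow_succ]
          exact Finset.mul_mem_mul h2 h1
    have hy : ∑ j ∈ H n, t j ≠ 0 :=
      ht.2.2 (H n) (Finset.ssubset_iff_subset_ne.2 ⟨hsub n, hn⟩) ⟨i, hiH n⟩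
    -- The right side does not depend on `k`, and minimality makes the partial sum on the left
    -- nonzero; hence all `l k` would coincide.
    have hz : ∀ k ∈ I, l k * ∑ j ∈ H n, t j = ∑ j ∈ H n, l j * t j := by
      intro k hk
      have := hclosed k hk
      simp only [sub_mul, Finset.sum_sub_distrib] at this
      rw [Finset.mul_sum]
      exact (sub_eq_zero.1 this).symm
    obtain ⟨a, ha, b, hb, hab⟩ := hl
    exact hab (mul_right_cancel₀ hy ((hz a ha).trans (hz b hb).symm))
  have hcard : ∀ n, H n = I ∨ n + 1 ≤ (H n).card := by
    intro n
    induction n with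
    | zero => exact Or.inr (Finset.card_pos.2 ⟨i, hiH 0⟩)
    | succ n ih =>
      by_cases hn : H n = I
      · exact Or.inl ((hsub _).antisymm (hn ▸ hmono n))
      · have h1 := ih.resolve_left hn
        have h2 := Finset.card_lt_card
          (Finset.ssubset_iff_subset_ne.2 ⟨hmono n, hstep n hn⟩)
        exact Or.inr (by omega)
  have hfin : H I.card = I := by
    rcases hcard I.card with h | h
    · exact h
    · have := Finset.card_le_card (hsub I.card)
      omega
  intro j hj
  rw [← hfin] at hj
  exact (Finset.mem_filter.1 hj).2

/-- Bounds of the shape `(x + c) ^ c` are stable under affine operations at the price of a larger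
`c`, so one constant can carry both coefficient and exponent through the induction. -/
theorem mul_add_pow_add_le (A B c x : ℕ) :
    A * (x + c) ^ c + B ≤ (x + (A + B + c + 1)) ^ (A + B + c + 1) := by
  have h1 : (x + (A + B + c + 1)) ^ (c + 1) ≤ (x + (A + B + c + 1)) ^ (A + B + c + 1) :=
    Nat.pow_le_pow_right (by omega) (by omega)
  have h2 : (x + c) ^ c ≤ (x + (A + B + c + 1)) ^ c := Nat.pow_le_pow_left (by omega) c
  have h3 : 1 ≤ (x + (A + B + c + 1)) ^ c := Nat.one_le_pow _ _ (by omega)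
  calc A * (x + c) ^ c + B
      ≤ A * (x + (A + B + c + 1)) ^ c + B * (x + (A + B + c + 1)) ^ c := by
        gcongr
        exact Nat.le_mul_of_pos_right B h3
    _ = (A + B) * (x + (A + B + c + 1)) ^ c := by ring
    _ ≤ (x + (A + B + c + 1)) * (x + (A + B + c + 1)) ^ c :=
        Nat.mul_le_mul_right _ (by omega)
    _ = (x + (A + B + c + 1)) ^ (c + 1) := by ring
    _ ≤ _ := h1

theorem log_add_le {b : ℕ} (hb : 1 < b) (M q : ℕ) : Nat.log b (M + q) ≤ Nat.log b M + q := by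
  induction q with
  | zero => simp
  | succ q ih =>
    have h1 : M + q + 1 < b ^ (Nat.log b (M + q) + 2) := by
      have h2 : M + q < b ^ (Nat.log b (M + q) + 1) := Nat.lt_pow_succ_log_self hb _
      have h3 : b ^ (Nat.log b (M + q) + 1) * 2 ≤ b ^ (Nat.log b (M + q) + 1) * b :=
        Nat.mul_le_mul_left _ hb
      rw [pow_succ b (Nat.log b (M + q) + 1)]
      omega
    have h4 := (Nat.log_lt_iff_lt_pow hb (by omega)).2 h1
    rw [← add_assoc]
    omega

variable {K : Type*} [Field K] [Algebra (ZMod p)[X] K]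

/-- The counting bound for minimal `S`-unit equations with at most `s` terms. -/
def SUnitBound (p : ℕ) [Fact p.Prime] (K : Type*) [Field K] [Algebra (ZMod p)[X] K] (s : ℕ) :
    Prop :=
  ∀ Q : (ZMod p)[X], Q ≠ 0 → ∃ c : ℕ, ∀ M : ℕ, ∃ S : Finset K,
    S.card ≤ (Nat.log p M + c) ^ c ∧
    ∀ (ι : Type) (I : Finset ι) (t : ι → (ZMod p)[X]), I.card ≤ s → IsSUnitTuple Q M t I →
      ∀ i ∈ I, ∀ j ∈ I, algebraMap _ K (t i) / algebraMap _ K (t j) ∈ S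

/-- Here `l j = Q t_j'/t_j`. The degree bound does not involve `M`, so over a finite field these
quotients range over a finite set fixed by `Q`. -/
theorem exists_logDerivative {ι : Type} {Q : (ZMod p)[X]} {M : ℕ} {t : ι → (ZMod p)[X]}
    {I : Finset ι} (ht : IsSUnitTuple Q M t I) :
    ∃ l : ι → (ZMod p)[X], ∀ j ∈ I, l j * t j = Q * derivative (t j) ∧
      (l j).natDegree ≤ Q.natDegree := by
  have h : ∀ j, ∃ l : (ZMod p)[X], j ∈ I → l * t j = Q * derivative (t j) ∧
      l.natDegree ≤ Q.natDegree := by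
    intro j
    by_cases hj : j ∈ I
    · obtain ⟨h0, ⟨n, hn⟩, -⟩ := ht.2 j hj
      obtain ⟨l, hl⟩ := dvd_mul_derivative (t j) n hn
      refine ⟨l, fun _ => ⟨by rw [hl, mul_comm], ?_⟩⟩
      by_cases hl0 : l = 0
      · simp [hl0]
      have h1 := congrArg natDegree hl
      rw [natDegree_mul h0 hl0] at h1
      have h2 : (Q * derivative (t j)).natDegree ≤ Q.natDegree + (t j).natDegree :=
        natDegree_mul_le.trans (Nat.add_le_add_left ((natDegree_derivative_le _).trans
          (Nat.sub_le _ _)) _)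
      omega
    · exact ⟨0, fun h => absurd h hj⟩
  choose l hl using h
  exact ⟨l, hl⟩

/-- The solutions with distinct logarithmic derivatives reduce to equations with fewer terms. -/
theorem exists_ratio_finset_of_derivative_ne (hinj : Function.Injective (algebraMap (ZMod p)[X] K))
    {s : ℕ} (hs : SUnitBound p K s) {Q : (ZMod p)[X]} (hQ : Q ≠ 0) :
    ∃ c : ℕ, ∀ M : ℕ, ∃ S : Finset K, S.card ≤ (Nat.log p M + c) ^ c ∧
      ∀ (ι : Type) (I : Finset ι) (t : ι → (ZMod p)[X]), I.card ≤ s + 1 → IsSUnitTuple Q M t I →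
        (∃ i ∈ I, ∃ j ∈ I, derivative (t i) * t j ≠ derivative (t j) * t i) →
        ∀ i ∈ I, ∀ j ∈ I, algebraMap _ K (t i) / algebraMap _ K (t j) ∈ S := by
  classical
  set φ := algebraMap (ZMod p)[X] K with hφ
  -- All possible nonzero differences `l j - l i`, the coefficients of the shorter relations.
  set Co : Finset (ZMod p)[X] := (finite_natDegree_le (ZMod p) Q.natDegree).toFinset.erase 0
    with hCo
  have hmemCo : ∀ c, c ∈ Co ↔ c ≠ 0 ∧ c.natDegree ≤ Q.natDegree := by
    intro c; simp [hCo]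
  -- Enlarging the set of primes makes the terms `(l j - l i) * t j` smooth as well, so the bound
  -- for `s` terms applies to them.
  set Q' := Q * ∏ c ∈ Co, c with hQ'
  have hQ'0 : Q' ≠ 0 := mul_ne_zero hQ
    (Finset.prod_ne_zero_iff.2 fun c hc => ((hmemCo c).1 hc).1)
  have hdvd : ∀ c ∈ Co, c ∣ Q' := fun c hc =>
    (Finset.dvd_prod_of_mem (fun c => c) hc).trans (dvd_mul_left _ _)
  obtain ⟨c, hc⟩ := hs Q' hQ'0
  set m := Co.card ^ 2 + 1 + (c + Q.natDegree) + 1 with hm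
  refine ⟨m * (s + 1), fun M => ?_⟩
  obtain ⟨S, hScard, hS⟩ := hc (M + Q.natDegree)
  -- The ratio of two `t`'s in a block is a ratio of coefficients times a ratio of the weighted
  -- terms. Adjoining `1` makes the powers of `F` increase.
  set F : Finset K := insert 1 (((Co ×ˢ Co).image fun x => φ x.1 / φ x.2) * S) with hF
  refine ⟨F ^ (s + 1), ?_, ?_⟩
  · have h1 : F.card ≤ (Nat.log p M + m) ^ m := by
      calc F.card ≤ (((Co ×ˢ Co).image fun x => φ x.1 / φ x.2) * S).card + 1 :=
            Finset.card_insert_le _ _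
        _ ≤ Co.card ^ 2 * S.card + 1 := by
            gcongr
            refine Finset.card_mul_le.trans ?_
            gcongr
            refine Finset.card_image_le.trans ?_
            rw [Finset.card_product, sq]
        _ ≤ Co.card ^ 2 * (Nat.log p M + (c + Q.natDegree)) ^ (c + Q.natDegree) + 1 := by
            gcongr
            refine hScard.trans ?_
            rcases Nat.eq_zero_or_pos c with rfl | hcpos
            · rw [pow_zero]
              rcases Nat.eq_zero_or_pos Q.natDegree with h | h
              · simp [h]
              · exact Nat.one_le_pow _ _ (by omega)
            · refine (Nat.pow_le_pow_left (m := Nat.log p M + (c + Q.natDegree)) ?_ c).trans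
                (Nat.pow_le_pow_right (by omega) (by omega))
              have := log_add_le (Fact.out : p.Prime).one_lt M Q.natDegree
              omega
        _ ≤ _ := mul_add_pow_add_le _ _ _ _
    calc (F ^ (s + 1)).card ≤ F.card ^ (s + 1) := Finset.card_pow_le
      _ ≤ ((Nat.log p M + m) ^ m) ^ (s + 1) := by gcongr
      _ = (Nat.log p M + m) ^ (m * (s + 1)) := by rw [← pow_mul]
      _ ≤ _ := by
        gcongr
        exact Nat.le_mul_of_pos_right m (by omega)
  · intro ι I t hI ht hne i hi j hj
    obtain ⟨l, hl⟩ := exists_logDerivative ht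
    have hsum : ∑ j ∈ I, l j * t j = 0 := by
      rw [Finset.sum_congr rfl fun j hj => (hl j hj).1, ← Finset.mul_sum, ← derivative_sum,
        ht.1.2.1, derivative_zero, mul_zero]
    have h1F : (1 : K) ∈ F := Finset.mem_insert_self _ _
    have hmem := ratio_mem_pow_card (φ := φ) hinj ht.1 (fun i hi => (ht.2 i hi).1) (l := l) ?_ ?_
      h1F ?_ j hj i hi
    · exact Finset.pow_subset_pow_right h1F hI hmem
    · obtain ⟨a, ha, b, hb, hab⟩ := hne
      refine ⟨a, ha, b, hb, fun h => hab (mul_left_cancel₀ hQ ?_)⟩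
      rw [← mul_assoc, ← mul_assoc, ← (hl a ha).1, ← (hl b hb).1, h]
      ring
    · intro i hi
      simp only [sub_mul, Finset.sum_sub_distrib]
      rw [hsum, ← Finset.mul_sum, ht.1.2.1, mul_zero, sub_zero]
    · intro i hi B hB hBne hBm j hj k hk
      have hco : ∀ j ∈ B, l j - l i ∈ Co := fun j hj => (hmemCo _).2
        ⟨sub_ne_zero.2 (hBne j hj), (natDegree_sub_le _ _).trans
          (max_le (hl j (hB hj)).2 (hl i hi).2)⟩
      -- The index `i` has coefficient zero and drops out, which is the gain of one term.
      have hBcard : B.card ≤ s := by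
        have : B ⊆ I.erase i := fun j hj =>
          Finset.mem_erase.2 ⟨fun h => hBne j hj (h ▸ rfl), hB hj⟩
        have := Finset.card_le_card this
        rw [Finset.card_erase_of_mem hi] at this
        omega
      have hBt : IsSUnitTuple Q' (M + Q.natDegree) (fun j => (l j - l i) * t j) B := by
        refine ⟨hBm, fun j hj => ?_⟩
        obtain ⟨h0, ⟨n, hn⟩, hd⟩ := ht.2 j (hB hj)
        have hc := (hmemCo _).1 (hco j hj)
        refine ⟨mul_ne_zero hc.1 h0, ⟨n + 1, ?_⟩, ?_⟩
        · rw [pow_succ']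
          exact mul_dvd_mul (hdvd _ (hco j hj))
            (hn.trans (pow_dvd_pow_of_dvd (dvd_mul_right _ _) n))
        · refine natDegree_mul_le.trans ?_
          have := hc.2
          omega
      have hr := hS ι B _ hBcard hBt j hj k hk
      have hcj := (map_ne_zero_iff φ hinj).2 ((hmemCo _).1 (hco j hj)).1
      have hck := (map_ne_zero_iff φ hinj).2 ((hmemCo _).1 (hco k hk)).1
      have htk := (map_ne_zero_iff φ hinj).2 (ht.2 k (hB hk)).1
      have heq : φ (t j) / φ (t k) = φ (l k - l i) / φ (l j - l i) *
          (φ ((l j - l i) * t j) / φ ((l k - l i) * t k)) := by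
        rw [map_mul, map_mul]
        field_simp
      rw [heq]
      refine Finset.mem_insert_of_mem (Finset.mul_mem_mul ?_ hr)
      exact Finset.mem_image.2 ⟨(l k - l i, l j - l i),
        Finset.mem_product.2 ⟨hco k hk, hco j hj⟩, rfl⟩

/-- The logarithm of `b * M`, rather than of `M`, drops by exactly one at each descent, including
the last one from `M < b` to `0`. -/
theorem log_mul_div {b M : ℕ} (hb : 1 < b) (hM : M ≠ 0) :
    Nat.log b (b * M) = Nat.log b (b * (M / b)) + 1 := by
  rw [mul_comm b M, Nat.log_mul_base hb hM]
  by_cases h : M < b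
  · simp [Nat.div_eq_of_lt h, Nat.log_of_lt h]
  · push Not at h
    rw [mul_comm b, Nat.log_mul_base hb (Nat.div_pos h (by omega)).ne', Nat.log_div_base]
    have := Nat.log_pos hb h
    omega

/-- Outer induction on the number of terms, inner induction on the degree. Families with distinct
logarithmic derivatives reduce to fewer terms; the others are `p`-th powers up to a common factor,
which disappears in ratios. Frobenius thus produces new solutions, but only logarithmically many
generations of them fit below a given degree. -/
theorem sUnitBound (hinj : Function.Injective (algebraMap (ZMod p)[X] K)) (s : ℕ) :
    SUnitBound p K s := by
  classical
  have hp := (Fact.out : p.Prime)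
  induction s with
  | zero =>
    refine fun Q _ => ⟨0, fun M => ⟨∅, by simp, fun ι I t hI ht => ?_⟩⟩
    exact absurd (Finset.card_pos.2 ht.1.1) (by omega)
  | succ s ih =>
    intro Q hQ
    obtain ⟨c, hc⟩ := exists_ratio_finset_of_derivative_ne hinj ih hQ
    -- The first factor counts the Frobenius descents together with the final stage of constants.
    -- Each stage contributes at most the constant ratios in `𝔽_p` plus the solutions of
    -- non-Frobenius type.
    have key : ∀ M, ∃ S : Finset K,
        S.card ≤ (Nat.log p (p * M) + 1) * (p + (Nat.log p M + c) ^ c) ∧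
        ∀ (ι : Type) (I : Finset ι) (t : ι → (ZMod p)[X]), I.card ≤ s + 1 →
          IsSUnitTuple Q M t I →
          ∀ i ∈ I, ∀ j ∈ I, algebraMap _ K (t i) / algebraMap _ K (t j) ∈ S := by
      intro M
      induction M using Nat.strong_induction_on with
      | _ M ihM =>
        rcases Nat.eq_zero_or_pos M with rfl | hM
        · refine ⟨Finset.univ.image fun a : ZMod p => algebraMap _ K (C a), ?_, ?_⟩
          · refine Finset.card_image_le.trans ?_
            rw [Finset.card_univ, ZMod.card]
            nlinarith [Nat.zero_le (Nat.log p (p * 0)), Nat.zero_le ((Nat.log p 0 + c) ^ c)]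
          · intro ι I t _ ht i hi j hj
            have hi' := eq_C_of_natDegree_le_zero (ht.2 i hi).2.2
            have hj' := eq_C_of_natDegree_le_zero (ht.2 j hj).2.2
            have hj0 := (ht.2 j hj).1
            rw [hi', hj']
            rw [hj', C_ne_zero] at hj0
            refine Finset.mem_image.2 ⟨(t i).coeff 0 / (t j).coeff 0, Finset.mem_univ _, ?_⟩
            rw [eq_div_iff ((map_ne_zero_iff _ hinj).2 (C_ne_zero.2 hj0)), ← map_mul, ← C_mul,
              div_mul_cancel₀ _ hj0]
        · obtain ⟨S, hScard, hS⟩ := ihM (M / p) (Nat.div_lt_self hM hp.one_lt)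
          obtain ⟨T, hTcard, hT⟩ := hc M
          refine ⟨T ∪ S.image (· ^ p), ?_, ?_⟩
          · rw [log_mul_div hp.one_lt hM.ne']
            have h1 : (Nat.log p (M / p) + c) ^ c ≤ (Nat.log p M + c) ^ c := by
              gcongr
              exact Nat.div_le_self _ _
            calc (T ∪ S.image (· ^ p)).card ≤ T.card + S.card :=
                  (Finset.card_union_le _ _).trans (Nat.add_le_add_left Finset.card_image_le _)
              _ ≤ (Nat.log p M + c) ^ c +
                  (Nat.log p (p * (M / p)) + 1) * (p + (Nat.log p M + c) ^ c) := by
                  gcongr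
                  exact hScard.trans (Nat.mul_le_mul_left _ (Nat.add_le_add_left h1 p))
              _ ≤ _ := by
                  rw [add_mul (Nat.log p (p * (M / p)) + 1) 1]
                  omega
          · intro ι I t hI ht i hi j hj
            by_cases hd : ∃ i ∈ I, ∃ j ∈ I, derivative (t i) * t j ≠ derivative (t j) * t i
            · exact Finset.mem_union_left _ (hT ι I t hI ht hd i hi j hj)
            · push Not at hd
              obtain ⟨g, w, hg, hw⟩ :=
                exists_eq_mul_pow ht.1.1 t (fun i hi => (ht.2 i hi).1) hd
              -- Additivity of Frobenius carries vanishing and nonvanishing of all partial sums from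
              -- `t` to `w`, so minimality survives.
              have hsumJ : ∀ J ⊆ I, ∑ j ∈ J, t j = g * (∑ j ∈ J, w j) ^ p := by
                intro J hJ
                rw [sum_pow_char p, Finset.mul_sum]
                exact Finset.sum_congr rfl fun j hj => hw j (hJ hj)
              have hwt : IsSUnitTuple Q (M / p) w I := by
                refine ⟨⟨ht.1.1, ?_, fun J hJ hJne h0 => ?_⟩, fun i hi => ?_⟩
                · have := hsumJ I subset_rfl
                  rw [ht.1.2.1] at this
                  exact eq_zero_of_pow_eq_zero
                    ((mul_eq_zero.1 this.symm).resolve_left hg)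
                · refine ht.1.2.2 J hJ hJne ?_
                  rw [hsumJ J hJ.subset, h0, zero_pow hp.ne_zero, mul_zero]
                · obtain ⟨h0, ⟨n, hn⟩, hdeg⟩ := ht.2 i hi
                  have hw0 : w i ≠ 0 := by
                    intro h
                    rw [hw i hi, h, zero_pow hp.ne_zero, mul_zero] at h0
                    exact h0 rfl
                  refine ⟨hw0, ⟨n, ?_⟩, ?_⟩
                  · refine ((dvd_pow_self _ hp.ne_zero).trans ?_).trans hn
                    rw [hw i hi]
                    exact dvd_mul_left _ _
                  · rw [Nat.le_div_iff_mul_le hp.pos]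
                    rw [hw i hi, natDegree_mul hg (pow_ne_zero _ hw0), natDegree_pow] at hdeg
                    nlinarith
              refine Finset.mem_union_right _ (Finset.mem_image.2
                ⟨_, hS ι I w hI hwt i hi j hj, ?_⟩)
              rw [hw i hi, hw j hj, map_mul, map_mul, map_pow, map_pow,
                mul_div_mul_left _ _ ((map_ne_zero_iff _ hinj).2 hg), div_pow]
    refine ⟨p + c + 3, fun M => ?_⟩
    obtain ⟨S, hScard, hS⟩ := key M
    refine ⟨S, hScard.trans ?_, hS⟩
    have h1 : Nat.log p (p * M) ≤ Nat.log p M + 1 := by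
      rcases Nat.eq_zero_or_pos M with rfl | hM
      · simp
      · rw [mul_comm, Nat.log_mul_base hp.one_lt hM.ne']
    set x := Nat.log p M
    set m := p + c + 3 with hm
    have h2 : (x + c) ^ c ≤ (x + m) ^ c := Nat.pow_le_pow_left (by omega) c
    have h3 : 1 ≤ (x + m) ^ c := Nat.one_le_pow _ _ (by omega)
    calc (Nat.log p (p * M) + 1) * (p + (x + c) ^ c)
        ≤ (x + m) * (p * (x + m) ^ c + (x + m) ^ c) :=
          Nat.mul_le_mul (by omega) (Nat.add_le_add (Nat.le_mul_of_pos_right p h3) h2)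
      _ = (x + m) * ((p + 1) * (x + m) ^ c) := by ring
      _ ≤ (x + m) * ((x + m) * (x + m) ^ c) :=
          Nat.mul_le_mul_left _ (Nat.mul_le_mul_right _ (by omega))
      _ = (x + m) ^ (c + 2) := by ring
      _ ≤ (x + m) ^ m := Nat.pow_le_pow_right (by omega) (by omega)

end SUnits

/-! ### Pairings dominate the zero sums of a sparse set -/

section ZeroSums

variable {A : Type*} [AddCommGroup A]

open Classical in
/-- The families with values in `B` and sum zero. -/
noncomputable def zeroSums (ι : Type) [Fintype ι] (B : Finset A) : Finset (ι → A) :=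
  (Fintype.piFinset fun _ : ι => B).filter fun b => ∑ i, b i = 0

open Classical in
/-- The families with values in `B` whose sum is zero, minimally so. -/
noncomputable def minZeroSums (ι : Type) [Fintype ι] (B : Finset A) : Finset (ι → A) :=
  (Fintype.piFinset fun _ : ι => B).filter fun b => MinZero b Finset.univ

theorem mem_zeroSums {ι : Type} [Fintype ι] {B : Finset A} {b : ι → A} :
    b ∈ zeroSums ι B ↔ (∀ i, b i ∈ B) ∧ ∑ i, b i = 0 := by
  simp [zeroSums]

theorem mem_minZeroSums {ι : Type} [Fintype ι] {B : Finset A} {b : ι → A} :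
    b ∈ minZeroSums ι B ↔ (∀ i, b i ∈ B) ∧ MinZero b Finset.univ := by
  simp [minZeroSums]

theorem MinZero.restrict {ι : Type*} {b : ι → A} {I : Finset ι} (h : MinZero b I) :
    MinZero (fun i : I => b i) Finset.univ := by
  refine ⟨?_, ?_, fun J hJ hJne => ?_⟩
  · obtain ⟨i, hi⟩ := h.1
    exact ⟨⟨i, hi⟩, Finset.mem_univ _⟩
  · rw [Finset.univ_eq_attach, Finset.sum_attach I b]
    exact h.2.1
  · have h1 := h.2.2 (J.map (Function.Embedding.subtype _)) ?_ (hJne.map)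
    · rwa [Finset.sum_map] at h1
    · rw [Finset.ssubset_univ_iff] at hJ
      refine Finset.ssubset_iff_subset_ne.2 ⟨fun i hi => ?_, fun heq => hJ ?_⟩
      · obtain ⟨j, -, rfl⟩ := Finset.mem_map.1 hi
        exact j.2
      · refine Finset.eq_univ_iff_forall.2 fun i => ?_
        have hi : (i : ι) ∈ J.map (Function.Embedding.subtype _) := by
          rw [heq]
          exact i.2
        obtain ⟨j, hj, hji⟩ := Finset.mem_map.1 hi
        have : j = i := Subtype.ext hji
        exact this ▸ hj

-- A tuple with total zero and a minimal block `I` is the block together with a zero sum on the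
-- complement.
open Classical in
theorem card_filter_minZero_le {ι : Type} [Fintype ι] [DecidableEq ι] (B : Finset A)
    (I : Finset ι) :
    ((zeroSums ι B).filter fun b => MinZero b I).card ≤
      (minZeroSums I B).card * (zeroSums (Iᶜ : Finset ι) B).card := by
  rw [← Finset.card_product]
  refine Finset.card_le_card_of_injOn
    (fun b => (fun i : I => b i, fun i : (Iᶜ : Finset ι) => b i)) ?_ ?_
  · intro b hb
    rw [Finset.mem_coe, Finset.mem_filter, mem_zeroSums] at hb
    rw [Finset.mem_coe, Finset.mem_product, mem_minZeroSums, mem_zeroSums]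
    refine ⟨⟨fun i => hb.1.1 i, hb.2.restrict⟩, fun i => hb.1.1 i, ?_⟩
    change ∑ i : (Iᶜ : Finset ι), b i = 0
    rw [Finset.univ_eq_attach, Finset.sum_attach Iᶜ b]
    have := Finset.sum_add_sum_compl I b
    rwa [hb.2.2.1, zero_add, hb.1.2] at this
  · intro b _ b' _ h
    funext i
    by_cases hi : i ∈ I
    · exact congrFun (congrArg Prod.fst h) ⟨i, hi⟩
    · exact congrFun (congrArg Prod.snd h) ⟨i, Finset.mem_compl.2 hi⟩

/-- The hypotheses under which zero sums are dominated by pairings: `B` has `O(ν ^ 4)` elements and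
minimal zero sums of length at least three and at most `r` are few. -/
structure IsSparse (c : ℝ) (r : ℕ) (ν : ℝ) (B : Finset A) : Prop where
  one_le : 1 ≤ ν
  zero_notMem : 0 ∉ B
  neg_mem : ∀ b ∈ B, -b ∈ B
  card_le : (B.card : ℝ) ≤ c * ν ^ 4
  card_minZeroSums_le : ∀ (ι : Type) [Fintype ι], 3 ≤ Fintype.card ι → Fintype.card ι ≤ r →
    ((minZeroSums ι B).card : ℝ) ≤ ν ^ 5

/-- Every entry costs at most `ν ^ 2`, half the exponent in `|B| = O(ν ^ 4)`. A pair is determined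
by one entry, a single entry cannot vanish, and `5 ≤ 2k` for `k ≥ 3`. -/
theorem IsSparse.card_minZeroSums_le_pow {c : ℝ} (hc : 0 ≤ c) {r : ℕ} {ν : ℝ} {B : Finset A}
    (h : IsSparse c r ν B) (ι : Type) [Fintype ι] (hr : Fintype.card ι ≤ r) :
    ((minZeroSums ι B).card : ℝ) ≤ (c + 1) * ν ^ (2 * Fintype.card ι) := by
  classical
  have hν := h.one_le
  have hpos : 0 ≤ (c + 1) * ν ^ (2 * Fintype.card ι) := by positivity
  by_cases h3 : 3 ≤ Fintype.card ι
  · calc ((minZeroSums ι B).card : ℝ) ≤ ν ^ 5 := h.card_minZeroSums_le ι h3 hr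
      _ ≤ ν ^ (2 * Fintype.card ι) := pow_le_pow_right₀ hν (by omega)
      _ ≤ _ := le_mul_of_one_le_left (by positivity) (by linarith)
  · have h012 : Fintype.card ι = 0 ∨ Fintype.card ι = 1 ∨ Fintype.card ι = 2 := by omega
    rcases h012 with h0 | h1 | h2
    · have : minZeroSums ι B = ∅ := by
        refine Finset.eq_empty_of_forall_notMem fun b hb => ?_
        obtain ⟨i, -⟩ := (mem_minZeroSums.1 hb).2.1
        exact (Fintype.card_eq_zero_iff.1 h0).false i
      rw [this, Finset.card_empty, Nat.cast_zero]
      exact hpos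
    · have : minZeroSums ι B = ∅ := by
        refine Finset.eq_empty_of_forall_notMem fun b hb => ?_
        obtain ⟨i, hi⟩ := Fintype.card_eq_one_iff.1 h1
        obtain ⟨hB, -, hs, -⟩ := mem_minZeroSums.1 hb
        have hu : (Finset.univ : Finset ι) = {i} := by
          ext j; simp [hi j]
        rw [hu, Finset.sum_singleton] at hs
        exact h.zero_notMem (hs ▸ hB i)
      rw [this, Finset.card_empty, Nat.cast_zero]
      exact hpos
    · obtain ⟨i, j, hij, hu⟩ := Finset.card_eq_two.1 (Finset.card_univ.trans h2)
      have hle : (minZeroSums ι B).card ≤ B.card := by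
        refine Finset.card_le_card_of_injOn (fun b => b i)
          (fun b hb => (mem_minZeroSums.1 hb).1 i) ?_
        intro b hb b' hb' (hbb : b i = b' i)
        have e1 := (mem_minZeroSums.1 hb).2.2.1
        have e2 := (mem_minZeroSums.1 hb').2.2.1
        rw [hu, Finset.sum_pair hij] at e1 e2
        have e3 : b j = b' j := by
          rw [eq_neg_of_add_eq_zero_right e1, eq_neg_of_add_eq_zero_right e2, hbb]
        funext k
        have hk : k ∈ ({i, j} : Finset ι) := hu ▸ Finset.mem_univ k
        rw [Finset.mem_insert, Finset.mem_singleton] at hk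
        rcases hk with rfl | rfl
        · exact hbb
        · exact e3
      rw [h2]
      calc ((minZeroSums ι B).card : ℝ) ≤ B.card := by exact_mod_cast hle
        _ ≤ c * ν ^ 4 := h.card_le
        _ ≤ (c + 1) * ν ^ (2 * 2) := by
          norm_num
          gcongr
          linarith

/-- Peel off the minimal block through a fixed index and induct on the length; the number of choices
of block depends on the length only. -/
theorem exists_card_zeroSums_le {c : ℝ} (hc : 0 ≤ c) (r : ℕ) :
    ∃ C : ℝ, 0 ≤ C ∧ ∀ (A : Type) [AddCommGroup A] (ν : ℝ) (B : Finset A), IsSparse c r ν B →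
      ∀ (ι : Type) [Fintype ι], Fintype.card ι ≤ r →
        ((zeroSums ι B).card : ℝ) ≤ C * ν ^ (2 * Fintype.card ι) := by
  classical
  suffices H : ∀ k, ∃ C : ℝ, 0 ≤ C ∧ ∀ (A : Type) [AddCommGroup A] (ν : ℝ) (B : Finset A),
      IsSparse c r ν B → ∀ (ι : Type) [Fintype ι], Fintype.card ι ≤ k → Fintype.card ι ≤ r →
        ((zeroSums ι B).card : ℝ) ≤ C * ν ^ (2 * Fintype.card ι) by
    obtain ⟨C, hC, h⟩ := H r
    exact ⟨C, hC, fun A _ ν B hB ι _ hι => h A ν B hB ι hι hι⟩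
  intro k
  induction k with
  | zero =>
    refine ⟨1, zero_le_one, fun A _ ν B hB ι _ hι _ => ?_⟩
    have h0 : Fintype.card ι = 0 := by omega
    have := Fintype.card_eq_zero_iff.1 h0
    rw [h0]
    have : (zeroSums ι B).card ≤ 1 := Finset.card_le_one.2 fun a _ b _ => Subsingleton.elim a b
    simpa using this
  | succ k ih =>
    obtain ⟨C, hC, ih⟩ := ih
    refine ⟨C + 2 ^ (k + 1) * ((c + 1) * C), by positivity, fun A _ ν B hB ι _ hι hr => ?_⟩
    have hν : 0 ≤ ν := zero_le_one.trans hB.one_le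
    by_cases hk : Fintype.card ι ≤ k
    · refine (ih A ν B hB ι hk hr).trans ?_
      gcongr
      have : (0 : ℝ) ≤ 2 ^ (k + 1) * ((c + 1) * C) := by positivity
      linarith
    · have hk' : Fintype.card ι = k + 1 := by omega
      have : Nonempty ι := Fintype.card_pos_iff.1 (by omega)
      obtain ⟨i₀⟩ := this
      have hcover : zeroSums ι B ⊆
          ((Finset.univ : Finset (Finset ι)).filter fun I => i₀ ∈ I).biUnion
          fun I => (zeroSums ι B).filter fun b => MinZero b I := by
        intro b hb
        obtain ⟨I, -, hI, hIm⟩ :=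
          exists_minZero_mem b (Finset.mem_univ i₀) (mem_zeroSums.1 hb).2
        rw [Finset.mem_biUnion]
        exact ⟨I, by simpa using hI, Finset.mem_filter.2 ⟨hb, hIm⟩⟩
      have hterm : ∀ I ∈ (Finset.univ : Finset (Finset ι)).filter fun I => i₀ ∈ I,
          (((zeroSums ι B).filter fun b => MinZero b I).card : ℝ) ≤
            (c + 1) * C * ν ^ (2 * Fintype.card ι) := by
        intro I hI
        have hi₀ : i₀ ∈ I := by simpa using hI
        have hIpos : 0 < I.card := Finset.card_pos.2 ⟨i₀, hi₀⟩
        have hIle : I.card ≤ Fintype.card ι := Finset.card_le_univ I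
        have hIc : Fintype.card (Iᶜ : Finset ι) = Fintype.card ι - I.card := by
          rw [Fintype.card_coe, Finset.card_compl]
        have e1 := hB.card_minZeroSums_le_pow hc I (by rw [Fintype.card_coe]; omega)
        have e2 := ih A ν B hB (Iᶜ : Finset ι) (by omega) (by omega)
        rw [Fintype.card_coe] at e1
        rw [hIc] at e2
        calc (((zeroSums ι B).filter fun b => MinZero b I).card : ℝ)
            ≤ (minZeroSums I B).card * (zeroSums (Iᶜ : Finset ι) B).card := by
              exact_mod_cast card_filter_minZero_le B I
          _ ≤ ((c + 1) * ν ^ (2 * I.card)) * (C * ν ^ (2 * (Fintype.card ι - I.card))) := by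
              gcongr
          _ = (c + 1) * C * ν ^ (2 * I.card + 2 * (Fintype.card ι - I.card)) := by
              rw [pow_add]; ring
          _ = _ := by congr 2; omega
      calc ((zeroSums ι B).card : ℝ)
          ≤ ∑ I ∈ (Finset.univ : Finset (Finset ι)).filter fun I => i₀ ∈ I,
              (((zeroSums ι B).filter fun b => MinZero b I).card : ℝ) := by
            exact_mod_cast (Finset.card_le_card hcover).trans Finset.card_biUnion_le
        _ ≤ ((Finset.univ : Finset (Finset ι)).filter fun I => i₀ ∈ I).card •
              ((c + 1) * C * ν ^ (2 * Fintype.card ι)) := Finset.sum_le_card_nsmul _ _ _ hterm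
        _ ≤ 2 ^ (k + 1) * ((c + 1) * C * ν ^ (2 * Fintype.card ι)) := by
            rw [nsmul_eq_mul]
            gcongr
            have : ((Finset.univ : Finset (Finset ι)).filter fun I => i₀ ∈ I).card ≤ 2 ^ (k + 1) :=
              (Finset.card_le_univ _).trans (by rw [Fintype.card_finset, hk'])
            exact_mod_cast this
        _ ≤ _ := by
            have : 0 ≤ C * ν ^ (2 * Fintype.card ι) := by positivity
            linarith

/-- The weighted number of zero sums of length `r`. -/
noncomputable def zeroSumWeight (B : Finset A) (w : A → ℂ) (r : ℕ) : ℂ :=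
  ∑ b ∈ zeroSums (Fin r) B, ∏ i, w (b i)

-- When entry `0` cancels against a prescribed other entry, the remaining `r` entries form an
-- arbitrary zero sum; this is the source of the Gaussian recursion.
open Classical in
theorem sum_paired_eq_mul (B : Finset A) (w : A → ℂ) (r : ℕ) (k : Fin (r + 1)) :
    ∑ b ∈ (zeroSums (Fin (r + 2)) B).filter fun b => b k.succ = -b 0, ∏ i, w (b i) =
      zeroSumWeight B w 2 * zeroSumWeight B w r := by
  rw [zeroSumWeight, zeroSumWeight, Finset.sum_mul_sum, ← Finset.sum_product']
  refine Finset.sum_bij'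
    (fun b _ => (![b 0, b k.succ], fun j => b (k.succAbove j).succ))
    (fun x _ => Fin.cons (x.1 0) (k.insertNth (α := fun _ => A) (x.1 1) x.2)) ?_ ?_ ?_ ?_ ?_
  · intro b hb
    rw [Finset.mem_filter, mem_zeroSums, Fin.sum_univ_succ, Fin.sum_univ_succAbove _ k] at hb
    obtain ⟨⟨hB, hs⟩, hk⟩ := hb
    rw [Finset.mem_product, mem_zeroSums, mem_zeroSums]
    refine ⟨⟨fun i => ?_, ?_⟩, fun i => hB _, ?_⟩
    · fin_cases i
      · exact hB 0
      · exact hB _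
    · simp [hk]
    · rw [hk, ← add_assoc, add_neg_cancel, zero_add] at hs
      exact hs
  · intro x hx
    rw [Finset.mem_product, mem_zeroSums, mem_zeroSums, Fin.sum_univ_two] at hx
    obtain ⟨⟨hB1, hs1⟩, hB2, hs2⟩ := hx
    rw [Finset.mem_filter, mem_zeroSums, Fin.sum_univ_succ, Fin.sum_univ_succAbove _ k]
    refine ⟨⟨fun i => ?_, ?_⟩, ?_⟩
    · refine Fin.cases ?_ (fun i => ?_) i
      · exact hB1 0
      · rw [Fin.cons_succ]
        refine Fin.succAboveCases k ?_ (fun j => ?_) i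
        · rw [Fin.insertNth_apply_same]
          exact hB1 1
        · rw [Fin.insertNth_apply_succAbove]
          exact hB2 j
    · simp only [Fin.cons_zero, Fin.cons_succ, Fin.insertNth_apply_same,
        Fin.insertNth_apply_succAbove, hs2, add_zero, hs1]
    · simp only [Fin.cons_zero, Fin.cons_succ, Fin.insertNth_apply_same]
      exact eq_neg_of_add_eq_zero_right hs1
  · intro b _
    funext i
    refine Fin.cases ?_ (fun i => ?_) i
    · rfl
    · simp only [Fin.cons_succ]
      refine Fin.succAboveCases k ?_ (fun j => ?_) i
      · simp
      · simp
  · intro x _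
    refine Prod.ext ?_ ?_
    · funext i
      fin_cases i <;> simp
    · funext j
      simp
  · intro b _
    rw [Fin.prod_univ_succ, Fin.prod_univ_succAbove _ k, Fin.prod_univ_two]
    simp [mul_assoc]

-- If two entries equal `-b 0`, the three together contribute `-b 0`; deleting the two and flipping
-- the sign of `b 0` keeps the sum zero and saves two positions.
open Classical in
theorem card_filter_two_pairs_le {B : Finset A} (hneg : ∀ b ∈ B, -b ∈ B) {r : ℕ}
    {j k : Fin (r + 1)} (hjk : j ≠ k) :
    ((zeroSums (Fin (r + 2)) B).filter fun b => b j.succ = -b 0 ∧ b k.succ = -b 0).card ≤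
      (zeroSums (({j.succ, k.succ}ᶜ : Finset (Fin (r + 2)))) B).card := by
  have hjk' : j.succ ≠ k.succ := fun h => hjk (Fin.succ_injective _ h)
  have h0 : (0 : Fin (r + 2)) ∈ ({j.succ, k.succ}ᶜ : Finset (Fin (r + 2))) := by
    rw [Finset.mem_compl, Finset.mem_insert, Finset.mem_singleton, not_or]
    exact ⟨(Fin.succ_ne_zero j).symm, (Fin.succ_ne_zero k).symm⟩
  refine Finset.card_le_card_of_injOn (fun b i => if (i : Fin (r + 2)) = 0 then -b 0 else b i) ?_ ?_
  · intro b hb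
    rw [Finset.mem_coe, Finset.mem_filter, mem_zeroSums] at hb
    obtain ⟨⟨hB, hs⟩, hj, hk⟩ := hb
    rw [Finset.mem_coe, mem_zeroSums]
    refine ⟨fun i => ?_, ?_⟩
    · dsimp only
      split_ifs
      · exact hneg _ (hB 0)
      · exact hB i
    · rw [Finset.univ_eq_attach, Finset.sum_attach ({j.succ, k.succ}ᶜ : Finset (Fin (r + 2)))
        (fun i => if i = 0 then -b 0 else b i)]
      have e1 := Finset.sum_add_sum_compl {j.succ, k.succ} b
      rw [Finset.sum_pair hjk', hj, hk, hs, ← Finset.add_sum_erase _ _ h0] at e1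
      rw [← Finset.add_sum_erase _ _ h0, if_pos rfl]
      rw [Finset.sum_congr rfl fun i hi => if_neg (Finset.ne_of_mem_erase hi)]
      rw [← e1]
      abel
  · intro b hb b' hb' h
    rw [Finset.mem_coe, Finset.mem_filter] at hb hb'
    have h00 : b 0 = b' 0 := by
      have := congrFun h ⟨0, h0⟩
      simpa using this
    funext i
    by_cases hi0 : i = 0
    · rw [hi0, h00]
    by_cases hi : i ∈ ({j.succ, k.succ}ᶜ : Finset (Fin (r + 2)))
    · have := congrFun h ⟨i, hi⟩
      simpa [hi0] using this
    · rw [Finset.mem_compl, not_not, Finset.mem_insert, Finset.mem_singleton] at hi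
      rcases hi with rfl | rfl
      · rw [hb.2.1, hb'.2.1, h00]
      · rw [hb.2.2, hb'.2.2, h00]

open Classical in
/-- The families in which the first entry does not cancel against exactly one other entry. -/
theorem exists_card_badZeroSums_le {c : ℝ} (hc : 0 ≤ c) (r : ℕ) :
    ∃ C : ℝ, 0 ≤ C ∧ ∀ (A : Type) [AddCommGroup A] (ν : ℝ) (B : Finset A),
      IsSparse c (r + 2) ν B →
      (((zeroSums (Fin (r + 2)) B).filter fun b =>
        (Finset.univ.filter fun k : Fin (r + 1) => b k.succ = -b 0).card ≠ 1).card : ℝ) ≤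
          C * ν ^ (2 * r + 3) := by
  obtain ⟨C, hC, hZ⟩ := exists_card_zeroSums_le hc (r + 2)
  refine ⟨2 ^ (r + 2) * C + (r + 1) ^ 2 * C, by positivity, fun A _ ν B hB => ?_⟩
  have hν := hB.one_le
  have hν0 : 0 ≤ ν := zero_le_one.trans hν
  set T := (Finset.univ : Finset (Finset (Fin (r + 2)))).filter fun I => 3 ≤ I.card with hT
  set P := (Finset.univ : Finset (Fin (r + 1) × Fin (r + 1))).filter fun x => x.1 ≠ x.2 with hP
  -- Two partners of entry `0` fall under the second union. With no partner, the minimal block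
  -- through `0` has length at least three: length one would put `0` into `B`, and length two would
  -- give a partner.
  have hcover : ((zeroSums (Fin (r + 2)) B).filter fun b =>
        (Finset.univ.filter fun k : Fin (r + 1) => b k.succ = -b 0).card ≠ 1) ⊆
      (T.biUnion fun I => (zeroSums (Fin (r + 2)) B).filter fun b => MinZero b I) ∪
      (P.biUnion fun x => (zeroSums (Fin (r + 2)) B).filter fun b =>
        b x.1.succ = -b 0 ∧ b x.2.succ = -b 0) := by
    intro b hb
    rw [Finset.mem_filter] at hb
    obtain ⟨hbZ, hn⟩ := hb
    rw [Finset.mem_union, Finset.mem_biUnion, Finset.mem_biUnion]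
    by_cases h2 : 1 < (Finset.univ.filter fun k : Fin (r + 1) => b k.succ = -b 0).card
    · right
      obtain ⟨j, hj, k, hk, hjk⟩ := Finset.one_lt_card.1 h2
      exact ⟨(j, k), by simpa [hP] using hjk, Finset.mem_filter.2
        ⟨hbZ, (Finset.mem_filter.1 hj).2, (Finset.mem_filter.1 hk).2⟩⟩
    · left
      have h0 : (Finset.univ.filter fun k : Fin (r + 1) => b k.succ = -b 0).card = 0 := by omega
      rw [Finset.card_eq_zero, Finset.filter_eq_empty_iff] at h0
      obtain ⟨hbB, hbs⟩ := mem_zeroSums.1 hbZ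
      obtain ⟨I, -, hI, hIm⟩ := exists_minZero_mem b (Finset.mem_univ 0) hbs
      refine ⟨I, ?_, Finset.mem_filter.2 ⟨hbZ, hIm⟩⟩
      rw [hT, Finset.mem_filter]
      refine ⟨Finset.mem_univ _, ?_⟩
      by_contra hlt
      have hpos : 0 < I.card := Finset.card_pos.2 ⟨0, hI⟩
      have h12 : I.card = 1 ∨ I.card = 2 := by omega
      rcases h12 with h1 | h2
      · obtain ⟨i, rfl⟩ := Finset.card_eq_one.1 h1
        have := hIm.2.1
        rw [Finset.sum_singleton] at this
        exact hB.zero_notMem (this ▸ hbB i)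
      · have h1 : (I.erase 0).card = 1 := by rw [Finset.card_erase_of_mem hI, h2]
        obtain ⟨i, hi⟩ := Finset.card_eq_one.1 h1
        have hi0 : i ≠ 0 := Finset.ne_of_mem_erase (hi ▸ Finset.mem_singleton_self i)
        obtain ⟨k, rfl⟩ := Fin.exists_succ_eq_of_ne_zero hi0
        have := hIm.2.1
        rw [← Finset.add_sum_erase _ _ hI, hi, Finset.sum_singleton] at this
        exact h0 (Finset.mem_univ k) (eq_neg_of_add_eq_zero_right this)
  have hT' : ∀ I ∈ T, (((zeroSums (Fin (r + 2)) B).filter fun b => MinZero b I).card : ℝ) ≤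
      C * ν ^ (2 * r + 3) := by
    intro I hI
    have h3 : 3 ≤ I.card := by simpa [hT] using hI
    have hIle : I.card ≤ r + 2 := by simpa using Finset.card_le_univ I
    have hIc : Fintype.card (Iᶜ : Finset (Fin (r + 2))) = r + 2 - I.card := by
      rw [Fintype.card_coe, Finset.card_compl, Fintype.card_fin]
    have e1 := hB.card_minZeroSums_le I (by rwa [Fintype.card_coe]) (by rwa [Fintype.card_coe])
    have e2 := hZ A ν B hB (Iᶜ : Finset (Fin (r + 2))) (by omega)
    calc (((zeroSums (Fin (r + 2)) B).filter fun b => MinZero b I).card : ℝ)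
        ≤ (minZeroSums I B).card * (zeroSums (Iᶜ : Finset (Fin (r + 2))) B).card := by
          exact_mod_cast card_filter_minZero_le B I
      _ ≤ ν ^ 5 * (C * ν ^ (2 * (r + 2 - I.card))) := by
          rw [hIc] at e2
          gcongr
      _ = C * ν ^ (5 + 2 * (r + 2 - I.card)) := by rw [pow_add]; ring
      -- The exponents agree when the block has three elements: a triple costs `ν ^ 5` instead of `ν
      -- ^ 6`, and this one factor `ν` drives the limit theorem.
      _ ≤ C * ν ^ (2 * r + 3) :=
          mul_le_mul_of_nonneg_left (pow_le_pow_right₀ hν (by omega)) hC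
  have hP' : ∀ x ∈ P, (((zeroSums (Fin (r + 2)) B).filter fun b =>
      b x.1.succ = -b 0 ∧ b x.2.succ = -b 0).card : ℝ) ≤ C * ν ^ (2 * r + 3) := by
    intro x hx
    have hne : x.1 ≠ x.2 := by simpa [hP] using hx
    have hne' : x.1.succ ≠ x.2.succ := fun h => hne (Fin.succ_injective _ h)
    have hcc : Fintype.card ({x.1.succ, x.2.succ}ᶜ : Finset (Fin (r + 2))) = r := by
      rw [Fintype.card_coe, Finset.card_compl, Fintype.card_fin, Finset.card_pair hne']
      omega
    have e2 := hZ A ν B hB ({x.1.succ, x.2.succ}ᶜ : Finset (Fin (r + 2))) (by omega)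
    rw [hcc] at e2
    calc (((zeroSums (Fin (r + 2)) B).filter fun b =>
          b x.1.succ = -b 0 ∧ b x.2.succ = -b 0).card : ℝ)
        ≤ (zeroSums (({x.1.succ, x.2.succ}ᶜ : Finset (Fin (r + 2)))) B).card := by
          exact_mod_cast card_filter_two_pairs_le hB.neg_mem hne
      _ ≤ C * ν ^ (2 * r) := e2
      _ ≤ C * ν ^ (2 * r + 3) :=
          mul_le_mul_of_nonneg_left (pow_le_pow_right₀ hν (by omega)) hC
  have hTc : (T.card : ℝ) ≤ 2 ^ (r + 2) := by
    have : T.card ≤ 2 ^ (r + 2) := (Finset.card_le_univ _).trans (by simp)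
    exact_mod_cast this
  have hPc : (P.card : ℝ) ≤ (r + 1) ^ 2 := by
    have : P.card ≤ (r + 1) ^ 2 := (Finset.card_le_univ _).trans (by simp [sq])
    exact_mod_cast this
  calc _ ≤ ∑ I ∈ T, (((zeroSums (Fin (r + 2)) B).filter fun b => MinZero b I).card : ℝ) +
        ∑ x ∈ P, (((zeroSums (Fin (r + 2)) B).filter fun b =>
          b x.1.succ = -b 0 ∧ b x.2.succ = -b 0).card : ℝ) := by
        exact_mod_cast (Finset.card_le_card hcover).trans ((Finset.card_union_le _ _).trans
          (Nat.add_le_add Finset.card_biUnion_le Finset.card_biUnion_le))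
    _ ≤ T.card • (C * ν ^ (2 * r + 3)) + P.card • (C * ν ^ (2 * r + 3)) :=
        add_le_add (Finset.sum_le_card_nsmul _ _ _ hT') (Finset.sum_le_card_nsmul _ _ _ hP')
    _ ≤ 2 ^ (r + 2) * (C * ν ^ (2 * r + 3)) + (r + 1) ^ 2 * (C * ν ^ (2 * r + 3)) := by
        rw [nsmul_eq_mul, nsmul_eq_mul]
        gcongr
    _ = _ := by ring

/-- The moments of a sparse trigonometric sum satisfy the Gaussian recursion up to a small error. -/
theorem exists_norm_zeroSumWeight_sub_le {c : ℝ} (hc : 0 ≤ c) (r : ℕ) :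
    ∃ C : ℝ, 0 ≤ C ∧ ∀ (A : Type) [AddCommGroup A] (ν : ℝ) (B : Finset A) (w : A → ℂ),
      IsSparse c (r + 2) ν B → (∀ b ∈ B, ‖w b‖ ≤ c) →
      ‖zeroSumWeight B w (r + 2) - (r + 1) * zeroSumWeight B w 2 * zeroSumWeight B w r‖ ≤
        C * ν ^ (2 * r + 3) := by
  classical
  obtain ⟨C, hC, hbad⟩ := exists_card_badZeroSums_le hc r
  refine ⟨(r + 2) * c ^ (r + 2) * C, by positivity, fun A _ ν B w hB hw => ?_⟩
  set Z := zeroSums (Fin (r + 2)) B with hZ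
  let n : (Fin (r + 2) → A) → ℕ :=
    fun b => (Finset.univ.filter fun k : Fin (r + 1) => b k.succ = -b 0).card
  -- Summing over the possible partners of entry `0` counts each zero sum as often as it has
  -- partners, so only tuples without exactly one partner contribute to the difference.
  have h1 : (r + 1) * zeroSumWeight B w 2 * zeroSumWeight B w r =
      ∑ b ∈ Z, (n b : ℂ) * ∏ i, w (b i) := by
    calc (r + 1) * zeroSumWeight B w 2 * zeroSumWeight B w r
        = ∑ k : Fin (r + 1), zeroSumWeight B w 2 * zeroSumWeight B w r := by
          rw [Finset.sum_const, Finset.card_univ, Fintype.card_fin, nsmul_eq_mul]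
          push_cast
          ring
      _ = ∑ k : Fin (r + 1), ∑ b ∈ Z, if b k.succ = -b 0 then ∏ i, w (b i) else 0 := by
          refine Finset.sum_congr rfl fun k _ => ?_
          rw [← sum_paired_eq_mul B w r k, Finset.sum_filter]
      _ = _ := by
          rw [Finset.sum_comm]
          refine Finset.sum_congr rfl fun b _ => ?_
          rw [← Finset.sum_filter, Finset.sum_const, nsmul_eq_mul]
  have h2 : zeroSumWeight B w (r + 2) - (r + 1) * zeroSumWeight B w 2 * zeroSumWeight B w r =
      ∑ b ∈ Z.filter fun b => n b ≠ 1, (1 - (n b : ℂ)) * ∏ i, w (b i) := by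
    rw [h1, zeroSumWeight, ← Finset.sum_sub_distrib, Finset.sum_filter]
    refine Finset.sum_congr rfl fun b _ => ?_
    split_ifs with h
    · ring
    · rw [not_not] at h
      rw [h]
      simp
  rw [h2]
  have h3 : ∀ b ∈ Z.filter fun b => n b ≠ 1, ‖(1 - (n b : ℂ)) * ∏ i, w (b i)‖ ≤
      (r + 2) * c ^ (r + 2) := by
    intro b hb
    have hbB := (mem_zeroSums.1 (Finset.mem_filter.1 hb).1).1
    have hn : n b ≤ r + 1 := (Finset.card_le_univ _).trans (by simp)
    rw [norm_mul, norm_prod]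
    have e1 : ‖(1 - (n b : ℂ))‖ ≤ r + 2 := by
      calc ‖(1 - (n b : ℂ))‖ ≤ ‖(1 : ℂ)‖ + ‖(n b : ℂ)‖ := norm_sub_le _ _
        _ = 1 + n b := by simp
        _ ≤ r + 2 := by
          have : (n b : ℝ) ≤ r + 1 := by exact_mod_cast hn
          linarith
    have e2 : ∏ i, ‖w (b i)‖ ≤ c ^ (r + 2) := by
      calc ∏ i, ‖w (b i)‖ ≤ ∏ _i : Fin (r + 2), c :=
            Finset.prod_le_prod (fun i _ => norm_nonneg _) fun i _ => hw _ (hbB i)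
        _ = c ^ (r + 2) := by simp
    gcongr
  calc _ ≤ (Z.filter fun b => n b ≠ 1).card • (((r : ℝ) + 2) * c ^ (r + 2)) :=
        (norm_sum_le _ _).trans (Finset.sum_le_card_nsmul _ _ _ h3)
    _ ≤ (C * ν ^ (2 * r + 3)) * ((r + 2) * c ^ (r + 2)) := by
        rw [nsmul_eq_mul]
        gcongr
        exact hbad A ν B hB
    _ = _ := by ring

end ZeroSums

/-! ### The method of moments for a Gaussian limit -/

section Moments

/-- The derivative of one Taylor remainder is `θ` times the preceding one, and the bounds are
related in the same way; a comparison of derivatives gives the induction. -/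
theorem norm_exp_mul_sub_taylor_le {θ : ℂ} (hθ : θ.re = 0) (hθ1 : ‖θ‖ = 1) (n : ℕ) {x : ℝ}
    (hx : 0 ≤ x) :
    ‖Complex.exp (x * θ) - ∑ k ∈ Finset.range n, (x * θ) ^ k / (k.factorial : ℂ)‖ ≤
      x ^ n / n.factorial := by
  induction n generalizing x with
  | zero =>
    simp [Complex.norm_exp, hθ]
  | succ n ih =>
    have hderiv : ∀ y : ℝ, HasDerivAt
        (fun y : ℝ => Complex.exp (y * θ) -
          ∑ k ∈ Finset.range (n + 1), (y * θ) ^ k / (k.factorial : ℂ))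
        (θ * (Complex.exp (y * θ) - ∑ k ∈ Finset.range n, (y * θ) ^ k / (k.factorial : ℂ))) y := by
      intro y
      have h1 : HasDerivAt (fun y : ℝ => (y : ℂ) * θ) θ y := by
        simpa using (Complex.ofRealCLM.hasDerivAt (x := y)).mul_const θ
      have h2 : HasDerivAt (fun y : ℝ => ∑ k ∈ Finset.range (n + 1),
          ((y : ℂ) * θ) ^ k / (k.factorial : ℂ))
          (∑ k ∈ Finset.range (n + 1), ((k : ℂ) * ((y : ℂ) * θ) ^ (k - 1) * θ) /
            (k.factorial : ℂ)) y :=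
        HasDerivAt.fun_sum fun k _ => (h1.fun_pow k).div_const _
      convert! h1.cexp.sub h2 using 1
      rw [Finset.sum_range_succ', mul_sub, Finset.mul_sum]
      congr 1
      · ring
      · simp only [Nat.cast_zero, zero_mul, zero_div, add_zero]
        refine Finset.sum_congr rfl fun k _ => ?_
        rw [Nat.add_sub_cancel, Nat.factorial_succ]
        push_cast
        have : (k.factorial : ℂ) ≠ 0 := by exact_mod_cast k.factorial_ne_zero
        have : (k : ℂ) + 1 ≠ 0 := by exact_mod_cast k.succ_ne_zero
        field_simp
    have hB : ∀ y : ℝ, HasDerivAt (fun y : ℝ => y ^ (n + 1) / ((n + 1).factorial : ℝ))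
        (y ^ n / n.factorial) y := by
      intro y
      convert! (hasDerivAt_pow (n + 1) y).div_const ((n + 1).factorial : ℝ) using 1
      rw [Nat.factorial_succ]
      push_cast
      have : (n.factorial : ℝ) ≠ 0 := by exact_mod_cast n.factorial_ne_zero
      have : (n : ℝ) + 1 ≠ 0 := by exact_mod_cast n.succ_ne_zero
      field_simp
    refine image_norm_le_of_norm_deriv_right_le_deriv_boundary (a := 0) (b := x)
      (f := fun y : ℝ => Complex.exp (y * θ) -
          ∑ k ∈ Finset.range (n + 1), (y * θ) ^ k / (k.factorial : ℂ))
      (fun y _ => (hderiv y).continuousAt.continuousWithinAt)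
      (fun y _ => (hderiv y).hasDerivWithinAt) ?_ hB ?_ (Set.right_mem_Icc.2 hx)
    · simp [Finset.sum_range_succ']
    · intro y hy
      rw [norm_mul, hθ1, one_mul]
      exact ih hy.1

theorem norm_exp_mul_I_sub_taylor_le (n : ℕ) (x : ℝ) :
    ‖Complex.exp (x * Complex.I) -
      ∑ k ∈ Finset.range n, (x * Complex.I) ^ k / (k.factorial : ℂ)‖ ≤ |x| ^ n / n.factorial := by
  rcases le_total 0 x with hx | hx
  · rw [abs_of_nonneg hx]
    exact norm_exp_mul_sub_taylor_le (by simp) (by simp) n hx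
  · have := norm_exp_mul_sub_taylor_le (θ := -Complex.I) (by simp) (by simp) n (neg_nonneg.2 hx)
    rw [abs_of_nonpos hx]
    simpa using this

/-- The moments of the centred Gaussian law of variance `v`. -/
noncomputable def gaussianMoment (v : ℝ) : ℕ → ℝ
  | 0 => 1
  | 1 => 0
  | r + 2 => (r + 1) * v * gaussianMoment v r

theorem gaussianMoment_odd (v : ℝ) (k : ℕ) : gaussianMoment v (2 * k + 1) = 0 := by
  induction k with
  | zero => rfl
  | succ k ih =>
    rw [show 2 * (k + 1) + 1 = (2 * k + 1) + 2 by ring, gaussianMoment, ih, mul_zero]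

theorem gaussianMoment_even (v : ℝ) (k : ℕ) :
    gaussianMoment v (2 * k) / (2 * k).factorial = (v / 2) ^ k / k.factorial := by
  induction k with
  | zero => simp [gaussianMoment]
  | succ k ih =>
    rw [show 2 * (k + 1) = 2 * k + 2 by ring, gaussianMoment, Nat.factorial_succ,
      Nat.factorial_succ, Nat.factorial_succ k, pow_succ]
    push_cast
    have h1 : ((2 * k).factorial : ℝ) ≠ 0 := by exact_mod_cast (2 * k).factorial_ne_zero
    have h2 : (k.factorial : ℝ) ≠ 0 := by exact_mod_cast k.factorial_ne_zero
    have h3 : (k : ℝ) + 1 ≠ 0 := by exact_mod_cast k.succ_ne_zero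
    have h4 : (2 * (k : ℝ) + 1 + 1) ≠ 0 := by positivity
    have h5 : (2 * (k : ℝ) + 1) ≠ 0 := by positivity
    rw [div_eq_div_iff h1 h2] at ih
    rw [div_eq_div_iff (by positivity) (by positivity)]
    linear_combination (2 * (k : ℝ) + 1) * v * (k + 1) * ih

/-- Odd terms vanish and the even ones are the Taylor terms of the Gaussian characteristic function.
-/
theorem sum_range_two_mul_gaussianMoment (v t : ℝ) (K : ℕ) :
    ∑ k ∈ Finset.range (2 * K), (t * Complex.I) ^ k / (k.factorial : ℂ) * gaussianMoment v k =
      ∑ k ∈ Finset.range K, (-(v * t ^ 2 / 2) : ℂ) ^ k / (k.factorial : ℂ) := by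
  induction K with
  | zero => simp
  | succ K ih =>
    rw [show 2 * (K + 1) = 2 * K + 1 + 1 by ring, Finset.sum_range_succ, Finset.sum_range_succ, ih,
      Finset.sum_range_succ, gaussianMoment_odd]
    have h := congrArg (fun x : ℝ => (x : ℂ)) (gaussianMoment_even v K)
    push_cast at h
    rw [div_mul_eq_mul_div, mul_div_assoc ((t * Complex.I : ℂ) ^ (2 * K)), h, pow_mul,
      mul_pow, Complex.I_sq,
      show (-(v * t ^ 2 / 2) : ℂ) = (t ^ 2 * -1) * (v / 2) by ring, mul_pow _ ((v : ℂ) / 2)]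
    simp only [Complex.ofReal_zero, mul_zero, add_zero, add_right_inj]
    ring

variable {Ω : Type*} [MeasurableSpace Ω] {μ : Measure Ω} [IsProbabilityMeasure μ]

theorem tendsto_moment {X : ℕ → Ω → ℝ} {v : ℝ}
    (h1 : Tendsto (fun n => ∫ x, X n x ∂μ) atTop (𝓝 0))
    (h2 : Tendsto (fun n => ∫ x, X n x ^ 2 ∂μ) atTop (𝓝 v))
    (hrec : ∀ r : ℕ, Tendsto (fun n => ∫ x, X n x ^ (r + 2) ∂μ -
      (r + 1) * (∫ x, X n x ^ 2 ∂μ) * ∫ x, X n x ^ r ∂μ) atTop (𝓝 0)) (r : ℕ) :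
    Tendsto (fun n => ∫ x, X n x ^ r ∂μ) atTop (𝓝 (gaussianMoment v r)) := by
  induction r using Nat.strong_induction_on with
  | _ r ih =>
    match r with
    | 0 => simp [gaussianMoment]
    | 1 => simpa [gaussianMoment] using h1
    | r + 2 =>
      have h3 := (hrec r).add ((h2.const_mul ((r : ℝ) + 1)).mul (ih r (by omega)))
      simpa [gaussianMoment] using h3

/-- The method of moments for a Gaussian limit. -/
theorem tendsto_integral_exp_of_moments {X : ℕ → Ω → ℝ} {v : ℝ}
    (hX : ∀ n, AEStronglyMeasurable (X n) μ)
    (hint : ∀ n r, Integrable (fun x => X n x ^ r) μ)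
    (h1 : Tendsto (fun n => ∫ x, X n x ∂μ) atTop (𝓝 0))
    (h2 : Tendsto (fun n => ∫ x, X n x ^ 2 ∂μ) atTop (𝓝 v))
    (hrec : ∀ r : ℕ, Tendsto (fun n => ∫ x, X n x ^ (r + 2) ∂μ -
      (r + 1) * (∫ x, X n x ^ 2 ∂μ) * ∫ x, X n x ^ r ∂μ) atTop (𝓝 0)) (t : ℝ) :
    Tendsto (fun n => ∫ x, Complex.exp (t * X n x * Complex.I) ∂μ) atTop
      (𝓝 (Complex.exp (-(v * t ^ 2 / 2)))) := by
  have hm := tendsto_moment h1 h2 hrec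
  -- Cutting at an even order bounds the remainder by a genuine moment. Its limit in `n` is known,
  -- and by `herr` that limit tends to `0` in `K`.
  have hbound : ∀ K n, ‖∫ x, Complex.exp (t * X n x * Complex.I) ∂μ -
      ∑ k ∈ Finset.range (2 * K), (t * Complex.I) ^ k / (k.factorial : ℂ) *
        ((∫ x, X n x ^ k ∂μ : ℝ) : ℂ)‖ ≤
      t ^ (2 * K) / (2 * K).factorial * ∫ x, X n x ^ (2 * K) ∂μ := by
    intro K n
    have hterm : ∀ k, Integrable (fun x => (t * X n x * Complex.I) ^ k / (k.factorial : ℂ)) μ := by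
      intro k
      have := ((hint n k).ofReal (𝕜 := ℂ)).const_mul ((t * Complex.I) ^ k / (k.factorial : ℂ))
      refine this.congr (Eventually.of_forall fun x => ?_)
      simp only [RCLike.ofReal_pow, Complex.coe_algebraMap]
      ring_nf
    have hexp : Integrable (fun x => Complex.exp (t * X n x * Complex.I)) μ := by
      refine Integrable.of_bound (C := 1) ?_ (Eventually.of_forall fun x => ?_)
      · have hc : Continuous fun y : ℝ => Complex.exp (t * y * Complex.I) := by fun_prop
        exact hc.comp_aestronglyMeasurable (hX n)
      · rw [← Complex.ofReal_mul, Complex.norm_exp_ofReal_mul_I]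
    have hs : ∑ k ∈ Finset.range (2 * K), (t * Complex.I) ^ k / (k.factorial : ℂ) *
        ((∫ x, X n x ^ k ∂μ : ℝ) : ℂ) =
        ∫ x, ∑ k ∈ Finset.range (2 * K), (t * X n x * Complex.I) ^ k / (k.factorial : ℂ) ∂μ := by
      rw [integral_finsetSum _ fun k _ => hterm k]
      refine Finset.sum_congr rfl fun k _ => ?_
      rw [← integral_complex_ofReal, ← integral_const_mul]
      refine integral_congr_ae (Eventually.of_forall fun x => ?_)
      push_cast
      ring
    rw [hs, ← integral_sub hexp (integrable_finsetSum _ fun k _ => hterm k),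
      ← integral_const_mul]
    refine norm_integral_le_of_norm_le ((hint n (2 * K)).const_mul _)
      (Eventually.of_forall fun x => ?_)
    have := norm_exp_mul_I_sub_taylor_le (2 * K) (t * X n x)
    rw [Even.pow_abs (even_two_mul K), mul_pow] at this
    push_cast at this
    calc _ ≤ _ := this
      _ = _ := by ring
  have herr : Tendsto (fun K : ℕ => t ^ (2 * K) / (2 * K).factorial * gaussianMoment v (2 * K))
      atTop (𝓝 0) := by
    have := FloorSemiring.tendsto_pow_div_factorial_atTop (t ^ 2 * (v / 2))
    refine this.congr fun K => ?_
    rw [mul_pow, mul_div_assoc, ← gaussianMoment_even, pow_mul]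
    ring
  have hlim : Tendsto (fun K : ℕ => ∑ k ∈ Finset.range (2 * K),
      (t * Complex.I) ^ k / (k.factorial : ℂ) * gaussianMoment v k) atTop
      (𝓝 (Complex.exp (-(v * t ^ 2 / 2)))) := by
    simp_rw [sum_range_two_mul_gaussianMoment]
    rw [Complex.exp_eq_exp_ℂ]
    exact (NormedSpace.expSeries_div_hasSum_exp (-(v * t ^ 2 / 2) : ℂ)).tendsto_sum_nat
  rw [Metric.tendsto_nhds]
  intro ε hε
  obtain ⟨K, hK1, hK2⟩ := ((herr.eventually (gt_mem_nhds (by positivity : (0 : ℝ) < ε / 3))).and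
    ((Metric.tendsto_nhds.1 hlim) (ε / 3) (by positivity))).exists
  have e1 : Tendsto (fun n => t ^ (2 * K) / (2 * K).factorial * ∫ x, X n x ^ (2 * K) ∂μ) atTop
      (𝓝 (t ^ (2 * K) / (2 * K).factorial * gaussianMoment v (2 * K))) := (hm _).const_mul _
  have e2 : Tendsto (fun n => ∑ k ∈ Finset.range (2 * K), (t * Complex.I) ^ k /
      (k.factorial : ℂ) * ((∫ x, X n x ^ k ∂μ : ℝ) : ℂ)) atTop
      (𝓝 (∑ k ∈ Finset.range (2 * K), (t * Complex.I) ^ k / (k.factorial : ℂ) *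
        gaussianMoment v k)) :=
    tendsto_finsetSum _ fun k _ => ((Complex.continuous_ofReal.tendsto _).comp (hm k)).const_mul _
  filter_upwards [e1.eventually (gt_mem_nhds hK1), (Metric.tendsto_nhds.1 e2) (ε / 3)
    (by positivity)] with n hn1 hn2
  have hn0 := hbound K n
  rw [← dist_eq_norm] at hn0
  calc _ ≤ _ := dist_triangle4 _
        (∑ k ∈ Finset.range (2 * K), (t * Complex.I) ^ k / (k.factorial : ℂ) *
          ((∫ x, X n x ^ k ∂μ : ℝ) : ℂ))
        (∑ k ∈ Finset.range (2 * K), (t * Complex.I) ^ k / (k.factorial : ℂ) *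
          gaussianMoment v k) _
    _ < ε / 3 + ε / 3 + ε / 3 := by
      gcongr
      exact hn0.trans_lt hn1
    _ = ε := by ring

end Moments

/-! ### Følner averages -/

section Foelner

open scoped symmDiff Pointwise

/-- Pairs are grouped by their difference `q`. Divided by `|D|`, the multiplicity is at most `1` and
tends to `1` along a Følner sequence, so dominated convergence applies. -/
theorem sum_sum_sub_eq_tsum {G : Type*} [AddCommGroup G] [DecidableEq G] {γ : G → ℂ}
    (hγ : Summable γ) (D : Finset G) :
    ∑ l ∈ D, ∑ l' ∈ D, γ (l - l') = ∑' q, ((D.filter fun l => q + l ∈ D).card : ℂ) * γ q := by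
  have h1 : ∀ l' : G, ∑ l ∈ D, γ (l - l') = ∑' q, if q + l' ∈ D then γ q else 0 := by
    intro l'
    have h2 : ∑' l, (if l ∈ D then γ (l - l') else 0) = ∑ l ∈ D, γ (l - l') :=
      (tsum_eq_sum fun l hl => if_neg hl).trans (Finset.sum_congr rfl fun l hl => if_pos hl)
    rw [← h2, ← (Equiv.addRight l').tsum_eq]
    simp
  rw [Finset.sum_comm, Finset.sum_congr rfl fun l' _ => h1 l', ← Summable.tsum_finsetSum]
  · refine tsum_congr fun q => ?_
    rw [← Finset.sum_filter, Finset.sum_const, nsmul_eq_mul]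
  · intro l' _
    refine Summable.of_norm_bounded hγ.norm fun q => ?_
    split_ifs <;> simp

variable {G : Type*} [AddCommGroup G] [MeasurableSpace G] [MeasurableSingletonClass G]

theorem tendsto_card_filter_div_card [DecidableEq G] {D : ℕ → Finset G}
    (hD : IsAddFoelner G Measure.count atTop fun n => (D n : Set G)) (q : G) :
    Tendsto (fun n => (((D n).filter fun l => q + l ∈ D n).card : ℝ) / ((D n).card : ℝ)) atTop
      (𝓝 1) := by
  have h0 := hD.tendsto_meas_vadd_symmDiff q
  have h1 := (ENNReal.tendsto_toReal ENNReal.zero_ne_top).comp h0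
  have h2 := h1.const_sub 1
  simp only [ENNReal.toReal_zero, sub_zero] at h2
  refine tendsto_of_tendsto_of_tendsto_of_le_of_le' h2 tendsto_const_nhds ?_ ?_
  · filter_upwards [hD.eventually_meas_ne_zero] with n hn
    have hpos : 0 < (D n).card := by
      rw [Finset.card_pos]
      rw [ne_eq, Measure.count_eq_zero_iff] at hn
      exact Finset.coe_nonempty.1 (Set.nonempty_iff_ne_empty.2 hn)
    have hsub : ((D n).filter fun l => q + l ∉ D n).card ≤
        ((((D n).image fun l => q + l) \ D n).card) := by
      refine Finset.card_le_card_of_injOn (fun l => q + l) ?_ (add_right_injective q).injOn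
      intro l hl
      rw [Finset.mem_coe, Finset.mem_filter] at hl
      exact Finset.mem_coe.2 (Finset.mem_sdiff.2 ⟨Finset.mem_image_of_mem _ hl.1, hl.2⟩)
    have hset : (q +ᵥ (D n : Set G)) ∆ (D n : Set G) =
        ((((D n).image fun l => q + l) ∆ D n : Finset G) : Set G) := by
      rw [Finset.coe_symmDiff, Finset.coe_image]
      rfl
    have hcard := Finset.card_filter_add_card_filter_not (s := D n) (fun l => q + l ∈ D n)
    have hle : (((D n).image fun l => q + l) \ D n).card ≤
        (((D n).image fun l => q + l) ∆ D n).card :=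
      Finset.card_le_card (by rw [Finset.symmDiff_def]; exact Finset.subset_union_left)
    simp only [Function.comp_apply]
    rw [hset, Measure.count_apply_finset, Measure.count_apply_finset, ENNReal.toReal_div,
      ENNReal.toReal_natCast, ENNReal.toReal_natCast, sub_le_iff_le_add, ← add_div,
      one_le_div (by exact_mod_cast hpos)]
    exact_mod_cast (by omega)
  · refine Eventually.of_forall fun n => div_le_one_of_le₀ ?_ (Nat.cast_nonneg _)
    exact_mod_cast Finset.card_filter_le _ _

/-- Følner averages of a summable kernel converge to its sum. -/
theorem tendsto_sum_sum_sub_div_card {D : ℕ → Finset G}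
    (hD : IsAddFoelner G Measure.count atTop fun n => (D n : Set G)) {γ : G → ℂ}
    (hγ : Summable γ) :
    Tendsto (fun n => (∑ l ∈ D n, ∑ l' ∈ D n, γ (l - l')) / ((D n).card : ℂ)) atTop
      (𝓝 (∑' q, γ q)) := by
  classical
  simp_rw [sum_sum_sub_eq_tsum hγ, ← tsum_div_const]
  refine tendsto_tsum_of_dominated_convergence hγ.norm (fun q => ?_)
    (Eventually.of_forall fun n q => ?_)
  · have := ((Complex.continuous_ofReal.tendsto _).comp
      (tendsto_card_filter_div_card hD q)).mul_const (γ q)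
    rw [Complex.ofReal_one, one_mul] at this
    refine this.congr fun n => ?_
    simp only [Function.comp_apply]
    push_cast
    ring
  · rw [mul_div_right_comm, norm_mul]
    refine mul_le_of_le_one_left (norm_nonneg _) ?_
    rw [norm_div, Complex.norm_natCast, Complex.norm_natCast]
    refine div_le_one_of_le₀ ?_ (Nat.cast_nonneg _)
    exact_mod_cast Finset.card_filter_le _ _

/-- A nonempty finite set is not invariant under a nonzero translation of a torsion-free group, so
at least one point is lost and `1/|D n|` is bounded by the vanishing Følner defect. -/
theorem tendsto_card_atTop_of_isAddFoelner [IsAddTorsionFree G] [Nontrivial G]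
    {D : ℕ → Finset G}
    (hD : IsAddFoelner G Measure.count atTop fun n => (D n : Set G)) :
    Tendsto (fun n => ((D n).card : ℝ)) atTop atTop := by
  classical
  obtain ⟨q, hq⟩ := exists_ne (0 : G)
  have h1 := (tendsto_card_filter_div_card hD q).const_sub 1
  rw [sub_self] at h1
  have h2 : ∀ᶠ n in atTop, 0 < (D n).card := by
    filter_upwards [hD.eventually_meas_ne_zero] with n hn
    rw [Finset.card_pos]
    rw [ne_eq, Measure.count_eq_zero_iff] at hn
    exact Finset.coe_nonempty.1 (Set.nonempty_iff_ne_empty.2 hn)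
  have h3 : Tendsto (fun n => ((D n).card : ℝ)⁻¹) atTop (𝓝[>] 0) := by
    refine tendsto_nhdsWithin_iff.2 ⟨?_, ?_⟩
    · refine tendsto_of_tendsto_of_tendsto_of_le_of_le' tendsto_const_nhds h1
        (Eventually.of_forall fun n => by positivity) ?_
      filter_upwards [h2] with n hn
      have hlt : ((D n).filter fun l => q + l ∈ D n).card < (D n).card := by
        refine lt_of_le_of_ne (Finset.card_filter_le _ _) fun heq => hq ?_
        have hall : ∀ l ∈ D n, q + l ∈ D n := Finset.card_filter_eq_iff.1 heq
        have himg : (D n).image (fun l => q + l) = D n := by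
          refine Finset.eq_of_subset_of_card_le (fun x hx => ?_)
            (Finset.card_image_of_injective _ (add_right_injective q)).ge
          obtain ⟨l, hl, rfl⟩ := Finset.mem_image.1 hx
          exact hall l hl
        -- Comparing the sums of all elements of an invariant set gives `|D n| • q = 0`.
        have hsum : ∑ l ∈ D n, (q + l) = ∑ l ∈ D n, l := by
          conv_rhs => rw [← himg]
          rw [Finset.sum_image (add_right_injective q).injOn]
        rw [Finset.sum_add_distrib, Finset.sum_const, add_eq_right] at hsum
        exact (nsmul_eq_zero_iff_right hn.ne').1 hsum
      rw [le_sub_iff_add_le, inv_eq_one_div, ← add_div, div_le_one (Nat.cast_pos.2 hn)]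
      exact_mod_cast (by omega)
    · filter_upwards [h2] with n hn
      have hn' : (0 : ℝ) < (D n).card := Nat.cast_pos.2 hn
      exact Set.mem_Ioi.2 (inv_pos.2 hn')
  refine (tendsto_inv_nhdsGT_zero.comp h3).congr fun n => ?_
  simp

end Foelner

/-! ### Counting minimal zero sums of monomials with exponents in a box -/

section Counting

open Polynomial

variable {p : ℕ} [Fact p.Prime] {K : Type*} [Field K] [Algebra (ZMod p)[X] K]

theorem MinZero.of_iff {ι A A' : Type*} [AddCommGroup A] [AddCommGroup A'] {b : ι → A}
    {t : ι → A'} {I : Finset ι} (h : MinZero b I)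
    (hbt : ∀ J : Finset ι, ∑ i ∈ J, t i = 0 ↔ ∑ i ∈ J, b i = 0) : MinZero t I :=
  ⟨h.1, (hbt I).2 h.2.1, fun J hJ hne h0 => h.2.2 J hJ hne ((hbt J).1 h0)⟩

theorem log_mul_le {b : ℕ} (hb : 1 < b) (c M : ℕ) : Nat.log b (c * M) ≤ Nat.log b M + c := by
  rcases Nat.eq_zero_or_pos (c * M) with h | h
  · simp [h]
  · have h1 : M < b ^ (Nat.log b M + 1) := Nat.lt_pow_succ_log_self hb _
    have h2 : c < b ^ c := Nat.lt_pow_self hb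
    have h3 : c * M < b ^ (Nat.log b M + c + 1) := by
      calc c * M < b ^ c * b ^ (Nat.log b M + 1) := Nat.mul_lt_mul'' h2 h1
        _ = _ := by rw [← pow_add]; congr 1; omega
    have := (Nat.log_lt_iff_lt_pow hb h.ne').2 h3
    omega

theorem natDegree_prod_pow_mul_pow_le {d : ℕ} (n θ : Fin d → (ZMod p)[X]) (e f : Fin d → ℕ)
    (Δ : ℕ) (he : ∀ j, e j ≤ 2 * Δ) (hf : ∀ j, f j ≤ 2 * Δ) :
    (∏ j, n j ^ e j * θ j ^ f j).natDegree ≤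
      (2 * ∑ j, ((n j).natDegree + (θ j).natDegree)) * Δ := by
  refine (natDegree_prod_le _ _).trans ?_
  rw [mul_assoc, mul_left_comm, Finset.sum_mul]
  refine Finset.sum_le_sum fun j _ => ?_
  refine natDegree_mul_le.trans ?_
  rw [natDegree_pow, natDegree_pow]
  calc _ ≤ 2 * Δ * (n j).natDegree + 2 * Δ * (θ j).natDegree :=
        Nat.add_le_add (Nat.mul_le_mul_right _ (he j)) (Nat.mul_le_mul_right _ (hf j))
    _ ≤ _ := by apply le_of_eq; ring

/-- Clearing denominators: the monomials `∏ ρ_j ^ l_j * a` with `l` in a box become polynomials with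
prescribed prime factors and controlled degree. -/
theorem exists_clear_denominators [IsFractionRing (ZMod p)[X] K] {d : ℕ} (ρ : Fin d → K)
    (hρ : ∀ j, ρ j ≠ 0) (F : Finset K) (hF : 0 ∉ F) :
    ∃ (Q : (ZMod p)[X]) (C₀ C₁ : ℕ), Q ≠ 0 ∧ ∀ (Δ : ℕ) (l₀ : Fin d → ℤ), ∃ κ : K, κ ≠ 0 ∧
      ∀ l : Fin d → ℤ, (∀ j, |l j - l₀ j| ≤ Δ) → ∀ a ∈ F, ∃ t : (ZMod p)[X],
        algebraMap _ K t = κ * ((∏ j, ρ j ^ l j) * a) ∧ t ≠ 0 ∧ (∃ n, t ∣ Q ^ n) ∧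
          t.natDegree ≤ C₀ + C₁ * Δ := by
  classical
  have hinj : Function.Injective (algebraMap (ZMod p)[X] K) := IsFractionRing.injective _ _
  have hfrac : ∀ j, ∃ x : (ZMod p)[X] × (ZMod p)[X], x.1 ≠ 0 ∧ x.2 ≠ 0 ∧
      ρ j * algebraMap _ K x.2 = algebraMap _ K x.1 := by
    intro j
    obtain ⟨x, y, hy, hxy⟩ := IsFractionRing.div_surjective (A := (ZMod p)[X]) (ρ j)
    have hy0 := nonZeroDivisors.ne_zero hy
    have hy1 := (map_ne_zero_iff _ hinj).2 hy0
    refine ⟨(x, y), fun hx => hρ j ?_, hy0, ?_⟩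
    · rw [← hxy, show x = 0 from hx, map_zero, zero_div]
    · rw [← hxy, div_mul_cancel₀ _ hy1]
  choose x hx1 hx2 hx using hfrac
  obtain ⟨⟨q, hq⟩, hqF⟩ := IsLocalization.exist_integer_multiples_of_finset
    (nonZeroDivisors (ZMod p)[X]) F
  have hq0 : q ≠ 0 := nonZeroDivisors.ne_zero hq
  have hqa : ∀ a : K, ∃ s : (ZMod p)[X], a ∈ F → algebraMap _ K s = algebraMap _ K q * a := by
    intro a
    by_cases ha : a ∈ F
    · obtain ⟨s, hs⟩ := hqF a ha
      exact ⟨s, fun _ => hs.trans (Algebra.smul_def _ _)⟩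
    · exact ⟨0, fun h => absurd h ha⟩
  choose s hs using hqa
  have hs0 : ∀ a ∈ F, s a ≠ 0 := by
    intro a ha h0
    have := hs a ha
    rw [h0, map_zero] at this
    rcases mul_eq_zero.1 this.symm with h | h
    · exact (map_ne_zero_iff _ hinj).2 hq0 h
    · exact hF (h ▸ ha)
  have hn1 : ∀ j, algebraMap _ K (x j).1 ≠ 0 := fun j => (map_ne_zero_iff _ hinj).2 (hx1 j)
  have hn2 : ∀ j, algebraMap _ K (x j).2 ≠ 0 := fun j => (map_ne_zero_iff _ hinj).2 (hx2 j)
  set P := ∏ j, ((x j).1 * (x j).2) with hP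
  refine ⟨(∏ a ∈ F, s a) * P, ∑ a ∈ F, (s a).natDegree,
    2 * ∑ j, ((x j).1.natDegree + (x j).2.natDegree), ?_, fun Δ l₀ => ?_⟩
  · exact mul_ne_zero (Finset.prod_ne_zero_iff.2 hs0)
      (Finset.prod_ne_zero_iff.2 fun j _ => mul_ne_zero (hx1 j) (hx2 j))
  -- With `ρ_j = n_j/θ_j`, the factor `(n_j θ_j)^Δ` turns `ρ_j^(l_j - l₀_j)` into `n_j^(Δ + l_j -
  -- l₀_j) θ_j^(Δ - l_j + l₀_j)`, with both exponents between `0` and `2Δ`. Recentring at `l₀` makes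
  -- the degree depend only on the size of the box, not on its position; `q` clears the denominators
  -- of `F`.
  refine ⟨algebraMap _ K q * ∏ j, ((algebraMap _ K (x j).1 * algebraMap _ K (x j).2) ^ Δ *
    ρ j ^ (-l₀ j)), ?_, ?_⟩
  · refine mul_ne_zero ((map_ne_zero_iff _ hinj).2 hq0) (Finset.prod_ne_zero_iff.2 fun j _ => ?_)
    exact mul_ne_zero (pow_ne_zero _ (mul_ne_zero (hn1 j) (hn2 j))) (zpow_ne_zero _ (hρ j))
  · intro l hl a ha
    have hl1 : ∀ j, ((Δ + (l j - l₀ j)).toNat : ℤ) = Δ + (l j - l₀ j) := fun j =>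
      Int.toNat_of_nonneg (by have := abs_le.1 (hl j); omega)
    have hl2 : ∀ j, ((Δ - (l j - l₀ j)).toNat : ℤ) = Δ - (l j - l₀ j) := fun j =>
      Int.toNat_of_nonneg (by have := abs_le.1 (hl j); omega)
    refine ⟨s a * ∏ j, (x j).1 ^ (Δ + (l j - l₀ j)).toNat * (x j).2 ^ (Δ - (l j - l₀ j)).toNat,
      ?_, ?_, ?_, ?_⟩
    · rw [map_mul, hs a ha, map_prod, mul_assoc, mul_assoc]
      congr 1
      rw [mul_comm a, ← mul_assoc, ← Finset.prod_mul_distrib]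
      congr 1
      refine Finset.prod_congr rfl fun j _ => ?_
      rw [map_mul, map_pow, map_pow, ← zpow_natCast, ← zpow_natCast, hl1, hl2, ← hx j, mul_assoc,
        ← zpow_add₀ (hρ j), zpow_sub₀ (hn2 j), zpow_add₀ (mul_ne_zero (hρ j) (hn2 j)), mul_zpow,
        mul_zpow (ρ j) _ (l j - l₀ j), zpow_natCast, zpow_natCast, neg_add_eq_sub]
      have := zpow_ne_zero (l j - l₀ j) (hn2 j)
      field_simp
      ring
    · exact mul_ne_zero (hs0 a ha) (Finset.prod_ne_zero_iff.2 fun j _ =>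
        mul_ne_zero (pow_ne_zero _ (hx1 j)) (pow_ne_zero _ (hx2 j)))
    · refine ⟨2 * Δ + 1, ?_⟩
      rw [mul_pow]
      refine mul_dvd_mul ((Finset.dvd_prod_of_mem s ha).trans (dvd_pow_self _ (by omega))) ?_
      rw [hP, ← Finset.prod_pow]
      refine Finset.prod_dvd_prod_of_dvd _ _ fun j _ => ?_
      rw [mul_pow]
      have := abs_le.1 (hl j)
      exact mul_dvd_mul (pow_dvd_pow _ (by omega)) (pow_dvd_pow _ (by omega))
    · refine natDegree_mul_le.trans (Nat.add_le_add
        (Finset.single_le_sum (f := fun a => (s a).natDegree) (fun _ _ => Nat.zero_le _) ha)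
        (natDegree_prod_pow_mul_pow_le _ _ _ _ Δ (fun j => ?_) fun j => ?_)) <;>
      · have := abs_le.1 (hl j)
        omega

/-- The number of minimal zero sums of monomials `∏ ρ_j ^ l_j * a` with `l` in a box is linear in
the number of monomials, up to a power of the logarithm of the size of the box. -/
theorem exists_card_minZeroSums_le [IsFractionRing (ZMod p)[X] K] {d : ℕ} (ρ : Fin d → K)
    (hρ : ∀ j, ρ j ≠ 0) (F : Finset K) (hF : 0 ∉ F) (r : ℕ) :
    ∃ c : ℕ, ∀ (A : Type) [AddCommGroup A] (φ : A →+ K), Function.Injective φ →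
      ∀ (B : Finset A) (D : Finset (Fin d → ℤ)) (Δ : ℕ),
      (∀ l ∈ D, ∀ l' ∈ D, ∀ j, |l j - l' j| ≤ Δ) →
      (∀ b ∈ B, ∃ l ∈ D, ∃ a ∈ F, φ b = (∏ j, ρ j ^ l j) * a) →
      ∀ (ι : Type) [Fintype ι], Fintype.card ι ≤ r →
        (minZeroSums ι B).card ≤ B.card * (Nat.log p Δ + c) ^ c := by
  classical
  have hp : 1 < p := (Fact.out : p.Prime).one_lt
  have hinj : Function.Injective (algebraMap (ZMod p)[X] K) := IsFractionRing.injective _ _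
  obtain ⟨Q, C₀, C₁, hQ, hclear⟩ := exists_clear_denominators (p := p) ρ hρ F hF
  obtain ⟨c, hc⟩ := sUnitBound hinj r Q hQ
  set m := c + C₀ + C₁ + 1 with hm
  refine ⟨m * (r + 1), fun A _ φ hφ B D Δ hΔ hB ι _ hι => ?_⟩
  rcases (minZeroSums ι B).eq_empty_or_nonempty with he | ⟨b₀, hb₀⟩
  · simp [he]
  obtain ⟨hb₀B, ⟨i₀, -⟩, -⟩ := mem_minZeroSums.1 hb₀
  obtain ⟨l₀, hl₀, -⟩ := hB _ (hb₀B i₀)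
  obtain ⟨κ, hκ, hcl⟩ := hclear Δ l₀
  obtain ⟨S, hScard, hS⟩ := hc (C₀ + C₁ * Δ)
  -- A minimal zero sum is determined by one entry and the ratios of the others to it. The common
  -- factor `κ` cancels in the ratios, which `sUnitBound` confines to `S`.
  have hmap : ∀ b ∈ minZeroSums ι B,
      (b i₀, fun i => φ (b i) / φ (b i₀)) ∈ B ×ˢ Fintype.piFinset fun _ : ι => S := by
    intro b hb
    obtain ⟨hbB, hbm⟩ := mem_minZeroSums.1 hb
    have ht : ∀ i, ∃ t : (ZMod p)[X], algebraMap _ K t = κ * φ (b i) ∧ t ≠ 0 ∧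
        (∃ n, t ∣ Q ^ n) ∧ t.natDegree ≤ C₀ + C₁ * Δ := by
      intro i
      obtain ⟨l, hl, a, ha, hla⟩ := hB _ (hbB i)
      rw [hla]
      exact hcl l (fun j => hΔ l hl l₀ hl₀ j) a ha
    choose t ht1 ht2 using ht
    have htm : IsSUnitTuple Q (C₀ + C₁ * Δ) t Finset.univ := by
      refine ⟨hbm.of_iff fun J => ?_, fun i _ => ht2 i⟩
      rw [← map_eq_zero_iff _ hinj, map_sum, Finset.sum_congr rfl fun i _ => ht1 i,
        ← Finset.mul_sum, ← map_sum, mul_eq_zero, or_iff_right hκ, map_eq_zero_iff _ hφ]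
    rw [Finset.mem_product, Fintype.mem_piFinset]
    refine ⟨hbB i₀, fun i => ?_⟩
    have := hS ι Finset.univ t (by rwa [Finset.card_univ]) htm i (Finset.mem_univ _) i₀
      (Finset.mem_univ _)
    rwa [ht1, ht1, mul_div_mul_left _ _ hκ] at this
  have hcard : (minZeroSums ι B).card ≤ B.card * S.card ^ Fintype.card ι := by
    have := Finset.card_le_card_of_injOn
      (fun b : ι → A => (b i₀, fun i => φ (b i) / φ (b i₀))) hmap ?_
    · rwa [Finset.card_product, Fintype.card_piFinset, Finset.prod_const, Finset.card_univ] at this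
    · intro b hb b' hb' h
      have h1 : b i₀ = b' i₀ := congrArg Prod.fst h
      have h0 : φ (b i₀) ≠ 0 := by
        obtain ⟨l, hl, a, ha, hla⟩ := hB _ ((mem_minZeroSums.1 hb).1 i₀)
        rw [hla]
        exact mul_ne_zero (Finset.prod_ne_zero_iff.2 fun j _ => zpow_ne_zero _ (hρ j))
          fun h => hF (h ▸ ha)
      funext i
      have h2 := congrFun (congrArg Prod.snd h) i
      simp only at h2
      rw [← h1, div_left_inj' h0] at h2
      exact hφ h2
  refine hcard.trans (Nat.mul_le_mul_left _ ?_)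
  have hS' : S.card ≤ (Nat.log p Δ + m) ^ m := by
    refine hScard.trans ((Nat.pow_le_pow_left ?_ c).trans
      (Nat.pow_le_pow_right (by omega) (by omega)))
    have e1 := log_add_le hp (C₁ * Δ) C₀
    have e2 := log_mul_le hp C₁ Δ
    rw [add_comm] at e1
    omega
  calc S.card ^ Fintype.card ι ≤ ((Nat.log p Δ + m) ^ m) ^ Fintype.card ι :=
        Nat.pow_le_pow_left hS' _
    _ = (Nat.log p Δ + m) ^ (m * Fintype.card ι) := by rw [← pow_mul]
    _ ≤ (Nat.log p Δ + m) ^ (m * (r + 1)) :=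
        Nat.pow_le_pow_right (by omega) (Nat.mul_le_mul_left _ (by omega))
    _ ≤ _ := Nat.pow_le_pow_left (Nat.add_le_add_left (Nat.le_mul_of_pos_right m (by omega)) _) _

end Counting

/-! ### The dual ring as a subring of `𝔽_p(x)` -/

section Algebra

open Polynomial LaurentPolynomial

variable {p d : ℕ} [Fact p.Prime]

/-- The field `𝔽_p(x)`. -/
abbrev FunField (p : ℕ) [Fact p.Prime] : Type := FractionRing (ZMod p)[X]

/-- The variable of `𝔽_p(x)` as a unit. -/
noncomputable def funVar (p : ℕ) [Fact p.Prime] : (FunField p)ˣ :=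
  Units.mk0 (algebraMap (ZMod p)[X] (FunField p) X)
    ((map_ne_zero_iff _ (IsFractionRing.injective _ _)).2 X_ne_zero)

/-- The embedding of the Laurent polynomials into `𝔽_p(x)`. -/
noncomputable def laurentToField (p : ℕ) [Fact p.Prime] :
    LaurentPolynomial (ZMod p) →+* FunField p :=
  eval₂ (algebraMap (ZMod p) (FunField p)) (funVar p)

theorem laurentToField_injective : Function.Injective (laurentToField p) := by
  rw [injective_iff_map_eq_zero]
  intro f hf
  obtain ⟨n, g, hg⟩ := exists_T_pow f
  have h1 : laurentToField p (toLaurent g) = 0 := by rw [hg, map_mul, hf, zero_mul]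
  have h2 : laurentToField p (toLaurent g) = algebraMap _ (FunField p) g := by
    rw [laurentToField, eval₂_toLaurent]
    change Polynomial.eval₂ (algebraMap (ZMod p) (FunField p))
      (algebraMap (ZMod p)[X] (FunField p) X) g = _
    rw [IsScalarTower.algebraMap_eq (ZMod p) (ZMod p)[X] (FunField p), ← Polynomial.hom_eval₂,
      Polynomial.algebraMap_eq, Polynomial.eval₂_C_X]
  rw [h2, map_eq_zero_iff _ (IsFractionRing.injective _ _)] at h1
  rw [h1, map_zero] at hg
  exact ((isUnit_T (n : ℤ)).mul_left_eq_zero).1 hg.symm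

/-- A vanishing `R j` would give equal products for the exponents `1` and `2` at `j`. -/
theorem MulIndependent.ne_zero {R : Fin d → LaurentPolynomial (ZMod p)} (hR : MulIndependent R)
    (j : Fin d) : R j ≠ 0 := by
  classical
  intro h
  have h1 : (Pi.single j 1 : Fin d → ℕ) = Pi.single j 2 := by
    refine hR ?_
    simp only
    rw [Finset.prod_eq_zero (Finset.mem_univ j) (by simp [h]),
      Finset.prod_eq_zero (Finset.mem_univ j) (by simp [h])]
  simpa using congrFun h1 j

/-- The image of `R_j` in `𝔽_p(x)`. -/
noncomputable def fieldGen (R : Fin d → LaurentPolynomial (ZMod p)) (j : Fin d) : FunField p :=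
  laurentToField p (R j)

theorem fieldGen_ne_zero {R : Fin d → LaurentPolynomial (ZMod p)} (hR : MulIndependent R)
    (j : Fin d) : fieldGen R j ≠ 0 :=
  (map_ne_zero_iff _ laurentToField_injective).2 (hR.ne_zero j)

theorem prod_fieldGen_zpow_injective {R : Fin d → LaurentPolynomial (ZMod p)}
    (hR : MulIndependent R) :
    Function.Injective fun l : Fin d → ℤ => ∏ j, fieldGen R j ^ l j := by
  intro l l' h
  have hne := fieldGen_ne_zero hR
  simp only at h
  -- Independence is available for natural exponents only; multiplying both sides by the negative
  -- parts of `l` and `l'` makes all exponents natural.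
  have hsplit : ∀ (l l' : Fin d → ℤ) (j : Fin d),
      fieldGen R j ^ ((l j).toNat + (-l' j).toNat) =
        fieldGen R j ^ (l j) * (fieldGen R j ^ ((-l j).toNat + (-l' j).toNat)) := by
    intro l l' j
    rw [← zpow_natCast, ← zpow_natCast, ← zpow_add₀ (hne j)]
    congr 1
    push_cast
    have := Int.toNat_sub_toNat_neg (l j)
    omega
  have h1 : (fun j => (l j).toNat + (-l' j).toNat) = fun j => (l' j).toNat + (-l j).toNat := by
    refine hR (laurentToField_injective ?_)
    simp only [map_prod, map_pow]
    change ∏ j, fieldGen R j ^ _ = ∏ j, fieldGen R j ^ _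
    rw [Finset.prod_congr rfl fun j _ => hsplit l l' j,
      Finset.prod_congr rfl fun j _ => hsplit l' l j, Finset.prod_mul_distrib,
      Finset.prod_mul_distrib, h]
    congr 1
    exact Finset.prod_congr rfl fun j _ => by rw [add_comm]
  funext j
  have h2 : (l j).toNat + (-l' j).toNat = (l' j).toNat + (-l j).toNat := congrFun h1 j
  omega

/-- Evaluation of Laurent monomials at a point with nonzero coordinates. -/
noncomputable def monomialEval {m : ℕ} {K : Type*} [Field K] (y : Fin m → Kˣ) :
    Multiplicative (Fin m → ℤ) →* K where
  toFun k := ((∏ i, y i ^ (k.toAdd i) : Kˣ) : K)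
  map_one' := by simp
  map_mul' k k' := by
    rw [← Units.val_mul, ← Finset.prod_mul_distrib]
    simp [zpow_add]

open Classical in
/-- The point `(x, R_1, ..., R_d)` of `𝔽_p(x)`. -/
noncomputable def extPoint (R : Fin d → LaurentPolynomial (ZMod p)) :
    Fin (d + 1) → (FunField p)ˣ :=
  Fin.cons (funVar p) fun j => if h : fieldGen R j = 0 then 1 else Units.mk0 _ h

/-- Evaluation of Laurent polynomials in `d + 1` variables at `(x, R_1, ..., R_d)`. -/
noncomputable def extEval (R : Fin d → LaurentPolynomial (ZMod p)) :
    LPoly p (d + 1) →ₐ[ZMod p] FunField p :=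
  AddMonoidAlgebra.lift (ZMod p) (FunField p) (Fin (d + 1) → ℤ) (monomialEval (extPoint R))

theorem extEval_single {R : Fin d → LaurentPolynomial (ZMod p)} (hR : MulIndependent R)
    (k : Fin (d + 1) → ℤ) (c : ZMod p) :
    extEval R (AddMonoidAlgebra.single k c) =
      c • ((funVar p : FunField p) ^ k 0 * ∏ j, fieldGen R j ^ k (Fin.succ j)) := by
  rw [extEval, AddMonoidAlgebra.lift_single]
  congr 1
  change ((∏ i, extPoint R i ^ k i : (FunField p)ˣ) : FunField p) = _
  rw [Fin.prod_univ_succ, Units.val_mul, Units.coe_prod, Units.val_zpow_eq_zpow_val]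
  congr 1
  refine Finset.prod_congr rfl fun j _ => ?_
  rw [Units.val_zpow_eq_zpow_val, extPoint, Fin.cons_succ, dif_neg (fieldGen_ne_zero hR j),
    Units.val_mk0]

theorem inFirstVar_add (Q Q' : LaurentPolynomial (ZMod p)) :
    inFirstVar d (Q + Q') = inFirstVar d Q + inFirstVar d Q' :=
  AddMonoidAlgebra.mapDomain_add _ _ _

/-- `inFirstVar` as a ring homomorphism. -/
noncomputable def inFirstVarHom (p d : ℕ) : LaurentPolynomial (ZMod p) →+* LPoly p (d + 1) :=
  AddMonoidAlgebra.mapDomainRingHom (ZMod p)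
    (AddMonoidHom.single (fun _ : Fin (d + 1) => ℤ) 0)

theorem inFirstVarHom_apply (Q : LaurentPolynomial (ZMod p)) :
    inFirstVarHom p d Q = inFirstVar d Q := rfl

theorem extEval_inFirstVar {R : Fin d → LaurentPolynomial (ZMod p)} (hR : MulIndependent R)
    (Q : LaurentPolynomial (ZMod p)) : extEval R (inFirstVar d Q) = laurentToField p Q := by
  induction Q using AddMonoidAlgebra.induction_linear with
  | zero => rw [← inFirstVarHom_apply, map_zero, map_zero, map_zero]
  | add x y hx hy => rw [inFirstVar_add, map_add, map_add, hx, hy]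
  | single n r =>
    rw [inFirstVar, AddMonoidAlgebra.mapDomain_single, extEval_single hR]
    have h1 : (AddMonoidAlgebra.single n r : LaurentPolynomial (ZMod p)) =
        LaurentPolynomial.C r * T n :=
      single_eq_C_mul_T r n
    rw [h1, laurentToField, eval₂_C_mul_T, Units.val_zpow_eq_zpow_val, Algebra.smul_def]
    simp

theorem extEval_eq_zero_of_mem {R : Fin d → LaurentPolynomial (ZMod p)} (hR : MulIndependent R)
    {P : LPoly p (d + 1)} (hP : P ∈ extIdeal R) : extEval R P = 0 := by
  have h : extIdeal R ≤ RingHom.ker (extEval R) := by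
    rw [extIdeal, Ideal.span_le]
    rintro _ ⟨j, rfl⟩
    rw [SetLike.mem_coe, RingHom.mem_ker, map_sub, extEval_inFirstVar hR, extEval_single hR,
      sub_eq_zero, one_smul]
    rw [Pi.single_eq_of_ne (Fin.succ_ne_zero j).symm, zpow_zero, one_mul,
      Finset.prod_eq_single j]
    · simp [fieldGen]
    · intro i _ hij
      rw [Pi.single_eq_of_ne (fun h => hij (Fin.succ_injective _ h)), zpow_zero]
    · simp
  exact h hP

/-- Modulo the ideal each `x_(j+1)` may be replaced by `R_j`. Nonnegative exponents are needed
because `R_j` need not be invertible among the Laurent polynomials. -/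
theorem single_mem_range_inFirstVar (R : Fin d → LaurentPolynomial (ZMod p))
    (k : Fin (d + 1) → ℤ) (hk : ∀ j : Fin d, 0 ≤ k j.succ) (c : ZMod p) :
    ∃ Q, (AddMonoidAlgebra.single k c : LPoly p (d + 1)) - inFirstVar d Q ∈ extIdeal R := by
  let π := Ideal.Quotient.mk (extIdeal R)
  have hgen : ∀ j : Fin d, π (AddMonoidAlgebra.single (Pi.single j.succ 1) 1) =
      π (inFirstVar d (R j)) := fun j =>
    Ideal.Quotient.eq.2 (Ideal.subset_span ⟨j, rfl⟩)
  refine ⟨AddMonoidAlgebra.single (k 0) c * ∏ j, R j ^ (k j.succ).toNat, ?_⟩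
  rw [← Ideal.Quotient.eq]
  have hprod : (AddMonoidAlgebra.single k c : LPoly p (d + 1)) =
      inFirstVarHom p d (AddMonoidAlgebra.single (k 0) c) *
        ∏ j : Fin d, AddMonoidAlgebra.single (Pi.single j.succ 1) 1 ^ (k j.succ).toNat := by
    have h1 : inFirstVarHom p d (AddMonoidAlgebra.single (k 0) c) =
        AddMonoidAlgebra.single (Pi.single 0 (k 0)) c := by
      rw [inFirstVarHom_apply, inFirstVar, AddMonoidAlgebra.mapDomain_single]
    have h2 : (∏ j : Fin d, (AddMonoidAlgebra.single (Pi.single j.succ 1) 1 : LPoly p (d + 1)) ^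
        (k j.succ).toNat) = AddMonoidAlgebra.single
          (∑ j : Fin d, (k j.succ).toNat • (Pi.single j.succ 1 : Fin (d + 1) → ℤ)) 1 := by
      rw [Finset.prod_congr rfl fun j _ => AddMonoidAlgebra.single_pow _ _ _]
      simp only [one_pow]
      rw [AddMonoidAlgebra.prod_single]
      simp
    rw [h1, h2, AddMonoidAlgebra.single_mul_single, mul_one]
    congr 1
    funext i
    refine Fin.cases ?_ (fun i => ?_) i
    · simp [Finset.sum_apply]
    · rw [Pi.add_apply, Pi.single_eq_of_ne (Fin.succ_ne_zero i), zero_add, Finset.sum_apply,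
        Finset.sum_eq_single i]
      · simp [hk i]
      · intro j _ hj
        rw [Pi.smul_apply, Pi.single_eq_of_ne (fun h => hj (Fin.succ_injective _ h.symm)),
          smul_zero]
      · simp
  change π _ = π _
  rw [hprod, ← inFirstVarHom_apply (p := p) (d := d) (_ * _), map_mul, map_mul, map_mul, map_prod,
    map_prod, map_prod]
  congr 1
  refine Finset.prod_congr rfl fun j _ => ?_
  rw [map_pow, map_pow, map_pow, hgen, inFirstVarHom_apply]

/-- The monomial `(x_2 ⋯ x_(d+1))^N`. -/
noncomputable def tailMonomial (p d : ℕ) (N : ℤ) : LPoly p (d + 1) :=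
  AddMonoidAlgebra.single (Fin.cons 0 fun _ => N) 1

/-- A large power of `x_2 ⋯ x_(d+1)` removes the negative exponents. Allowing every larger power
lets two summands share the same one. -/
theorem exists_mul_tailMonomial_sub_mem (R : Fin d → LaurentPolynomial (ZMod p))
    (P : LPoly p (d + 1)) :
    ∃ N : ℕ, ∀ N' : ℕ, N ≤ N' → ∃ Q, P * tailMonomial p d N' - inFirstVar d Q ∈ extIdeal R := by
  induction P using AddMonoidAlgebra.induction_linear with
  | zero =>
    refine ⟨0, fun N' _ => ⟨0, ?_⟩⟩
    rw [zero_mul, ← inFirstVarHom_apply, map_zero, sub_zero]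
    exact zero_mem _
  | add x y hx hy =>
    obtain ⟨N₁, h₁⟩ := hx
    obtain ⟨N₂, h₂⟩ := hy
    refine ⟨max N₁ N₂, fun N' hN' => ?_⟩
    obtain ⟨Q₁, hQ₁⟩ := h₁ N' ((le_max_left _ _).trans hN')
    obtain ⟨Q₂, hQ₂⟩ := h₂ N' ((le_max_right _ _).trans hN')
    refine ⟨Q₁ + Q₂, ?_⟩
    rw [inFirstVar_add, add_mul, add_sub_add_comm]
    exact add_mem hQ₁ hQ₂
  | single k c =>
    refine ⟨∑ j : Fin d, (k j.succ).natAbs, fun N' hN' => ?_⟩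
    rw [tailMonomial, AddMonoidAlgebra.single_mul_single, mul_one]
    refine single_mem_range_inFirstVar R _ (fun j => ?_) c
    have h1 : (k j.succ).natAbs ≤ ∑ j : Fin d, (k j.succ).natAbs :=
      Finset.single_le_sum (f := fun j : Fin d => (k j.succ).natAbs) (fun _ _ => Nat.zero_le _)
        (Finset.mem_univ j)
    rw [Pi.add_apply, Fin.cons_succ]
    omega

/-- After multiplication by a monomial, which is a unit, `P` is congruent to a Laurent polynomial in
`x_1` alone, and on those the evaluation is injective. -/
theorem mem_extIdeal_iff {R : Fin d → LaurentPolynomial (ZMod p)} (hR : MulIndependent R)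
    {P : LPoly p (d + 1)} : P ∈ extIdeal R ↔ extEval R P = 0 := by
  refine ⟨extEval_eq_zero_of_mem hR, fun h => ?_⟩
  obtain ⟨N, hN⟩ := exists_mul_tailMonomial_sub_mem R P
  obtain ⟨Q, hQ⟩ := hN N le_rfl
  have h1 := extEval_eq_zero_of_mem hR hQ
  rw [map_sub, map_mul, h, zero_mul, zero_sub, neg_eq_zero, extEval_inFirstVar hR,
    map_eq_zero_iff _ laurentToField_injective] at h1
  rw [h1, ← inFirstVarHom_apply, map_zero, sub_zero] at hQ
  have h2 := (extIdeal R).mul_mem_right (tailMonomial p d (-N)) hQ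
  rw [mul_assoc, tailMonomial, tailMonomial, AddMonoidAlgebra.single_mul_single, mul_one] at h2
  have h3 : (Fin.cons 0 fun _ => (N : ℤ) : Fin (d + 1) → ℤ) +
      Fin.cons 0 (fun _ => -(N : ℤ)) = 0 := by
    funext i
    refine Fin.cases ?_ (fun i => ?_) i <;> simp
  rwa [h3, ← AddMonoidAlgebra.one_def, mul_one] at h2

/-- The group of characters of the extension, as a ring. -/
abbrev DualRing (R : Fin d → LaurentPolynomial (ZMod p)) : Type :=
  LPoly p (d + 1) ⧸ extIdeal R

/-- The embedding of the dual ring into `𝔽_p(x)`. -/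
noncomputable def dualEmbedding {R : Fin d → LaurentPolynomial (ZMod p)} (hR : MulIndependent R) :
    DualRing R →+* FunField p :=
  Ideal.Quotient.lift (extIdeal R) (extEval R : LPoly p (d + 1) →+* FunField p)
    fun _ hP => extEval_eq_zero_of_mem hR hP

theorem dualEmbedding_mk {R : Fin d → LaurentPolynomial (ZMod p)} (hR : MulIndependent R)
    (P : LPoly p (d + 1)) :
    dualEmbedding hR (Ideal.Quotient.mk (extIdeal R) P) = extEval R P := rfl

theorem dualEmbedding_injective {R : Fin d → LaurentPolynomial (ZMod p)}
    (hR : MulIndependent R) : Function.Injective (dualEmbedding hR) := by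
  rw [injective_iff_map_eq_zero]
  intro a
  obtain ⟨P, rfl⟩ := Ideal.Quotient.mk_surjective a
  intro h
  rw [dualEmbedding_mk, ← mem_extIdeal_iff hR] at h
  exact Ideal.Quotient.eq_zero_iff_mem.2 h

/-- The monomial `x_2^(l_1) ⋯ x_(d+1)^(l_d)` in the dual ring. -/
noncomputable def dualMonomial (R : Fin d → LaurentPolynomial (ZMod p)) (l : Fin d → ℤ) :
    DualRing R :=
  Ideal.Quotient.mk (extIdeal R) (AddMonoidAlgebra.single (Fin.cons 0 l) 1)

theorem dualEmbedding_dualMonomial {R : Fin d → LaurentPolynomial (ZMod p)}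
    (hR : MulIndependent R) (l : Fin d → ℤ) :
    dualEmbedding hR (dualMonomial R l) = ∏ j, fieldGen R j ^ l j := by
  rw [dualMonomial, dualEmbedding_mk, extEval_single hR]
  simp

theorem dualMonomial_add (R : Fin d → LaurentPolynomial (ZMod p)) (l l' : Fin d → ℤ) :
    dualMonomial R (l + l') = dualMonomial R l * dualMonomial R l' := by
  rw [dualMonomial, dualMonomial, dualMonomial, ← map_mul, AddMonoidAlgebra.single_mul_single,
    mul_one]
  congr 2
  funext i
  refine Fin.cases ?_ (fun i => ?_) i <;> simp

theorem dualMonomial_zero (R : Fin d → LaurentPolynomial (ZMod p)) :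
    dualMonomial R 0 = 1 := by
  have : (Fin.cons 0 (0 : Fin d → ℤ) : Fin (d + 1) → ℤ) = 0 := by
    funext i
    refine Fin.cases ?_ (fun i => ?_) i <;> simp
  rw [dualMonomial, this, ← AddMonoidAlgebra.one_def, map_one]

theorem dualMonomial_mul_injective {R : Fin d → LaurentPolynomial (ZMod p)}
    (hR : MulIndependent R) {a : DualRing R} (ha : a ≠ 0) :
    Function.Injective fun l : Fin d → ℤ => dualMonomial R l * a := by
  intro l l' h
  have h1 := congrArg (dualEmbedding hR) h
  simp only [map_mul, dualEmbedding_dualMonomial] at h1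
  exact prod_fieldGen_zpow_injective hR
    (mul_right_cancel₀ ((map_ne_zero_iff _ (dualEmbedding_injective hR)).2 ha) h1)

end Algebra

/-! ### Pontryagin duality for the extension -/

section Duality

variable {p d : ℕ} [Fact p.Prime]

theorem polyMul_add_left {m : ℕ} (P Q : LPoly p m) (ζ : FullGroup p m) :
    polyMul (P + Q) ζ = polyMul P ζ + polyMul Q ζ := by
  funext k
  simp only [polyMul, Pi.add_apply, AddMonoidAlgebra.coeff_add]
  exact Finsupp.sum_add_index' (fun _ => zero_mul _) fun _ _ _ => add_mul _ _ _

theorem polyMul_zero_left {m : ℕ} (ζ : FullGroup p m) : polyMul (0 : LPoly p m) ζ = 0 := by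
  funext k
  simp [polyMul]

theorem polyMul_single {m : ℕ} (v : Fin m → ℤ) (c : ZMod p) (ζ : FullGroup p m)
    (k : Fin m → ℤ) :
    polyMul (AddMonoidAlgebra.single v c : LPoly p m) ζ k = c * ζ (k + v) := by
  simp [polyMul, AddMonoidAlgebra.coeff_single]

theorem polyMul_single_mul {m : ℕ} (v : Fin m → ℤ) (P : LPoly p m) (ζ : FullGroup p m)
    (k : Fin m → ℤ) :
    polyMul (AddMonoidAlgebra.single v 1 * P) ζ k = polyMul P ζ (k + v) := by
  induction P using AddMonoidAlgebra.induction_linear with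
  | zero => rw [mul_zero, polyMul_zero_left]; rfl
  | add x y hx hy => rw [mul_add, polyMul_add_left, polyMul_add_left, Pi.add_apply, hx, hy]; rfl
  | single w s =>
    rw [AddMonoidAlgebra.single_mul_single, polyMul_single, polyMul_single, one_mul, add_assoc]

theorem polyMul_add_right {m : ℕ} (P : LPoly p m) (ζ ξ : FullGroup p m) (k : Fin m → ℤ) :
    polyMul P (ζ + ξ) k = polyMul P ζ k + polyMul P ξ k := by
  simp only [polyMul, Pi.add_apply, mul_add]
  exact Finsupp.sum_add

theorem continuous_polyMul {m : ℕ} (P : LPoly p m) (k : Fin m → ℤ) :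
    Continuous fun ζ : FullGroup p m => polyMul P ζ k :=
  continuous_finsetSum _ fun j _ => continuous_const.mul (continuous_apply (k + j))

variable (R : Fin d → LaurentPolynomial (ZMod p))

/-- The character of the extension attached to a Laurent polynomial. -/
noncomputable def polyChar (P : LPoly p (d + 1)) : AddChar (ExtGroup R) Circle where
  toFun ζ := ZMod.toCircle (polyMul P (ζ : FullGroup p (d + 1)) 0)
  map_zero_eq_one' := by
    have : polyMul P (0 : FullGroup p (d + 1)) 0 = 0 := by simp [polyMul]
    rw [AddSubgroup.coe_zero, this, AddChar.map_zero_eq_one]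
  map_add_eq_mul' ζ ξ := by
    rw [AddSubgroup.coe_add, polyMul_add_right, AddChar.map_add_eq_mul]

theorem polyChar_apply (P : LPoly p (d + 1)) (ζ : ExtGroup R) :
    polyChar R P ζ = ZMod.toCircle (polyMul P (ζ : FullGroup p (d + 1)) 0) := rfl

theorem continuous_polyChar (P : LPoly p (d + 1)) : Continuous (polyChar R P) :=
  (continuous_of_discreteTopology (f := (ZMod.toCircle : ZMod p → Circle))).comp
    ((continuous_polyMul P 0).comp continuous_subtype_val)

theorem polyChar_add (P Q : LPoly p (d + 1)) (ζ : ExtGroup R) :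
    polyChar R (P + Q) ζ = polyChar R P ζ * polyChar R Q ζ := by
  rw [polyChar_apply, polyMul_add_left, Pi.add_apply, AddChar.map_add_eq_mul]
  rfl

theorem polyChar_shiftAct (P : LPoly p (d + 1)) (l : Fin d → ℤ) (ζ : ExtGroup R) :
    polyChar R P (shiftAct R l ζ) =
      polyChar R (AddMonoidAlgebra.single (Fin.cons 0 l) 1 * P) ζ := by
  rw [polyChar_apply, polyChar_apply, polyMul_single_mul]
  have h := polyMul_shift P (ζ : FullGroup p (d + 1)) (Fin.cons 0 l)
  exact congrArg ZMod.toCircle (congrFun h 0)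

variable {R}

/-- The element of the extension defined by a functional on the dual ring. -/
noncomputable def ofFunctional (μ : DualRing R →ₗ[ZMod p] ZMod p) : ExtGroup R :=
  ⟨fun k => μ (Ideal.Quotient.mk _ (AddMonoidAlgebra.single k 1)), fun P hP => by
    have key : ∀ (P : LPoly p (d + 1)) (k : Fin (d + 1) → ℤ),
        polyMul P (fun k => μ (Ideal.Quotient.mk _ (AddMonoidAlgebra.single k 1))) k =
          μ (Ideal.Quotient.mk _ (AddMonoidAlgebra.single k 1 * P)) := by
      intro P k
      induction P using AddMonoidAlgebra.induction_linear with
      | zero => rw [polyMul_zero_left, mul_zero, map_zero, map_zero]; rfl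
      | add x y hx hy => rw [polyMul_add_left, Pi.add_apply, hx, hy, mul_add, map_add, map_add]
      | single w s =>
        rw [polyMul_single, AddMonoidAlgebra.single_mul_single, one_mul, ← smul_eq_mul, ← map_smul]
        congr 1
        have : (AddMonoidAlgebra.single (k + w) s : LPoly p (d + 1)) =
            s • AddMonoidAlgebra.single (k + w) 1 := by
          rw [AddMonoidAlgebra.smul_single, smul_eq_mul, mul_one]
        rw [this]
        rfl
    funext k
    rw [key, Ideal.Quotient.eq_zero_iff_mem.2 ((extIdeal R).mul_mem_left _ hP), map_zero]
    rfl⟩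

theorem polyMul_ofFunctional (μ : DualRing R →ₗ[ZMod p] ZMod p) (P : LPoly p (d + 1)) :
    polyMul P (ofFunctional μ : FullGroup p (d + 1)) 0 = μ (Ideal.Quotient.mk _ P) := by
  induction P using AddMonoidAlgebra.induction_linear with
  | zero => rw [polyMul_zero_left, map_zero, map_zero]; rfl
  | add x y hx hy => rw [polyMul_add_left, Pi.add_apply, hx, hy, map_add, map_add]
  | single w s =>
    rw [polyMul_single, zero_add]
    change s * μ (Ideal.Quotient.mk _ (AddMonoidAlgebra.single w 1)) = _
    rw [← smul_eq_mul, ← map_smul]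
    congr 1
    have : (AddMonoidAlgebra.single w s : LPoly p (d + 1)) =
        s • AddMonoidAlgebra.single w 1 := by
      rw [AddMonoidAlgebra.smul_single, smul_eq_mul, mul_one]
    rw [this]
    rfl

/-- Every `𝔽_p`-linear functional on the dual ring is realized by a point of the group, and
functionals separate the points of a vector space. -/
theorem polyChar_eq_one_iff {P : LPoly p (d + 1)} :
    (∀ ζ, polyChar R P ζ = 1) ↔ P ∈ extIdeal R := by
  constructor
  · intro h
    rw [← Ideal.Quotient.eq_zero_iff_mem, ← Module.forall_dual_apply_eq_zero_iff (ZMod p)]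
    intro μ
    have h1 := h (ofFunctional μ)
    rw [polyChar_apply, polyMul_ofFunctional] at h1
    exact ZMod.injective_toCircle (h1.trans (AddChar.map_zero_eq_one _).symm)
  · intro hP ζ
    rw [polyChar_apply, ζ.2 P hP]
    exact AddChar.map_zero_eq_one _

theorem exists_toCircle_eq {z : Circle} (hz : z ^ p = 1) : ∃ j : ZMod p, ZMod.toCircle j = z := by
  have hp : p ≠ 0 := (Fact.out : p.Prime).ne_zero
  have h1 : (z : ℂ) ^ p = 1 := by rw [← Circle.coe_pow, hz, Circle.coe_one]
  obtain ⟨i, -, hi⟩ := (Complex.isPrimitiveRoot_exp p hp).eq_pow_of_pow_eq_one h1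
  refine ⟨(i : ZMod p), Circle.ext ?_⟩
  rw [ZMod.toCircle_natCast, ← hi, ← Complex.exp_nat_mul]
  congr 1
  ring

/-- Every continuous character of the extension comes from a Laurent polynomial. -/
theorem exists_polyChar_eq (χ : AddChar (ExtGroup R) Circle) (hχ : Continuous χ) :
    ∃ P, χ = polyChar R P := by
  classical
  -- The group has exponent `p`, so `χ` factors through `𝔽_p` by an additive map `θ`.
  have hroot : ∀ ζ, (χ ζ) ^ p = 1 := by
    intro ζ
    rw [← AddChar.map_nsmul_eq_pow]
    have : p • ζ = 0 := by
      refine Subtype.ext (funext fun k => ?_)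
      rw [AddSubgroup.coe_nsmul, Pi.smul_apply, nsmul_eq_mul, CharP.cast_eq_zero, zero_mul]
      rfl
    rw [this, AddChar.map_zero_eq_one]
  choose θ hθ using fun ζ => exists_toCircle_eq (hroot ζ)
  let Θ : ExtGroup R →+ ZMod p :=
    { toFun := θ
      map_zero' := ZMod.injective_toCircle (by
        rw [hθ, AddChar.map_zero_eq_one, AddChar.map_zero_eq_one])
      map_add' := fun ζ ξ => ZMod.injective_toCircle (by
        rw [hθ, AddChar.map_add_eq_mul, AddChar.map_add_eq_mul, hθ, hθ]) }
  have hopen : IsOpen {ζ : ExtGroup R | θ ζ = 0} := by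
    have h1 : {ζ : ExtGroup R | θ ζ = 0} =
        χ ⁻¹' ((ZMod.toCircle : ZMod p → Circle) '' {j | j ≠ 0})ᶜ := by
      ext ζ
      simp only [Set.mem_ofPred_eq, Set.mem_preimage, Set.mem_compl_iff, Set.mem_image, not_exists,
        not_and, ← hθ ζ]
      constructor
      · intro h j hj hjz
        exact hj ((ZMod.injective_toCircle hjz).trans h)
      · intro h
        by_contra h0
        exact h (θ ζ) h0 rfl
    rw [h1]
    exact ((Set.toFinite _).isClosed.isOpen_compl).preimage hχ
  -- An open kernel contains a basic neighbourhood of `0`, so `θ` depends on the finitely many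
  -- coordinates in `E` only.
  obtain ⟨V, hV, hVU⟩ := isOpen_induced_iff.1 hopen
  have h0V : ((0 : ExtGroup R) : FullGroup p (d + 1)) ∈ V := by
    have h2 : (0 : ExtGroup R) ∈ {ζ : ExtGroup R | θ ζ = 0} := Θ.map_zero
    rw [← hVU] at h2
    exact h2
  obtain ⟨E, u, hu, huV⟩ := isOpen_pi_iff.1 hV _ h0V
  have hker : ∀ ζ : ExtGroup R, (∀ k ∈ E, (ζ : FullGroup p (d + 1)) k = 0) → θ ζ = 0 := by
    intro ζ hζ
    have h3 : ζ ∈ (Subtype.val ⁻¹' V : Set (ExtGroup R)) := by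
      refine huV fun k hk => ?_
      rw [hζ k hk]
      exact (hu k hk).2
    rw [hVU] at h3
    exact h3
  let Θ' : ExtGroup R →ₗ[ZMod p] ZMod p := Θ.toZModLinearMap p
  let L : E → ExtGroup R →ₗ[ZMod p] ZMod p := fun k =>
    AddMonoidHom.toZModLinearMap p
      ((Pi.evalAddMonoidHom (fun _ => ZMod p) (k : Fin (d + 1) → ℤ)).comp
        (idealSubgroup (extIdeal R)).subtype)
  -- A functional vanishing on the common kernel of finitely many coordinates is a combination of
  -- them; its coefficients are those of the Laurent polynomial.
  have hspan : Θ' ∈ Submodule.span (ZMod p) (Set.range L) := by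
    refine mem_span_of_iInf_ker_le_ker fun ζ hζ => ?_
    rw [Submodule.mem_iInf] at hζ
    exact hker ζ fun k hk => hζ ⟨k, hk⟩
  obtain ⟨c, hc⟩ := (Submodule.mem_span_range_iff_exists_fun (ZMod p)).1 hspan
  refine ⟨∑ k : E, AddMonoidAlgebra.single (k : Fin (d + 1) → ℤ) (c k), ?_⟩
  refine DFunLike.ext _ _ fun ζ => ?_
  rw [← hθ ζ, polyChar_apply]
  congr 1
  have h4 : θ ζ = ∑ k, c k * (ζ : FullGroup p (d + 1)) k := by
    have h5 := LinearMap.congr_fun hc ζ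
    rw [LinearMap.sum_apply] at h5
    exact h5.symm
  rw [h4]
  have h6 : ∀ s : Finset E, polyMul (∑ k ∈ s, (AddMonoidAlgebra.single (k : Fin (d + 1) → ℤ) (c k) :
      LPoly p (d + 1))) (ζ : FullGroup p (d + 1)) 0 =
      ∑ k ∈ s, c k * (ζ : FullGroup p (d + 1)) k := by
    intro s
    induction s using Finset.induction_on with
    | empty => rw [Finset.sum_empty, Finset.sum_empty, polyMul_zero_left]; rfl
    | insert k s hk ih =>
      rw [Finset.sum_insert hk, Finset.sum_insert hk, polyMul_add_left, Pi.add_apply, ih,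
        polyMul_single, zero_add]
  exact (h6 _).symm

/-- The character attached to an element of the dual ring, as a complex function. -/
noncomputable def dualChar (a : DualRing R) (ζ : ExtGroup R) : ℂ :=
  (polyChar R (Quotient.out a) ζ : ℂ)

theorem polyChar_congr {P Q : LPoly p (d + 1)}
    (h : Ideal.Quotient.mk (extIdeal R) P = Ideal.Quotient.mk (extIdeal R) Q) :
    polyChar R P = polyChar R Q := by
  refine DFunLike.ext _ _ fun ζ => ?_
  have h1 := polyChar_eq_one_iff.2 (Ideal.Quotient.eq.1 h) ζ
  have h2 := polyChar_add R (P - Q) Q ζ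
  rwa [sub_add_cancel, h1, one_mul] at h2

theorem mk_out (a : DualRing R) : Ideal.Quotient.mk (extIdeal R) (Quotient.out a) = a :=
  Quotient.out_eq a

theorem dualChar_mk (P : LPoly p (d + 1)) (ζ : ExtGroup R) :
    dualChar (Ideal.Quotient.mk (extIdeal R) P) ζ = polyChar R P ζ := by
  rw [dualChar, polyChar_congr (mk_out _)]

theorem dualChar_zero (ζ : ExtGroup R) : dualChar (0 : DualRing R) ζ = 1 := by
  rw [← map_zero (Ideal.Quotient.mk (extIdeal R)), dualChar_mk,
    polyChar_eq_one_iff.2 (zero_mem _), Circle.coe_one]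

theorem dualChar_add (a b : DualRing R) (ζ : ExtGroup R) :
    dualChar (a + b) ζ = dualChar a ζ * dualChar b ζ := by
  obtain ⟨P, rfl⟩ := Ideal.Quotient.mk_surjective a
  obtain ⟨Q, rfl⟩ := Ideal.Quotient.mk_surjective b
  rw [← map_add, dualChar_mk, dualChar_mk, dualChar_mk, polyChar_add, Circle.coe_mul]

theorem norm_dualChar (a : DualRing R) (ζ : ExtGroup R) : ‖dualChar a ζ‖ = 1 :=
  Circle.norm_coe _

theorem continuous_dualChar (a : DualRing R) : Continuous (dualChar a : ExtGroup R → ℂ) :=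
  continuous_subtype_val.comp (continuous_polyChar R _)

theorem dualChar_neg (a : DualRing R) (ζ : ExtGroup R) :
    dualChar (-a) ζ = (starRingEnd ℂ) (dualChar a ζ) := by
  have h1 : dualChar (-a) ζ * dualChar a ζ = 1 := by
    rw [← dualChar_add, neg_add_cancel, dualChar_zero]
  have h2 : (starRingEnd ℂ) (dualChar a ζ) * dualChar a ζ = 1 := by
    rw [Complex.conj_mul', norm_dualChar]
    simp
  have h3 : dualChar a ζ ≠ 0 := norm_ne_zero_iff.1 (by rw [norm_dualChar]; exact one_ne_zero)
  exact mul_right_cancel₀ h3 (h1.trans h2.symm)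

theorem dualChar_shiftAct (a : DualRing R) (l : Fin d → ℤ) (ζ : ExtGroup R) :
    dualChar a (shiftAct R l ζ) = dualChar (dualMonomial R l * a) ζ := by
  obtain ⟨P, rfl⟩ := Ideal.Quotient.mk_surjective a
  rw [dualMonomial, ← map_mul, dualChar_mk, dualChar_mk, polyChar_shiftAct]

theorem integral_dualChar (a : DualRing R) [Decidable (a = 0)] :
    ∫ ζ, dualChar a ζ ∂(haar R) = if a = 0 then 1 else 0 := by
  split_ifs with ha
  · rw [ha]
    simp [dualChar_zero]
  · obtain ⟨ξ, hξ⟩ : ∃ ξ : ExtGroup R, dualChar a ξ ≠ 1 := by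
      by_contra! hall
      refine ha ?_
      rw [← mk_out a, Ideal.Quotient.eq_zero_iff_mem, ← polyChar_eq_one_iff]
      intro ζ
      exact Circle.ext ((hall ζ).trans Circle.coe_one.symm)
    have hinv : (haar R).IsAddLeftInvariant := by unfold haar; infer_instance
    have hmul : ∀ ζ, dualChar a (ξ + ζ) = dualChar a ξ * dualChar a ζ := by
      intro ζ
      rw [dualChar, AddChar.map_add_eq_mul, Circle.coe_mul]
      rfl
    have h1 := integral_add_left_eq_self (μ := haar R) (fun ζ => dualChar a ζ) ξ
    simp_rw [hmul] at h1
    rw [integral_const_mul] at h1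
    have h2 : (dualChar a ξ - 1) * ∫ ζ, dualChar a ζ ∂(haar R) = 0 := by
      rw [sub_mul, one_mul, h1, sub_self]
    exact (mul_eq_zero.1 h2).resolve_left (sub_ne_zero.2 hξ)

/-- The continuous characters are parametrized by the dual ring. -/
noncomputable def dualEquiv (R : Fin d → LaurentPolynomial (ZMod p)) :
    DualRing R ≃ {χ : AddChar (ExtGroup R) Circle // Continuous χ} :=
  Equiv.ofBijective (fun a => ⟨polyChar R (Quotient.out a), continuous_polyChar R _⟩) (by
    constructor
    · intro a b h
      have h1 : polyChar R (Quotient.out a) = polyChar R (Quotient.out b) :=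
        congrArg Subtype.val h
      rw [← mk_out a, ← mk_out b, Ideal.Quotient.eq, ← polyChar_eq_one_iff]
      intro ζ
      have h2 := polyChar_add R (Quotient.out a - Quotient.out b) (Quotient.out b) ζ
      rw [sub_add_cancel, h1] at h2
      exact (mul_eq_right.1 h2.symm)
    · rintro ⟨χ, hχ⟩
      obtain ⟨P, rfl⟩ := exists_polyChar_eq χ hχ
      exact ⟨Ideal.Quotient.mk _ P, Subtype.ext (polyChar_congr (mk_out _))⟩)

end Duality

/-! ### Absolutely convergent character series: correlations and variance -/

section FourierSeries

open scoped ComplexConjugate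

/-- A system of orthogonal characters `e a`, `a ∈ A`, on a probability space, permuted freely by the
action `T` of a group `G`. -/
structure IsCharSystem {Ω A G : Type*} [TopologicalSpace Ω] [MeasurableSpace Ω] [CommRing A]
    [AddCommGroup G] (μ : Measure Ω) (e : A → Ω → ℂ) (T : G → Ω → Ω) (u : G → A) : Prop where
  continuous : ∀ a, Continuous (e a)
  zero : ∀ x, e 0 x = 1
  add : ∀ a b x, e (a + b) x = e a x * e b x
  neg : ∀ a x, e (-a) x = conj (e a x)
  norm : ∀ a x, ‖e a x‖ = 1
  integral : ∀ a, a ≠ 0 → ∫ x, e a x ∂μ = 0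
  shift : ∀ a l x, e a (T l x) = e (u l * a) x
  u_zero : u 0 = 1
  u_add : ∀ l l', u (l + l') = u l * u l'
  u_injective : ∀ a, a ≠ 0 → Function.Injective fun l => u l * a

/-- The real function `f` is the sum of the absolutely convergent series `∑ c_a e_a`. -/
structure IsCharSeries {Ω A : Type*} (e : A → Ω → ℂ) (c : A → ℂ) (f : Ω → ℝ) : Prop where
  summable : Summable fun a => ‖c a‖
  hasSum : ∀ x, HasSum (fun a => c a * e a x) (f x : ℂ)

variable {Ω A G : Type*} [TopologicalSpace Ω] [MeasurableSpace Ω] [CommRing A] [AddCommGroup G]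
  {μ : Measure Ω} {e : A → Ω → ℂ} {T : G → Ω → Ω} {u : G → A}

theorem IsCharSeries.continuous (h : IsCharSystem μ e T u) {c : A → ℂ} {f : Ω → ℝ}
    (hf : IsCharSeries e c f) : Continuous f := by
  have h1 : Continuous fun x => ∑' a, c a * e a x :=
    continuous_tsum (fun a => continuous_const.mul (h.continuous a)) hf.summable fun a x => by
      rw [norm_mul, h.norm, mul_one]
  have h2 : f = fun x => (∑' a, c a * e a x).re := by
    funext x
    rw [(hf.hasSum x).tsum_eq, Complex.ofReal_re]
  rw [h2]
  exact Complex.continuous_re.comp h1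

theorem IsCharSystem.u_neg_mul (h : IsCharSystem μ e T u) (l : G) (a : A) :
    u (-l) * (u l * a) = a := by
  rw [← mul_assoc, ← h.u_add, neg_add_cancel, h.u_zero, one_mul]

theorem IsCharSystem.u_mul_neg (h : IsCharSystem μ e T u) (l : G) (a : A) :
    u l * (u (-l) * a) = a := by
  rw [← mul_assoc, ← h.u_add, add_neg_cancel, h.u_zero, one_mul]

/-- The permutation of the characters given by the action. -/
def IsCharSystem.mulEquiv (h : IsCharSystem μ e T u) (l : G) : A ≃ A where
  toFun a := u l * a
  invFun a := u (-l) * a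
  left_inv := h.u_neg_mul l
  right_inv := h.u_mul_neg l

theorem IsCharSeries.comp_shift (h : IsCharSystem μ e T u) {c : A → ℂ} {f : Ω → ℝ}
    (hf : IsCharSeries e c f) (l : G) :
    IsCharSeries e (fun b => c (u (-l) * b)) fun x => f (T l x) := by
  refine ⟨((h.mulEquiv (-l)).summable_iff (f := fun a => ‖c a‖)).2 hf.summable, fun x => ?_⟩
  rw [← (h.mulEquiv l).hasSum_iff]
  refine (hf.hasSum (T l x)).congr_fun fun a => ?_
  change c (u (-l) * (u l * a)) * e (u l * a) x = _
  rw [h.u_neg_mul, h.shift]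

/-- The autocorrelations of a series, in terms of its coefficients. -/
noncomputable def corr (u : G → A) (c : A → ℂ) (q : G) : ℂ := ∑' a, c a * c (-(u q * a))

/-- For `a ≠ 0` the frequencies `-(u q * a)` are distinct as `q` varies, so summing over `q` first
gives at most `‖c a‖` times the `ℓ¹` norm. The fixed frequency `0` is removed by `c 0 = 0`. -/
theorem summable_norm_corr (h : IsCharSystem μ e T u) {c : A → ℂ}
    (hc : Summable fun a => ‖c a‖) (hc0 : c 0 = 0) :
    (Summable fun q => ‖corr u c q‖) ∧ ∑' q, ‖corr u c q‖ ≤ (∑' a, ‖c a‖) ^ 2 := by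
  have hrow : ∀ a, (Summable fun q => ‖c a‖ * ‖c (-(u q * a))‖) ∧
      ∑' q, ‖c a‖ * ‖c (-(u q * a))‖ ≤ ‖c a‖ * ∑' b, ‖c b‖ := by
    intro a
    by_cases ha : a = 0
    · subst ha
      simp only [hc0, norm_zero, zero_mul, tsum_zero, le_refl, and_true]
      exact summable_zero
    · have hinj : Function.Injective fun q => -(u q * a) := fun q q' hq =>
        h.u_injective a ha (neg_injective hq)
      have hs : Summable fun q => ‖c (-(u q * a))‖ := hc.comp_injective hinj
      refine ⟨hs.mul_left _, ?_⟩
      rw [tsum_mul_left]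
      exact mul_le_mul_of_nonneg_left
        (hs.tsum_le_tsum_of_inj _ hinj (fun _ _ => norm_nonneg _) (fun _ => le_rfl) hc)
        (norm_nonneg _)
  have hprod : Summable fun x : A × G => ‖c x.1‖ * ‖c (-(u x.2 * x.1))‖ := by
    rw [summable_prod_of_nonneg fun x => by positivity]
    exact ⟨fun a => (hrow a).1, Summable.of_nonneg_of_le
      (fun a => tsum_nonneg fun q => by positivity) (fun a => (hrow a).2) (hc.mul_right _)⟩
  have hprod' : Summable fun x : G × A => ‖c x.2‖ * ‖c (-(u x.1 * x.2))‖ := hprod.prod_symm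
  have hle : ∀ q, ‖corr u c q‖ ≤ ∑' a, ‖c a‖ * ‖c (-(u q * a))‖ := by
    intro q
    have hs : Summable fun a => ‖c a * c (-(u q * a))‖ := by
      simpa only [norm_mul] using hprod'.prod_factor q
    refine (norm_tsum_le_tsum_norm hs).trans (le_of_eq ?_)
    simp only [norm_mul]
  have hsum : Summable fun q => ‖corr u c q‖ :=
    Summable.of_nonneg_of_le (fun _ => norm_nonneg _) hle hprod'.prod
  refine ⟨hsum, ?_⟩
  calc ∑' q, ‖corr u c q‖ ≤ ∑' q, ∑' a, ‖c a‖ * ‖c (-(u q * a))‖ :=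
        hsum.tsum_le_tsum hle hprod'.prod
    _ = ∑' a, ∑' q, ‖c a‖ * ‖c (-(u q * a))‖ := Summable.tsum_comm hprod
    _ ≤ ∑' a, ‖c a‖ * ∑' b, ‖c b‖ :=
        hprod.prod.tsum_le_tsum (fun a => (hrow a).2) (hc.mul_right _)
    _ = _ := by rw [tsum_mul_right, sq]

variable [CompactSpace Ω] [BorelSpace Ω] [IsProbabilityMeasure μ]

theorem integrable_of_continuous {E : Type*} [NormedAddCommGroup E] [SecondCountableTopology E]
    {g : Ω → E} (hg : Continuous g) : Integrable g μ :=
  hg.integrable_of_hasCompactSupport (HasCompactSupport.of_compactSpace g)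

theorem IsCharSeries.integral_char_mul [Countable A] (h : IsCharSystem μ e T u) {c : A → ℂ}
    {f : Ω → ℝ} (hf : IsCharSeries e c f) (b : A) : ∫ x, e b x * (f x : ℂ) ∂μ = c (-b) := by
  classical
  have h1 : ∀ x, e b x * (f x : ℂ) = ∑' a, c a * e (a + b) x := by
    intro x
    rw [← (hf.hasSum x).tsum_eq, ← tsum_mul_left]
    refine tsum_congr fun a => ?_
    rw [h.add]
    ring
  simp_rw [h1]
  rw [← integral_tsum_of_summable_integral_norm]
  · rw [tsum_eq_single (-b)]
    · rw [integral_const_mul, neg_add_cancel]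
      simp [h.zero]
    · intro a ha
      rw [integral_const_mul, h.integral _ (fun h0 => ha (eq_neg_of_add_eq_zero_left h0)), mul_zero]
  · exact fun a => integrable_of_continuous (continuous_const.mul (h.continuous _))
  · simpa [h.norm] using hf.summable

theorem IsCharSeries.integral_mul [Countable A] (h : IsCharSystem μ e T u) {c c' : A → ℂ}
    {f g : Ω → ℝ} (hf : IsCharSeries e c f) (hg : IsCharSeries e c' g) :
    ((∫ x, f x * g x ∂μ : ℝ) : ℂ) = ∑' a, c a * c' (-a) := by
  have hgc := hg.continuous h
  have h1 : ∀ x, ((f x * g x : ℝ) : ℂ) = ∑' a, c a * (e a x * (g x : ℂ)) := by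
    intro x
    rw [Complex.ofReal_mul, ← (hf.hasSum x).tsum_eq, ← tsum_mul_right]
    exact tsum_congr fun a => mul_assoc _ _ _
  obtain ⟨C, hC⟩ : ∃ C, ∀ x, ‖g x‖ ≤ C := by
    obtain ⟨C, hC⟩ := (isCompact_range hgc).isBounded.exists_norm_le
    exact ⟨C, fun x => hC _ ⟨x, rfl⟩⟩
  have hcont : ∀ a, Continuous fun x => c a * (e a x * (g x : ℂ)) := fun a =>
    continuous_const.mul ((h.continuous a).mul (Complex.continuous_ofReal.comp hgc))
  rw [← integral_complex_ofReal]
  simp_rw [h1]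
  rw [← integral_tsum_of_summable_integral_norm]
  · refine tsum_congr fun a => ?_
    rw [integral_const_mul, hg.integral_char_mul h]
  · exact fun a => integrable_of_continuous (hcont a)
  · refine Summable.of_nonneg_of_le (fun a => integral_nonneg fun x => norm_nonneg _) (fun a => ?_)
      (hf.summable.mul_right C)
    have h2 : ∀ x, ‖c a * (e a x * (g x : ℂ))‖ ≤ ‖c a‖ * C := by
      intro x
      rw [norm_mul, norm_mul, h.norm, one_mul, Complex.norm_real]
      exact mul_le_mul_of_nonneg_left (hC x) (norm_nonneg _)
    calc ∫ x, ‖c a * (e a x * (g x : ℂ))‖ ∂μ ≤ ∫ _, ‖c a‖ * C ∂μ :=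
          integral_mono (integrable_of_continuous (hcont a).norm) (integrable_const _) h2
      _ = ‖c a‖ * C := by simp

theorem IsCharSeries.conj_coeff [Countable A] (h : IsCharSystem μ e T u) {c : A → ℂ} {f : Ω → ℝ}
    (hf : IsCharSeries e c f) (a : A) : c (-a) = conj (c a) := by
  rw [← hf.integral_char_mul h a, ← neg_neg a, ← hf.integral_char_mul h (-a), ← integral_conj,
    neg_neg]
  refine integral_congr_ae (Eventually.of_forall fun x => ?_)
  simp only
  rw [map_mul, h.neg, Complex.conj_conj, Complex.conj_ofReal]

theorem IsCharSeries.integral_shift_mul_shift [Countable A] (h : IsCharSystem μ e T u)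
    {c : A → ℂ} {f : Ω → ℝ} (hf : IsCharSeries e c f) (l l' : G) :
    ((∫ x, f (T l x) * f (T l' x) ∂μ : ℝ) : ℂ) = corr u c (l - l') := by
  rw [(hf.comp_shift h l).integral_mul h (hf.comp_shift h l'), corr,
    ← (h.mulEquiv l).tsum_eq]
  refine tsum_congr fun a => ?_
  change c (u (-l) * (u l * a)) * c (u (-l') * -(u l * a)) = _
  rw [h.u_neg_mul, mul_neg, ← mul_assoc, ← h.u_add, neg_add_eq_sub]

/-- One identity serves twice: the constant weight gives the variance, and a character `m` of `G`
gives the positivity of the density at a point of the torus. -/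
theorem IsCharSeries.integral_norm_sum_sq [Countable A] (h : IsCharSystem μ e T u)
    {c : A → ℂ} {f : Ω → ℝ} (hf : IsCharSeries e c f) {m : G → ℂ}
    (hm : ∀ l l', m (l - l') = m l * conj (m l')) (D : Finset G) :
    ((∫ x, ‖∑ l ∈ D, m l * (f (T l x) : ℂ)‖ ^ 2 ∂μ : ℝ) : ℂ) =
      ∑ l ∈ D, ∑ l' ∈ D, m (l - l') * corr u c (l - l') := by
  have hcont : ∀ l, Continuous fun x => f (T l x) := fun l => (hf.comp_shift h l).continuous h
  have h1 : ∀ x, ((‖∑ l ∈ D, m l * (f (T l x) : ℂ)‖ ^ 2 : ℝ) : ℂ) =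
      ∑ l ∈ D, ∑ l' ∈ D, m (l - l') * ((f (T l x) * f (T l' x) : ℝ) : ℂ) := by
    intro x
    rw [Complex.ofReal_pow, ← Complex.mul_conj', map_sum, Finset.sum_mul_sum]
    refine Finset.sum_congr rfl fun l _ => Finset.sum_congr rfl fun l' _ => ?_
    rw [map_mul, Complex.conj_ofReal, hm]
    push_cast
    ring
  have hint : ∀ l l', Integrable (fun x => m (l - l') * ((f (T l x) * f (T l' x) : ℝ) : ℂ)) μ :=
    fun l l' => integrable_of_continuous (continuous_const.mul
      (Complex.continuous_ofReal.comp ((hcont l).mul (hcont l'))))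
  rw [← integral_complex_ofReal]
  simp_rw [h1]
  rw [integral_finsetSum _ fun l _ => integrable_finsetSum _ fun l' _ => hint l l']
  refine Finset.sum_congr rfl fun l _ => ?_
  rw [integral_finsetSum _ fun l' _ => hint l l']
  refine Finset.sum_congr rfl fun l' _ => ?_
  rw [integral_const_mul, integral_complex_ofReal, hf.integral_shift_mul_shift h]

theorem IsCharSeries.integral_sum_sq [Countable A] (h : IsCharSystem μ e T u)
    {c : A → ℂ} {f : Ω → ℝ} (hf : IsCharSeries e c f) (D : Finset G) :
    ((∫ x, (∑ l ∈ D, f (T l x)) ^ 2 ∂μ : ℝ) : ℂ) =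
      ∑ l ∈ D, ∑ l' ∈ D, corr u c (l - l') := by
  have h1 := hf.integral_norm_sum_sq h (m := fun _ => 1) (by simp) D
  simp only [one_mul] at h1
  rw [← h1]
  congr 2
  funext x
  rw [← Complex.ofReal_sum, Complex.norm_real, Real.norm_eq_abs, sq_abs]

theorem IsCharSeries.integral_sum_sq_le [Countable A] (h : IsCharSystem μ e T u)
    {c : A → ℂ} {f : Ω → ℝ} (hf : IsCharSeries e c f) (hc0 : c 0 = 0) (D : Finset G) :
    ∫ x, (∑ l ∈ D, f (T l x)) ^ 2 ∂μ ≤ D.card * (∑' a, ‖c a‖) ^ 2 := by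
  obtain ⟨hs, hle⟩ := summable_norm_corr h hf.summable hc0
  have h1 := congrArg norm (hf.integral_sum_sq h D)
  rw [Complex.norm_real] at h1
  have hinj : ∀ l : G, Function.Injective fun l' : G => l - l' := fun l => sub_right_injective
  calc ∫ x, (∑ l ∈ D, f (T l x)) ^ 2 ∂μ ≤ ‖∑ l ∈ D, ∑ l' ∈ D, corr u c (l - l')‖ := by
        rw [← h1]
        exact Real.le_norm_self _
    _ ≤ ∑ l ∈ D, ∑ l' ∈ D, ‖corr u c (l - l')‖ :=
        (norm_sum_le _ _).trans (Finset.sum_le_sum fun l _ => norm_sum_le _ _)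
    _ ≤ ∑ l ∈ D, (∑' a, ‖c a‖) ^ 2 := by
        refine Finset.sum_le_sum fun l _ => ?_
        have hs' : Summable fun l' => ‖corr u c (l - l')‖ := hs.comp_injective (hinj l)
        exact (hs'.sum_le_tsum D fun _ _ => norm_nonneg _).trans
          ((hs'.tsum_le_tsum_of_inj _ (hinj l) (fun _ _ => norm_nonneg _) (fun _ => le_rfl)
            hs).trans hle)
    _ = _ := by rw [Finset.sum_const, nsmul_eq_mul]

variable [MeasurableSpace G] [MeasurableSingletonClass G]

open scoped ComplexOrder in
/-- The spectral density is nonnegative. -/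
theorem IsCharSeries.tsum_mul_corr_nonneg [Countable A] (h : IsCharSystem μ e T u)
    {c : A → ℂ} {f : Ω → ℝ} (hf : IsCharSeries e c f) (hc0 : c 0 = 0) {m : G → ℂ}
    (hm : ∀ l l', m (l - l') = m l * conj (m l')) (hm1 : ∀ l, ‖m l‖ ≤ 1)
    {D : ℕ → Finset G} (hD : IsAddFoelner G Measure.count atTop fun n => (D n : Set G)) :
    0 ≤ ∑' q, m q * corr u c q := by
  have hs : Summable fun q => m q * corr u c q := by
    refine Summable.of_norm_bounded (summable_norm_corr h hf.summable hc0).1 fun q => ?_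
    rw [norm_mul]
    exact mul_le_of_le_one_left (norm_nonneg _) (hm1 q)
  have hlim := tendsto_sum_sum_sub_div_card hD hs
  -- The sum is a limit of Følner averages that are mean squares divided by cardinalities.
  refine ge_of_tendsto' hlim fun n => ?_
  rw [← hf.integral_norm_sum_sq h hm (D n), ← Complex.ofReal_natCast, ← Complex.ofReal_div]
  rw [Complex.zero_le_real]
  exact div_nonneg (integral_nonneg fun x => sq_nonneg _) (Nat.cast_nonneg _)

theorem IsCharSeries.tendsto_integral_sum_sq_div [Countable A] (h : IsCharSystem μ e T u)
    {c : A → ℂ} {f : Ω → ℝ} (hf : IsCharSeries e c f) (hc0 : c 0 = 0)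
    {D : ℕ → Finset G} (hD : IsAddFoelner G Measure.count atTop fun n => (D n : Set G)) :
    Tendsto (fun n => (∫ x, (∑ l ∈ D n, f (T l x)) ^ 2 ∂μ) / ((D n).card : ℝ)) atTop
      (𝓝 (∑' q, corr u c q).re) := by
  have hlim := tendsto_sum_sum_sub_div_card hD (summable_norm_corr h hf.summable hc0).1.of_norm
  refine ((Complex.continuous_re.tendsto _).comp hlim).congr fun n => ?_
  rw [Function.comp_apply, ← hf.integral_sum_sq h (D n), ← Complex.ofReal_natCast,
    ← Complex.ofReal_div, Complex.ofReal_re]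

end FourierSeries

/-! ### The limit theorem for trigonometric polynomials -/

section TrigPolynomials

variable {Ω A G : Type} [CommRing A] {u : G → A}

open Classical in
/-- The characters that occur in the sum over `D` of a trigonometric polynomial with frequencies
in `F`. -/
noncomputable def orbitFinset (u : G → A) (F : Finset A) (D : Finset G) : Finset A :=
  D.biUnion fun l => F.image fun a => u l * a

theorem mem_orbitFinset {F : Finset A} {D : Finset G} {b : A} :
    b ∈ orbitFinset u F D ↔ ∃ l ∈ D, ∃ a ∈ F, u l * a = b := by
  simp [orbitFinset]

theorem card_orbitFinset_le (F : Finset A) (D : Finset G) :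
    (orbitFinset u F D).card ≤ F.card * D.card := by
  classical
  rw [mul_comm]
  exact Finset.card_biUnion_le_card_mul _ _ _ fun l _ => Finset.card_image_le

theorem neg_mem_orbitFinset {F : Finset A} (hF : ∀ a ∈ F, -a ∈ F) (D : Finset G) :
    ∀ b ∈ orbitFinset u F D, -b ∈ orbitFinset u F D := by
  intro b hb
  obtain ⟨l, hl, a, ha, rfl⟩ := mem_orbitFinset.1 hb
  exact mem_orbitFinset.2 ⟨l, hl, -a, hF a ha, by rw [mul_neg]⟩

variable [TopologicalSpace Ω] [MeasurableSpace Ω] [AddCommGroup G] {μ : Measure Ω}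
  {e : A → Ω → ℂ} {T : G → Ω → Ω}

theorem zero_notMem_orbitFinset (h : IsCharSystem μ e T u) {F : Finset A} (hF : 0 ∉ F)
    (D : Finset G) : 0 ∉ orbitFinset u F D := by
  rw [mem_orbitFinset]
  rintro ⟨l, -, a, ha, h0⟩
  have := h.u_neg_mul l a
  rw [h0, mul_zero] at this
  exact hF (this ▸ ha)

/-- The coefficients of the sum over `D` of a series with coefficients `c`. -/
noncomputable def orbitWeight (u : G → A) (c : A → ℂ) (D : Finset G) (b : A) : ℂ :=
  ∑ l ∈ D, c (u (-l) * b)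

/-- Uniform in `D`: by freeness the frequencies `u (-l) * b` are distinct, so each coefficient `c a`
is used at most once. -/
theorem norm_orbitWeight_le (h : IsCharSystem μ e T u) {c : A → ℂ}
    (hc : Summable fun a => ‖c a‖) (D : Finset G) {b : A} (hb : b ≠ 0) :
    ‖orbitWeight u c D b‖ ≤ ∑' a, ‖c a‖ := by
  have hinj : Function.Injective fun l => u (-l) * b := fun l l' hl =>
    neg_injective (h.u_injective b hb hl)
  have hs : Summable fun l => ‖c (u (-l) * b)‖ := hc.comp_injective hinj
  exact (norm_sum_le _ _).trans ((hs.sum_le_tsum D fun _ _ => norm_nonneg _).trans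
    (hs.tsum_le_tsum_of_inj _ hinj (fun _ _ => norm_nonneg _) (fun _ => le_rfl) hc))

theorem IsCharSeries.sum_shift_eq (h : IsCharSystem μ e T u) {c : A → ℂ} {f : Ω → ℝ}
    (hf : IsCharSeries e c f) {F : Finset A} (hF : ∀ a ∉ F, c a = 0) (D : Finset G) (x : Ω) :
    ((∑ l ∈ D, f (T l x) : ℝ) : ℂ) =
      ∑ b ∈ orbitFinset u F D, orbitWeight u c D b * e b x := by
  have h1 : ∀ l ∈ D, ((f (T l x) : ℝ) : ℂ) =
      ∑ b ∈ orbitFinset u F D, c (u (-l) * b) * e b x := by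
    intro l hl
    refine ((hf.comp_shift h l).hasSum x).unique (hasSum_sum_of_ne_finset_zero fun b hb => ?_)
    rw [hF, zero_mul]
    intro hm
    exact hb (mem_orbitFinset.2 ⟨l, hl, _, hm, h.u_mul_neg l b⟩)
  rw [Complex.ofReal_sum, Finset.sum_congr rfl h1, Finset.sum_comm]
  refine Finset.sum_congr rfl fun b _ => ?_
  rw [orbitWeight, Finset.sum_mul]

theorem IsCharSystem.prod (h : IsCharSystem μ e T u) {ι : Type*} (s : Finset ι) (b : ι → A)
    (x : Ω) : ∏ i ∈ s, e (b i) x = e (∑ i ∈ s, b i) x := by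
  classical
  induction s using Finset.induction_on with
  | empty => simp [h.zero]
  | insert i s hi ih => rw [Finset.prod_insert hi, Finset.sum_insert hi, h.add, ih]

variable [CompactSpace Ω] [BorelSpace Ω] [IsProbabilityMeasure μ]

/-- Expanding the power gives one character per `r`-tuple of frequencies, and only the trivial one
has nonzero integral. -/
theorem integral_sum_char_pow (h : IsCharSystem μ e T u) (B : Finset A) (w : A → ℂ) (r : ℕ) :
    ∫ x, (∑ b ∈ B, w b * e b x) ^ r ∂μ = zeroSumWeight B w r := by
  classical
  have h1 : ∀ x, (∑ b ∈ B, w b * e b x) ^ r =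
      ∑ b ∈ Fintype.piFinset fun _ : Fin r => B, (∏ i, w (b i)) * e (∑ i, b i) x := by
    intro x
    have h2 : (∑ b ∈ B, w b * e b x) ^ r = ∏ _i : Fin r, ∑ b ∈ B, w b * e b x := by simp
    rw [h2, Finset.prod_univ_sum]
    refine Finset.sum_congr rfl fun b _ => ?_
    rw [Finset.prod_mul_distrib, h.prod]
  have hint : ∀ b : Fin r → A, Integrable (fun x => (∏ i, w (b i)) * e (∑ i, b i) x) μ := fun b =>
    integrable_of_continuous (continuous_const.mul (h.continuous _))
  simp_rw [h1]
  rw [integral_finsetSum _ fun b _ => hint b, zeroSumWeight, zeroSums, Finset.sum_filter]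
  refine Finset.sum_congr (Finset.ext fun b => by simp only [Fintype.mem_piFinset]) fun b _ => ?_
  rw [integral_const_mul]
  split_ifs with h0
  · rw [h0]
    simp [h.zero]
  · rw [h.integral _ h0, mul_zero]

theorem IsCharSeries.integral_sum_shift_pow (h : IsCharSystem μ e T u) {c : A → ℂ} {f : Ω → ℝ}
    (hf : IsCharSeries e c f) {F : Finset A} (hF : ∀ a ∉ F, c a = 0) (D : Finset G) (r : ℕ) :
    ((∫ x, (∑ l ∈ D, f (T l x)) ^ r ∂μ : ℝ) : ℂ) =
      zeroSumWeight (orbitFinset u F D) (orbitWeight u c D) r := by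
  rw [← integral_sum_char_pow h, ← integral_complex_ofReal]
  refine integral_congr_ae (Eventually.of_forall fun x => ?_)
  simp only
  rw [Complex.ofReal_pow, hf.sum_shift_eq h hF]

theorem IsCharSeries.integral_sum_shift_eq_zero (h : IsCharSystem μ e T u) {c : A → ℂ}
    {f : Ω → ℝ} (hf : IsCharSeries e c f) {F : Finset A} (hF : ∀ a ∉ F, c a = 0) (hF0 : 0 ∉ F)
    (D : Finset G) : ∫ x, ∑ l ∈ D, f (T l x) ∂μ = 0 := by
  have h1 := hf.integral_sum_shift_pow h hF D 1
  simp only [pow_one] at h1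
  have h2 : zeroSums (Fin 1) (orbitFinset u F D) = ∅ := by
    refine Finset.eq_empty_of_forall_notMem fun b hb => ?_
    obtain ⟨hB, hs⟩ := mem_zeroSums.1 hb
    rw [Fin.sum_univ_one] at hs
    exact zero_notMem_orbitFinset h hF0 D (hs ▸ hB 0)
  rw [zeroSumWeight, h2, Finset.sum_empty] at h1
  exact_mod_cast h1

/-- The central limit theorem for trigonometric polynomials whose orbits have few minimal zero
sums. -/
theorem IsCharSeries.tendsto_integral_exp (h : IsCharSystem μ e T u) {c : A → ℂ}
    {f : Ω → ℝ} (hf : IsCharSeries e c f) {F : Finset A} (hF : ∀ a ∉ F, c a = 0) (hF0 : 0 ∉ F)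
    (hFneg : ∀ a ∈ F, -a ∈ F) {D : ℕ → Finset G}
    (hD : Tendsto (fun n => ((D n).card : ℝ)) atTop atTop)
    (hcount : ∀ r : ℕ, ∀ᶠ n in atTop, ∀ (ι : Type) [Fintype ι], Fintype.card ι ≤ r →
      ((minZeroSums ι (orbitFinset u F (D n))).card : ℝ) ≤ √√((D n).card : ℝ) ^ 5) {v : ℝ}
    (hv : Tendsto (fun n => (∫ x, (∑ l ∈ D n, f (T l x)) ^ 2 ∂μ) / ((D n).card : ℝ)) atTop
      (𝓝 v)) (t : ℝ) :
    Tendsto (fun n => ∫ x, Complex.exp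
      (t * ((√((D n).card : ℝ))⁻¹ * ∑ l ∈ D n, f (T l x) : ℝ) * Complex.I) ∂μ) atTop
      (𝓝 (Complex.exp (-(v * t ^ 2 / 2)))) := by
  have hcont : ∀ n, Continuous fun x => (√((D n).card : ℝ))⁻¹ * ∑ l ∈ D n, f (T l x) := fun n =>
    continuous_const.mul (continuous_finsetSum _ fun l _ => (hf.comp_shift h l).continuous h)
  have hmom : ∀ n r, ∫ x, ((√((D n).card : ℝ))⁻¹ * ∑ l ∈ D n, f (T l x)) ^ r ∂μ =
      (√((D n).card : ℝ))⁻¹ ^ r * ∫ x, (∑ l ∈ D n, f (T l x)) ^ r ∂μ := by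
    intro n r
    rw [← integral_const_mul]
    simp_rw [mul_pow]
  refine tendsto_integral_exp_of_moments (fun n => (hcont n).aestronglyMeasurable)
    (fun n r => integrable_of_continuous ((hcont n).pow r)) ?_ ?_ (fun r => ?_) t
  · refine tendsto_const_nhds.congr fun n => ?_
    rw [integral_const_mul, hf.integral_sum_shift_eq_zero h hF hF0, mul_zero]
  · refine hv.congr fun n => ?_
    rw [hmom, inv_pow, Real.sq_sqrt (Nat.cast_nonneg _), inv_mul_eq_div]
  · set c₀ := max (F.card : ℝ) (∑' a, ‖c a‖) with hc₀
    have hc₀0 : 0 ≤ c₀ := (Nat.cast_nonneg _).trans (le_max_left _ _)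
    obtain ⟨C, hC, hmain⟩ := exists_norm_zeroSumWeight_sub_le hc₀0 r
    have hν : Tendsto (fun n => √√((D n).card : ℝ)) atTop atTop :=
      Real.tendsto_sqrt_atTop.comp (Real.tendsto_sqrt_atTop.comp hD)
    have hlim : Tendsto (fun n => C * (√√((D n).card : ℝ))⁻¹) atTop (𝓝 0) := by
      simpa using (tendsto_inv_atTop_zero.comp hν).const_mul C
    refine squeeze_zero_norm' ?_ hlim
    filter_upwards [hcount (r + 2), hν.eventually_ge_atTop 1] with n hn hν1
    -- With the fourth root as parameter, `|D n| = ν ^ 4`, the normalization is `ν ^ 2`, and the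
    -- permitted number of long blocks is `ν ^ 5`. The moment error becomes `ν ^ (2r+3) / ν ^ (2r+4)
    -- = 1/ν`.
    obtain ⟨ν, hνdef⟩ : ∃ ν, ν = √√((D n).card : ℝ) := ⟨_, rfl⟩
    rw [← hνdef] at hn hν1 ⊢
    have hν2 : √((D n).card : ℝ) = ν ^ 2 := by
      rw [hνdef, Real.sq_sqrt (Real.sqrt_nonneg _)]
    clear hνdef
    have hν4 : ((D n).card : ℝ) = ν ^ 4 := by
      rw [show (4 : ℕ) = 2 * 2 by rfl, pow_mul, ← hν2, Real.sq_sqrt (Nat.cast_nonneg _)]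
    have hν0 : 0 < ν := zero_lt_one.trans_le hν1
    have hB0 := zero_notMem_orbitFinset h hF0 (D n)
    have hsparse : IsSparse c₀ (r + 2) ν (orbitFinset u F (D n)) := by
      refine ⟨hν1, hB0, neg_mem_orbitFinset hFneg _, ?_, fun ι _ _ hι => hn ι hι⟩
      rw [← hν4]
      calc ((orbitFinset u F (D n)).card : ℝ) ≤ F.card * (D n).card := by
            exact_mod_cast card_orbitFinset_le F (D n)
        _ ≤ c₀ * (D n).card :=
            mul_le_mul_of_nonneg_right (le_max_left _ _) (Nat.cast_nonneg _)
    have hb := hmain A ν (orbitFinset u F (D n)) (orbitWeight u c (D n)) hsparse fun b hb =>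
      (norm_orbitWeight_le h hf.summable (D n) (fun h0 => hB0 (h0 ▸ hb))).trans (le_max_right _ _)
    rw [← hf.integral_sum_shift_pow h hF, ← hf.integral_sum_shift_pow h hF,
      ← hf.integral_sum_shift_pow h hF] at hb
    rw [hmom, hmom, hmom, hν2]
    clear hn hsparse hν2 hν4
    have hpos : 0 < (ν ^ 2)⁻¹ ^ (r + 2) := pow_pos (inv_pos.2 (pow_pos hν0 2)) _
    have hb' : |(∫ x, (∑ l ∈ D n, f (T l x)) ^ (r + 2) ∂μ) - (r + 1) *
        (∫ x, (∑ l ∈ D n, f (T l x)) ^ 2 ∂μ) * ∫ x, (∑ l ∈ D n, f (T l x)) ^ r ∂μ| ≤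
        C * ν ^ (2 * r + 3) := by
      rw [← Real.norm_eq_abs, ← Complex.norm_real]
      push_cast
      exact hb
    calc _ = (ν ^ 2)⁻¹ ^ (r + 2) * |(∫ x, (∑ l ∈ D n, f (T l x)) ^ (r + 2) ∂μ) - (r + 1) *
        (∫ x, (∑ l ∈ D n, f (T l x)) ^ 2 ∂μ) * ∫ x, (∑ l ∈ D n, f (T l x)) ^ r ∂μ| := by
          rw [← abs_of_pos hpos, ← abs_mul,
            Real.norm_eq_abs, abs_of_pos hpos]
          congr 1
          ring
      _ ≤ (ν ^ 2)⁻¹ ^ (r + 2) * (C * ν ^ (2 * r + 3)) := mul_le_mul_of_nonneg_left hb' hpos.le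
      _ = C * ν⁻¹ := by
          have hν' := hν0.ne'
          rw [inv_pow, ← pow_mul]
          field_simp
          ring

end TrigPolynomials

/-! ### Stability under small changes in `L²` -/

section Approximation

variable {Ω : Type*} [MeasurableSpace Ω] {μ : Measure Ω}

/-- Factor the difference of squares and use the weighted inequality `|ab| ≤ a²/ε + ε b²/4`
pointwise, with `a = X - Y` and `b = X + Y`. -/
theorem abs_integral_sq_sub_le {X Y : Ω → ℝ} (hX : Integrable (fun x => X x ^ 2) μ)
    (hY : Integrable (fun x => Y x ^ 2) μ) (hXY : Integrable (fun x => (X x - Y x) ^ 2) μ)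
    {ε M : ℝ} (hε : 0 < ε) (hle : ∫ x, (X x - Y x) ^ 2 ∂μ ≤ ε ^ 2) (hXM : ∫ x, X x ^ 2 ∂μ ≤ M)
    (hYM : ∫ x, Y x ^ 2 ∂μ ≤ M) :
    |∫ x, X x ^ 2 ∂μ - ∫ x, Y x ^ 2 ∂μ| ≤ ε * (2 * M + 1) := by
  rw [← integral_sub hX hY, ← Real.norm_eq_abs]
  have hbound : ∀ x, ‖X x ^ 2 - Y x ^ 2‖ ≤
      ε * (X x ^ 2 + Y x ^ 2) + (X x - Y x) ^ 2 * ε⁻¹ := by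
    intro x
    have h1 : (X x - Y x) ^ 2 * ε⁻¹ = |X x - Y x| ^ 2 / ε := by rw [sq_abs, div_eq_mul_inv]
    have h2 : X x ^ 2 - Y x ^ 2 = (X x - Y x) * (X x + Y x) := by ring
    have h3 : 0 ≤ (|X x - Y x| - ε * |X x + Y x| / 2) ^ 2 / ε := by positivity
    have h4 : (|X x - Y x| - ε * |X x + Y x| / 2) ^ 2 / ε =
        |X x - Y x| ^ 2 / ε - |X x - Y x| * |X x + Y x| + ε * |X x + Y x| ^ 2 / 4 := by
      field_simp
      ring
    have h5 : |X x + Y x| ^ 2 / 4 ≤ X x ^ 2 + Y x ^ 2 := by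
      rw [sq_abs]
      nlinarith [sq_nonneg (X x - Y x), sq_nonneg (X x), sq_nonneg (Y x)]
    have h6 := mul_le_mul_of_nonneg_left h5 hε.le
    rw [h1, Real.norm_eq_abs, h2, abs_mul]
    rw [h4] at h3
    linarith
  have hi1 : Integrable (fun x => ε * (X x ^ 2 + Y x ^ 2)) μ := (hX.add hY).const_mul ε
  have hi2 := hXY.mul_const ε⁻¹
  refine (norm_integral_le_of_norm_le (hi1.add hi2) (Eventually.of_forall hbound)).trans ?_
  have h7 : (∫ x, (X x - Y x) ^ 2 ∂μ) * ε⁻¹ ≤ ε := by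
    rw [← div_eq_mul_inv, div_le_iff₀ hε, ← sq]
    exact hle
  have h8 : ∫ x, (ε * (X x ^ 2 + Y x ^ 2) + (X x - Y x) ^ 2 * ε⁻¹) ∂μ =
      ε * (∫ x, X x ^ 2 ∂μ + ∫ x, Y x ^ 2 ∂μ) + (∫ x, (X x - Y x) ^ 2 ∂μ) * ε⁻¹ := by
    rw [integral_add hi1 hi2, integral_const_mul, integral_add hX hY, integral_mul_const]
  refine (le_of_eq h8).trans ?_
  have h9 : ε * (∫ x, X x ^ 2 ∂μ + ∫ x, Y x ^ 2 ∂μ) ≤ ε * (M + M) := by gcongr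
  linarith

variable [IsProbabilityMeasure μ]

/-- The exponential is Lipschitz on the imaginary axis, and `|X - Y| ≤ (ε + (X - Y)²/ε)/2` passes
from the first moment to the second. -/
theorem norm_integral_exp_sub_le {X Y : Ω → ℝ} (hX : AEStronglyMeasurable X μ)
    (hY : AEStronglyMeasurable Y μ) (hXY : Integrable (fun x => (X x - Y x) ^ 2) μ) {ε : ℝ}
    (hε : 0 < ε) (hle : ∫ x, (X x - Y x) ^ 2 ∂μ ≤ ε ^ 2) (t : ℝ) :
    ‖∫ x, Complex.exp (t * X x * Complex.I) ∂μ - ∫ x, Complex.exp (t * Y x * Complex.I) ∂μ‖ ≤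
      |t| * ε := by
  have hint : ∀ Z : Ω → ℝ, AEStronglyMeasurable Z μ →
      Integrable (fun x => Complex.exp (t * Z x * Complex.I)) μ := by
    intro Z hZ
    refine Integrable.of_bound (C := 1) ?_ (Eventually.of_forall fun x => ?_)
    · have hc : Continuous fun y : ℝ => Complex.exp (t * y * Complex.I) := by fun_prop
      exact hc.comp_aestronglyMeasurable hZ
    · rw [← Complex.ofReal_mul, Complex.norm_exp_ofReal_mul_I]
  have hlip : ∀ a b : ℝ, ‖Complex.exp (a * Complex.I) - Complex.exp (b * Complex.I)‖ ≤ |a - b| := by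
    intro a b
    have h1 := norm_exp_mul_I_sub_taylor_le 1 (a - b)
    simp only [Finset.range_one, Finset.sum_singleton, pow_zero, Nat.factorial_zero, Nat.cast_one,
      div_one, pow_one, Nat.factorial_one] at h1
    have h2 : Complex.exp (a * Complex.I) - Complex.exp (b * Complex.I) =
        Complex.exp (b * Complex.I) * (Complex.exp (((a - b : ℝ) : ℂ) * Complex.I) - 1) := by
      rw [mul_sub, ← Complex.exp_add, mul_one]
      congr 2
      push_cast
      ring
    rw [h2, norm_mul, Complex.norm_exp_ofReal_mul_I, one_mul]
    exact h1
  rw [← integral_sub (hint X hX) (hint Y hY)]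
  have hbound : ∀ x, ‖Complex.exp (t * X x * Complex.I) - Complex.exp (t * Y x * Complex.I)‖ ≤
      |t| * ((ε + (X x - Y x) ^ 2 * ε⁻¹) / 2) := by
    intro x
    have h1 := hlip (t * X x) (t * Y x)
    push_cast at h1
    refine h1.trans ?_
    rw [← mul_sub, abs_mul]
    refine mul_le_mul_of_nonneg_left ?_ (abs_nonneg t)
    have h2 : (X x - Y x) ^ 2 * ε⁻¹ = |X x - Y x| ^ 2 / ε := by rw [sq_abs, div_eq_mul_inv]
    rw [h2, le_div_iff₀ two_pos, ← sub_nonneg]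
    have h3 : ε + |X x - Y x| ^ 2 / ε - |X x - Y x| * 2 = (ε - |X x - Y x|) ^ 2 / ε := by
      field_simp
      ring
    rw [h3]
    positivity
  have hint2 : Integrable (fun x => |t| * ((ε + (X x - Y x) ^ 2 * ε⁻¹) / 2)) μ :=
    (((integrable_const ε).add (hXY.mul_const _)).div_const 2).const_mul _
  refine (norm_integral_le_of_norm_le hint2 (Eventually.of_forall hbound)).trans ?_
  rw [integral_const_mul, integral_div, integral_add (integrable_const ε) (hXY.mul_const _),
    integral_mul_const]
  refine mul_le_mul_of_nonneg_left ?_ (abs_nonneg t)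
  have h4 : (∫ x, (X x - Y x) ^ 2 ∂μ) * ε⁻¹ ≤ ε := by
    rw [← div_eq_mul_inv, div_le_iff₀ hε, ← sq]
    exact hle
  simp only [integral_const, probReal_univ, smul_eq_mul, one_mul]
  linarith

end Approximation

/-! ### From trigonometric polynomials to absolutely convergent series -/

section Truncation

open scoped ComplexConjugate

variable {Ω A G : Type} [CommRing A] {u : G → A} [TopologicalSpace Ω] [MeasurableSpace Ω]
  [AddCommGroup G] {μ : Measure Ω} {e : A → Ω → ℂ} {T : G → Ω → Ω} [CompactSpace Ω]
  [BorelSpace Ω] [IsProbabilityMeasure μ] [Countable A]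

/-- A series is approximated by the trigonometric polynomials cut out of it. -/
theorem IsCharSeries.exists_truncation (h : IsCharSystem μ e T u) {c : A → ℂ} {f : Ω → ℝ}
    (hf : IsCharSeries e c f) (hc0 : c 0 = 0) {ε : ℝ} (hε : 0 < ε) :
    ∃ (F : Finset A) (c' : A → ℂ) (g : Ω → ℝ), 0 ∉ F ∧ (∀ a ∈ F, -a ∈ F) ∧
      (∀ a ∉ F, c' a = 0) ∧ IsCharSeries e c' g ∧
      IsCharSeries e (fun a => c a - c' a) (fun x => f x - g x) ∧
      ∑' a, ‖c a - c' a‖ ≤ ε ∧ ∑' a, ‖c' a‖ ≤ ∑' a, ‖c a‖ := by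
  classical
  obtain ⟨s, hs⟩ := eventually_atTop.1
    ((tendsto_tsum_compl_atTop_zero fun a => ‖c a‖).eventually (gt_mem_nhds hε))
  -- A symmetric set of frequencies keeps the truncation real, because `c (-a)` is the conjugate of
  -- `c a`. Removing `0` costs nothing since `c 0 = 0`.
  set s' : Finset A := s ∪ s.image Neg.neg with hs'
  have hs'neg : ∀ a, a ∈ s' → -a ∈ s' := by
    intro a ha
    rw [hs', Finset.mem_union, Finset.mem_image] at ha ⊢
    rcases ha with ha | ⟨b, hb, rfl⟩
    · exact Or.inr ⟨a, ha, rfl⟩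
    · exact Or.inl (by rwa [neg_neg])
  have hFneg : ∀ a ∈ s'.erase 0, -a ∈ s'.erase 0 := by
    intro a ha
    rw [Finset.mem_erase] at ha ⊢
    exact ⟨neg_ne_zero.2 ha.1, hs'neg a ha.2⟩
  set c' : A → ℂ := fun a => if a ∈ s'.erase 0 then c a else 0 with hc'
  have hle : ∀ a, ‖c' a‖ ≤ ‖c a‖ := by
    intro a
    simp only [hc']
    split_ifs
    · exact le_rfl
    · rw [norm_zero]
      exact norm_nonneg _
  have hsum' : Summable fun a => ‖c' a‖ :=
    Summable.of_nonneg_of_le (fun _ => norm_nonneg _) hle hf.summable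
  have hreal : ∀ x, ((∑ a ∈ s'.erase 0, c a * e a x).re : ℂ) = ∑ a ∈ s'.erase 0, c a * e a x := by
    intro x
    rw [← Complex.conj_eq_iff_re, map_sum]
    refine Finset.sum_equiv (Equiv.neg A) (fun a => ⟨hFneg a, fun ha => ?_⟩) fun a _ => ?_
    · simpa using hFneg _ ha
    · rw [map_mul, ← hf.conj_coeff h, ← h.neg]
      rfl
  have hg : IsCharSeries e c' fun x => (∑ a ∈ s'.erase 0, c a * e a x).re := by
    refine ⟨hsum', fun x => ?_⟩
    rw [hreal]
    have h1 : ∑ a ∈ s'.erase 0, c a * e a x = ∑ a ∈ s'.erase 0, c' a * e a x :=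
      Finset.sum_congr rfl fun a ha => by simp only [hc', if_pos ha]
    rw [h1]
    refine hasSum_sum_of_ne_finset_zero fun a ha => ?_
    simp only [hc', if_neg ha, zero_mul]
  have hdiff : ∀ a, ‖c a - c' a‖ = Set.indicator {x | x ∉ s'} (fun a => ‖c a‖) a := by
    intro a
    by_cases ha : a ∈ s'
    · rw [Set.indicator_of_notMem (by simpa using ha)]
      by_cases ha0 : a = 0
      · simp [hc', ha0, hc0]
      · simp [hc', ha0, ha]
    · rw [Set.indicator_of_mem (by simpa using ha)]
      simp [hc', ha]
  refine ⟨s'.erase 0, c', _, Finset.notMem_erase _ _, hFneg, fun a ha => if_neg ha, hg, ⟨?_, ?_⟩,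
    ?_, hsum'.tsum_le_tsum hle hf.summable⟩
  · exact Summable.of_nonneg_of_le (fun _ => norm_nonneg _) (fun a => norm_sub_le _ _)
      (hf.summable.add hsum')
  · intro x
    have h1 := (hf.hasSum x).sub (hg.hasSum x)
    rw [Complex.ofReal_sub]
    exact h1.congr_fun fun a => sub_mul _ _ _
  · simp_rw [hdiff]
    rw [← tsum_subtype]
    exact (hs s' Finset.subset_union_left).le

variable [MeasurableSpace G] [MeasurableSingletonClass G]

/-- The central limit theorem for absolutely convergent series when the orbits of all finite sets
of characters have few minimal zero sums. -/
theorem IsCharSeries.tendsto_integral_exp_of_foelner (h : IsCharSystem μ e T u) {c : A → ℂ}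
    {f : Ω → ℝ} (hf : IsCharSeries e c f) (hc0 : c 0 = 0) {D : ℕ → Finset G}
    (hD : IsAddFoelner G Measure.count atTop fun n => (D n : Set G))
    (hcard : Tendsto (fun n => ((D n).card : ℝ)) atTop atTop)
    (hcount : ∀ F : Finset A, 0 ∉ F → ∀ r : ℕ, ∀ᶠ n in atTop, ∀ (ι : Type) [Fintype ι],
      Fintype.card ι ≤ r →
        ((minZeroSums ι (orbitFinset u F (D n))).card : ℝ) ≤ √√((D n).card : ℝ) ^ 5) (t : ℝ) :
    Tendsto (fun n => ∫ x, Complex.exp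
      (t * ((√((D n).card : ℝ))⁻¹ * ∑ l ∈ D n, f (T l x) : ℝ) * Complex.I) ∂μ) atTop
      (𝓝 (Complex.exp (-((∑' q, corr u c q).re * t ^ 2 / 2)))) := by
  set v := (∑' q, corr u c q).re with hv
  set M := (∑' a, ‖c a‖) ^ 2 with hM
  have hM0 : 0 ≤ M := sq_nonneg _
  have hXcont : ∀ {c : A → ℂ} {f : Ω → ℝ}, IsCharSeries e c f → ∀ n,
      Continuous fun x => (√((D n).card : ℝ))⁻¹ * ∑ l ∈ D n, f (T l x) := fun hf n =>
    continuous_const.mul (continuous_finsetSum _ fun l _ => (hf.comp_shift h l).continuous h)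
  have hsq : ∀ (f : Ω → ℝ) n, ∫ x, ((√((D n).card : ℝ))⁻¹ * ∑ l ∈ D n, f (T l x)) ^ 2 ∂μ =
      (∫ x, (∑ l ∈ D n, f (T l x)) ^ 2 ∂μ) / ((D n).card : ℝ) := by
    intro f n
    simp_rw [mul_pow]
    rw [integral_const_mul, inv_pow, Real.sq_sqrt (Nat.cast_nonneg _), inv_mul_eq_div]
  have hsqle : ∀ {c : A → ℂ} {f : Ω → ℝ}, IsCharSeries e c f → c 0 = 0 → ∀ n,
      ∫ x, ((√((D n).card : ℝ))⁻¹ * ∑ l ∈ D n, f (T l x)) ^ 2 ∂μ ≤ (∑' a, ‖c a‖) ^ 2 := by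
    intro c f hf hc0 n
    rw [hsq]
    refine div_le_of_le_mul₀ (Nat.cast_nonneg _) (sq_nonneg _) ?_
    rw [mul_comm]
    exact hf.integral_sum_sq_le h hc0 (D n)
  rw [Metric.tendsto_atTop']
  intro η hη
  have hexp : ContinuousAt (fun w : ℝ => Complex.exp (-(w * t ^ 2 / 2))) v := by fun_prop
  obtain ⟨δ, hδ, hδexp⟩ := Metric.continuousAt_iff.1 hexp (η / 3) (by positivity)
  -- The truncation must be close enough to change little both the limit variance and the
  -- characteristic functions, uniformly in `n`.
  obtain ⟨ε, hε, hε1, hε2⟩ : ∃ ε > 0, ε * (2 * M + 1) < δ ∧ |t| * ε < η / 3 := by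
    have hlim1 : Tendsto (fun ε : ℝ => ε * (2 * M + 1)) (𝓝[>] 0) (𝓝 0) :=
      ((continuous_id.mul continuous_const).tendsto' _ _ (zero_mul _)).mono_left
        nhdsWithin_le_nhds
    have hlim2 : Tendsto (fun ε : ℝ => |t| * ε) (𝓝[>] 0) (𝓝 0) :=
      ((continuous_const.mul continuous_id).tendsto' _ _ (mul_zero _)).mono_left
        nhdsWithin_le_nhds
    obtain ⟨ε, h1, h2, h3⟩ := ((hlim1.eventually (gt_mem_nhds hδ)).and
      ((hlim2.eventually (gt_mem_nhds (show 0 < η / 3 by positivity))).and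
        self_mem_nhdsWithin)).exists
    exact ⟨ε, h3, h1, h2⟩
  obtain ⟨F, c', g, hF0, hFneg, hF, hg, hfg, hle, hle'⟩ := hf.exists_truncation h hc0 hε
  have hc'0 : c' 0 = 0 := hF 0 hF0
  have hsub : ∀ n x, (√((D n).card : ℝ))⁻¹ * ∑ l ∈ D n, f (T l x) -
      (√((D n).card : ℝ))⁻¹ * ∑ l ∈ D n, g (T l x) =
      (√((D n).card : ℝ))⁻¹ * ∑ l ∈ D n, (f (T l x) - g (T l x)) := by
    intro n x
    rw [Finset.sum_sub_distrib, mul_sub]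
  have hXY : ∀ n, ∫ x, ((√((D n).card : ℝ))⁻¹ * ∑ l ∈ D n, f (T l x) -
      (√((D n).card : ℝ))⁻¹ * ∑ l ∈ D n, g (T l x)) ^ 2 ∂μ ≤ ε ^ 2 := by
    intro n
    simp_rw [hsub]
    refine (hsqle hfg (by rw [hc0, hc'0, sub_zero]) n).trans ?_
    exact pow_le_pow_left₀ (tsum_nonneg fun _ => norm_nonneg _) hle 2
  have hXYi : ∀ n, Integrable (fun x => ((√((D n).card : ℝ))⁻¹ * ∑ l ∈ D n, f (T l x) -
      (√((D n).card : ℝ))⁻¹ * ∑ l ∈ D n, g (T l x)) ^ 2) μ := fun n =>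
    integrable_of_continuous (((hXcont hf n).sub (hXcont hg n)).pow 2)
  have hgv := hg.tendsto_integral_sum_sq_div h hc'0 hD
  set v' := (∑' q, corr u c' q).re with hv'
  -- Both variances are limits of normalized second moments, which are close for every `n`.
  have hvv' : |v' - v| ≤ ε * (2 * M + 1) := by
    refine le_of_tendsto' (hgv.sub (hf.tendsto_integral_sum_sq_div h hc0 hD)).abs fun n => ?_
    rw [← hsq, ← hsq, abs_sub_comm]
    refine abs_integral_sq_sub_le (integrable_of_continuous ((hXcont hf n).pow 2))
      (integrable_of_continuous ((hXcont hg n).pow 2)) (hXYi n) hε (hXY n) (hsqle hf hc0 n) ?_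
    exact (hsqle hg hc'0 n).trans
      (pow_le_pow_left₀ (tsum_nonneg fun _ => norm_nonneg _) hle' 2)
  have hclt := hg.tendsto_integral_exp h hF hF0 hFneg hcard (hcount F hF0) hgv t
  obtain ⟨N, hN⟩ := Metric.tendsto_atTop'.1 hclt (η / 3) (by positivity)
  refine ⟨N, fun n hn => ?_⟩
  have h1 := norm_integral_exp_sub_le (hXcont hf n).aestronglyMeasurable
    (hXcont hg n).aestronglyMeasurable (hXYi n) hε (hXY n) t
  have h2 := hN n hn
  have h3 := hδexp (x := v') (by rw [Real.dist_eq]; exact hvv'.trans_lt hε1)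
  rw [← dist_eq_norm] at h1
  refine (dist_triangle4 _ _ _ _).trans_lt ((add_lt_add (add_lt_add_of_le_of_lt h1 h2) h3).trans ?_)
  linarith

end Truncation

/-! ### The diameter condition against powers of the logarithm -/

section Counting

open scoped Asymptotics

/-- The right side is `N^(5/4)`, which leaves `N^(1/4)`: half of this exponent pays for the power of
the logarithm, half for the constants. Hence `δ = 1/(8(c+1))`, where `c + 1` also covers `c = 0`. -/
theorem eventually_mul_log_pow_le {N L : ℕ → ℝ} (hN : Tendsto N atTop atTop)
    (hL : ∀ δ : ℝ, 0 < δ → L =O[atTop] fun n => N n ^ δ) {a : ℝ} (ha : 0 ≤ a) (c : ℕ) :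
    ∀ᶠ n in atTop, a * N n * (1 + 2 * |L n| + c) ^ c ≤ √√(N n) ^ 5 := by
  have hδ : (0 : ℝ) < (8 * ((c : ℝ) + 1))⁻¹ := by positivity
  obtain ⟨C, hC, hLC⟩ := (hL _ hδ).exists_pos
  have hbig : Tendsto (fun n => N n ^ (8⁻¹ : ℝ)) atTop atTop :=
    (tendsto_rpow_atTop (by norm_num)).comp hN
  filter_upwards [hLC.bound, hN.eventually_ge_atTop 1,
    hbig.eventually_ge_atTop (a * (1 + 2 * C + c) ^ c)] with n h1 h2 h3
  have hN0 : 0 ≤ N n := zero_le_one.trans h2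
  rw [Real.norm_eq_abs, Real.norm_eq_abs, abs_of_nonneg (Real.rpow_nonneg hN0 _)] at h1
  have hpow1 : 1 ≤ N n ^ (8 * ((c : ℝ) + 1))⁻¹ := Real.one_le_rpow h2 hδ.le
  have h4 : 1 + 2 * |L n| + c ≤ (1 + 2 * C + c) * N n ^ (8 * ((c : ℝ) + 1))⁻¹ := by
    have hc : (0 : ℝ) ≤ c := Nat.cast_nonneg c
    nlinarith
  have h5 : (N n ^ (8 * ((c : ℝ) + 1))⁻¹) ^ c ≤ N n ^ (8⁻¹ : ℝ) := by
    rw [← Real.rpow_natCast, ← Real.rpow_mul hN0]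
    refine Real.rpow_le_rpow_of_exponent_le h2 ?_
    rw [inv_mul_le_iff₀ (by positivity)]
    linarith
  have h6 : √√(N n) ^ 5 = N n * (N n ^ (8⁻¹ : ℝ) * N n ^ (8⁻¹ : ℝ)) := by
    have h7 : √√(N n) = N n ^ (8⁻¹ : ℝ) * N n ^ (8⁻¹ : ℝ) := by
      rw [← Real.rpow_add (by linarith), Real.sqrt_eq_rpow, Real.sqrt_eq_rpow, ← Real.rpow_mul hN0]
      norm_num
    have h8 : √√(N n) ^ 4 = N n := by
      rw [show (4 : ℕ) = 2 * 2 by rfl, pow_mul, Real.sq_sqrt (Real.sqrt_nonneg _),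
        Real.sq_sqrt hN0]
    rw [pow_succ, h8, ← h7]
  calc a * N n * (1 + 2 * |L n| + c) ^ c
      ≤ a * N n * ((1 + 2 * C + c) * N n ^ (8 * ((c : ℝ) + 1))⁻¹) ^ c := by gcongr
    _ = N n * ((a * (1 + 2 * C + c) ^ c) * (N n ^ (8 * ((c : ℝ) + 1))⁻¹) ^ c) := by
        rw [mul_pow]
        ring
    _ ≤ N n * (N n ^ (8⁻¹ : ℝ) * N n ^ (8⁻¹ : ℝ)) := by gcongr
    _ = _ := h6.symm

/-- The factor `2` bounds `1/log 2`, and the summand `1` pays for rounding up. The absolute value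
covers `0 < x < 1`, and `x ≤ 0` rounds to `0`, with natural logarithm `0`. -/
theorem natLog_ceil_le {p : ℕ} (hp : 2 ≤ p) {x : ℝ} :
    (Nat.log p ⌈x⌉₊ : ℝ) ≤ 1 + 2 * |Real.log x| := by
  have hlog2 : 1 / 2 ≤ Real.log 2 := by linarith [Real.log_two_gt_d9]
  rcases Nat.eq_zero_or_pos ⌈x⌉₊ with h0 | h0
  · rw [h0, Nat.log_zero_right, Nat.cast_zero]
    positivity
  · have hx : 0 < x := Nat.ceil_pos.1 h0
    have h1 : (Nat.log p ⌈x⌉₊ : ℝ) ≤ Real.logb 2 ⌈x⌉₊ := by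
      refine le_trans ?_ (Real.natLog_le_logb _ _)
      exact_mod_cast Nat.log_anti_left (by norm_num) hp
    have h2 : (⌈x⌉₊ : ℝ) ≤ 2 * max x 1 := by
      have := (Nat.ceil_lt_add_one hx.le).le
      linarith [le_max_left x 1, le_max_right x 1]
    have h3 : Real.log (max x 1) ≤ |Real.log x| := by
      rcases le_total x 1 with h | h
      · rw [max_eq_right h, Real.log_one]
        exact abs_nonneg _
      · rw [max_eq_left h]
        exact le_abs_self _
    have h4 : Real.log ⌈x⌉₊ ≤ Real.log 2 + |Real.log x| := by
      refine (Real.log_le_log (by exact_mod_cast h0) h2).trans ?_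
      rw [Real.log_mul two_ne_zero (by positivity)]
      linarith
    refine h1.trans ?_
    rw [Real.logb, div_le_iff₀ (by linarith)]
    nlinarith [abs_nonneg (Real.log x)]

variable {p d : ℕ} [Fact p.Prime]

/-- Along Følner sets of subexponential diameter, the minimal zero sums in the orbits of finite
sets of characters are few. -/
theorem eventually_card_minZeroSums_le {R : Fin d → LaurentPolynomial (ZMod p)}
    (hR : MulIndependent R) {D : ℕ → Finset (Fin d → ℤ)}
    (hcard : Tendsto (fun n => ((D n).card : ℝ)) atTop atTop)
    (hdiam : ∀ δ : ℝ, 0 < δ →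
      (fun n => Real.log (Metric.diam (D n : Set (Fin d → ℤ)))) =O[atTop]
        fun n => ((D n).card : ℝ) ^ δ) (F : Finset (DualRing R)) (hF : 0 ∉ F) (r : ℕ) :
    ∀ᶠ n in atTop, ∀ (ι : Type) [Fintype ι], Fintype.card ι ≤ r →
      ((minZeroSums ι (orbitFinset (dualMonomial R) F (D n))).card : ℝ) ≤
        √√((D n).card : ℝ) ^ 5 := by
  classical
  have hF' : (0 : FunField p) ∉ F.image (dualEmbedding hR) := by
    rw [Finset.mem_image]
    rintro ⟨a, ha, h0⟩
    rw [map_eq_zero_iff _ (dualEmbedding_injective hR)] at h0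
    exact hF (h0 ▸ ha)
  obtain ⟨c, hc⟩ := exists_card_minZeroSums_le (p := p) (fieldGen R) (fieldGen_ne_zero hR)
    (F.image (dualEmbedding hR)) hF' r
  filter_upwards [eventually_mul_log_pow_le hcard hdiam (Nat.cast_nonneg F.card) c]
    with n hn ι _ hι
  have hD : ∀ l ∈ D n, ∀ l' ∈ D n, ∀ j,
      |l j - l' j| ≤ (⌈Metric.diam (D n : Set (Fin d → ℤ))⌉₊ : ℤ) := by
    intro l hl l' hl' j
    have h1 : dist (l j) (l' j) ≤ Metric.diam (D n : Set (Fin d → ℤ)) :=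
      (dist_le_pi_dist l l' j).trans
        (Metric.dist_le_diam_of_mem (D n).finite_toSet.isBounded hl hl')
    rw [Int.dist_eq] at h1
    have h2 := h1.trans (Nat.le_ceil _)
    exact_mod_cast h2
  have hB : ∀ b ∈ orbitFinset (dualMonomial R) F (D n), ∃ l ∈ D n,
      ∃ a ∈ F.image (dualEmbedding hR),
        (dualEmbedding hR : DualRing R →+ FunField p) b = (∏ j, fieldGen R j ^ l j) * a := by
    intro b hb
    obtain ⟨l, hl, a, ha, rfl⟩ := mem_orbitFinset.1 hb
    refine ⟨l, hl, _, Finset.mem_image_of_mem _ ha, ?_⟩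
    rw [← dualEmbedding_dualMonomial hR]
    exact map_mul (dualEmbedding hR) _ _
  have h1 := hc (DualRing R) (dualEmbedding hR : DualRing R →+ FunField p)
    (dualEmbedding_injective hR) _ (D n) _ hD hB ι hι
  have h2 : ((orbitFinset (dualMonomial R) F (D n)).card : ℝ) ≤ F.card * (D n).card := by
    exact_mod_cast card_orbitFinset_le F (D n)
  have h3 := natLog_ceil_le (Fact.out : p.Prime).two_le
    (x := Metric.diam (D n : Set (Fin d → ℤ)))
  calc ((minZeroSums ι (orbitFinset (dualMonomial R) F (D n))).card : ℝ)
      ≤ (orbitFinset (dualMonomial R) F (D n)).card *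
        ((Nat.log p ⌈Metric.diam (D n : Set (Fin d → ℤ))⌉₊ : ℝ) + c) ^ c := by exact_mod_cast h1
    _ ≤ F.card * (D n).card *
        (1 + 2 * |Real.log (Metric.diam (D n : Set (Fin d → ℤ)))| + c) ^ c := by gcongr
    _ ≤ _ := hn

end Counting

/-! ### The characters of the extension as a character system -/

section Extension

variable {p d : ℕ} [Fact p.Prime]

theorem isCharSystem_dualChar {R : Fin d → LaurentPolynomial (ZMod p)} (hR : MulIndependent R) :
    IsCharSystem (haar R) (dualChar (R := R)) (shiftAct R) (dualMonomial R) where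
  continuous := continuous_dualChar
  zero := dualChar_zero
  add := dualChar_add
  neg := dualChar_neg
  norm := norm_dualChar
  integral a ha := by
    classical
    rw [integral_dualChar, if_neg ha]
  shift := dualChar_shiftAct
  u_zero := dualMonomial_zero R
  u_add := dualMonomial_add R
  u_injective _ ha := dualMonomial_mul_injective hR ha

instance instCountableDualRing (R : Fin d → LaurentPolynomial (ZMod p)) :
    Countable (DualRing R) := by
  have : Countable (LPoly p (d + 1)) := (AddMonoidAlgebra.coeffEquiv).injective.countable
  exact (Ideal.Quotient.mk_surjective (I := extIdeal R)).countable

theorem shiftAct_zero (R : Fin d → LaurentPolynomial (ZMod p)) (ζ : ExtGroup R) :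
    shiftAct R 0 ζ = ζ := by
  refine Subtype.ext (funext fun k => ?_)
  have hk : k + Fin.cons 0 (0 : Fin d → ℤ) = k := by
    funext i
    refine Fin.cases ?_ (fun j => ?_) i <;> simp
  exact congrArg (ζ : FullGroup p (d + 1)) hk

theorem IsRegular.exists_isCharSeries {R : Fin d → LaurentPolynomial (ZMod p)}
    (hR : MulIndependent R) {f : ExtGroup R → ℝ} (hf : IsRegular R f) :
    ∃ c : DualRing R → ℂ, c 0 = 0 ∧ IsCharSeries dualChar c f := by
  obtain ⟨⟨c, hc, hcf⟩, hf0⟩ := hf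
  have h : IsCharSeries dualChar (fun a => c (dualEquiv R a)) f := by
    refine ⟨((dualEquiv R).summable_iff (f := fun χ => ‖c χ‖)).2 hc, fun x => ?_⟩
    exact (dualEquiv R).hasSum_iff (f := fun χ => c χ * ((χ.1 x : Circle) : ℂ)) |>.2 (hcf x)
  refine ⟨_, ?_, h⟩
  have h1 := h.integral_char_mul (isCharSystem_dualChar hR) 0
  simp only [dualChar_zero, one_mul, neg_zero] at h1
  rw [← h1, integral_complex_ofReal, hf0, Complex.ofReal_zero]

end Extension

/-! ### Fourier series on the torus -/

section Torus

open UnitAddTorus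

theorem integral_mFourier {d : ℕ} (n : Fin d → ℤ) :
    ∫ t, mFourier n t ∂(Measure.pi fun _ : Fin d => AddCircle.haarAddCircle) =
      if n = 0 then 1 else 0 := by
  split_ifs with h
  · rw [h, mFourier_zero]
    simp
  · obtain ⟨i, hi⟩ := Function.ne_iff.1 h
    simp only [mFourier, ContinuousMap.coe_mk]
    rw [integral_fintype_prod_eq_prod]
    refine Finset.prod_eq_zero (Finset.mem_univ i) ?_
    have h1 := orthonormal_iff_ite.1 (orthonormal_fourier (T := 1)) 0 (n i)
    rw [if_neg (fun h0 => hi h0.symm), ContinuousMap.inner_toLp] at h1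
    simpa using h1

variable {d : ℕ} {γ : (Fin d → ℤ) → ℂ}

theorem continuous_tsum_mFourier (hγ : Summable fun q => ‖γ q‖) :
    Continuous fun t : UnitAddTorus (Fin d) => ∑' q, mFourier q t * γ q := by
  refine continuous_tsum (fun q => (mFourier q).continuous.mul continuous_const) hγ fun q t => ?_
  rw [norm_mul]
  refine mul_le_of_le_one_left (norm_nonneg _) ?_
  exact ((mFourier q).norm_coe_le_norm t).trans mFourier_norm.le

theorem integral_mFourier_neg_mul_tsum (hγ : Summable fun q => ‖γ q‖) (l : Fin d → ℤ) :
    ∫ t, mFourier (-l) t * ∑' q, mFourier q t * γ q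
      ∂(Measure.pi fun _ : Fin d => AddCircle.haarAddCircle) = γ l := by
  have h1 : ∀ t : UnitAddTorus (Fin d), mFourier (-l) t * ∑' q, mFourier q t * γ q =
      ∑' q, γ q * mFourier (q - l) t := by
    intro t
    rw [← tsum_mul_left]
    refine tsum_congr fun q => ?_
    rw [sub_eq_neg_add, mFourier_add]
    ring
  simp_rw [h1]
  rw [← integral_tsum_of_summable_integral_norm]
  · rw [tsum_eq_single l]
    · rw [integral_const_mul, integral_mFourier, if_pos (sub_self l), mul_one]
    · intro q hq
      rw [integral_const_mul, integral_mFourier, if_neg (sub_ne_zero.2 hq), mul_zero]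
  · exact fun q => integrable_of_continuous (continuous_const.mul (mFourier _).continuous)
  · refine Summable.of_nonneg_of_le (fun a => integral_nonneg fun x => norm_nonneg _)
      (fun q => ?_) hγ
    refine (integral_mono (μ := Measure.pi fun _ : Fin d => AddCircle.haarAddCircle)
      (g := fun _ => ‖γ q‖) (integrable_of_continuous
        (continuous_const.mul (mFourier _).continuous).norm) (integrable_const _)
      fun t => ?_).trans_eq (by simp)
    refine (norm_mul _ _).trans_le ?_
    refine mul_le_of_le_one_right (norm_nonneg _) ?_
    exact ((mFourier _).norm_coe_le_norm t).trans mFourier_norm.le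

end Torus

/-! ### The spectral density -/

section SpectralDensity

open UnitAddTorus
open scoped ComplexConjugate ComplexOrder

variable {p d : ℕ} [Fact p.Prime]

theorem mFourier_sub (l l' : Fin d → ℤ) (t : UnitAddTorus (Fin d)) :
    mFourier (l - l') t = mFourier l t * conj (mFourier l' t) := by
  rw [sub_eq_add_neg, mFourier_add, mFourier_neg]

theorem tsum_mFourier_mul_corr_nonneg {R : Fin d → LaurentPolynomial (ZMod p)}
    (hR : MulIndependent R) {D : ℕ → Finset (Fin d → ℤ)}
    (hD : IsAddFoelner (Fin d → ℤ) Measure.count atTop fun n => (D n : Set (Fin d → ℤ)))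
    {c : DualRing R → ℂ} (hc0 : c 0 = 0) {f : ExtGroup R → ℝ} (hf : IsCharSeries dualChar c f)
    (t : UnitAddTorus (Fin d)) :
    0 ≤ ∑' q, mFourier q t * corr (dualMonomial R) c q :=
  hf.tsum_mul_corr_nonneg (isCharSystem_dualChar hR) hc0 (m := fun q => mFourier q t)
    (fun l l' => mFourier_sub l l' t)
    (fun l => ((mFourier l).norm_coe_le_norm t).trans mFourier_norm.le) hD

/-- Summable correlations define a continuous function by their Fourier series, and integrating
termwise recovers them. Positivity makes the complex sum equal to its real part and turns it into a
density. -/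
theorem isSpectralDensity {R : Fin d → LaurentPolynomial (ZMod p)}
    (hR : MulIndependent R) {D : ℕ → Finset (Fin d → ℤ)}
    (hD : IsAddFoelner (Fin d → ℤ) Measure.count atTop fun n => (D n : Set (Fin d → ℤ)))
    {c : DualRing R → ℂ} (hc0 : c 0 = 0) {f : ExtGroup R → ℝ} (hf : IsCharSeries dualChar c f) :
    IsSpectralDensity R f fun t => (∑' q, mFourier q t * corr (dualMonomial R) c q).re := by
  have hsys := isCharSystem_dualChar hR
  have hs := (summable_norm_corr hsys hf.summable hc0).1
  have hpos := tsum_mFourier_mul_corr_nonneg hR hD hc0 hf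
  have hcont : Continuous fun t => (∑' q, mFourier q t * corr (dualMonomial R) c q).re :=
    Complex.continuous_re.comp (continuous_tsum_mFourier hs)
  have hre : ∀ t, 0 ≤ (∑' q, mFourier q t * corr (dualMonomial R) c q).re := fun t =>
    (Complex.nonneg_iff.1 (hpos t)).1
  refine ⟨hcont, hre, ?_, fun l => ?_⟩
  · exact isFiniteMeasure_withDensity_ofReal (integrable_of_continuous hcont).2
  · have hmeas : Measurable fun t =>
        ENNReal.ofReal (∑' q, mFourier q t * corr (dualMonomial R) c q).re :=
      ENNReal.measurable_ofReal.comp hcont.measurable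
    rw [integral_withDensity_eq_integral_toReal_smul hmeas
      (Eventually.of_forall fun _ => ENNReal.ofReal_lt_top)]
    have h1 := hf.integral_shift_mul_shift hsys l 0
    simp only [shiftAct_zero, sub_zero] at h1
    rw [h1, ← integral_mFourier_neg_mul_tsum hs l]
    refine integral_congr_ae (Eventually.of_forall fun t => ?_)
    simp only
    have h2 : ((∑' q, mFourier q t * corr (dualMonomial R) c q).re : ℂ) =
        ∑' q, mFourier q t * corr (dualMonomial R) c q :=
      Complex.ext rfl (Complex.nonneg_iff.1 (hpos t)).2
    rw [ENNReal.toReal_ofReal (hre t), Complex.real_smul, h2, mul_comm]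

end SpectralDensity

end ShiftCLT

/-! ### Assembly of the main theorem -/

theorem theorem3p7 (p d : ℕ) [Fact p.Prime] (hd : 1 ≤ d)
    (R : Fin d → LaurentPolynomial (ZMod p)) (hR : ShiftCLT.MulIndependent R)
    (D : ℕ → Finset (Fin d → ℤ)) (hDnonneg : ∀ n, ∀ l ∈ D n, 0 ≤ l)
    (hD : IsAddFoelner (Fin d → ℤ) Measure.count atTop
      fun n => (D n : Set (Fin d → ℤ)))
    (f : ShiftCLT.ExtGroup R → ℝ) (hf : ShiftCLT.IsRegular R f) :
    ∃ φ : UnitAddTorus (Fin d) → ℝ, ShiftCLT.IsSpectralDensity R f φ ∧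
      Tendsto (fun n => (∫ x, (∑ l ∈ D n, f (ShiftCLT.shiftAct R l x)) ^ 2 ∂(ShiftCLT.haar R)) /
        ((D n).card : ℝ)) atTop (𝓝 (φ 0)) ∧
      ((∀ δ : ℝ, 0 < δ →
          (fun n => Real.log (Metric.diam (D n : Set (Fin d → ℤ)))) =O[atTop]
            fun n => ((D n).card : ℝ) ^ δ) →
        TendstoInDistribution
          (fun n x => (√((D n).card : ℝ))⁻¹ * ∑ l ∈ D n, f (ShiftCLT.shiftAct R l x))
          atTop (id : ℝ → ℝ) (fun _ => ShiftCLT.haar R) (gaussianReal 0 (φ 0).toNNReal)) := by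
  obtain ⟨c, hc0, hfc⟩ := hf.exists_isCharSeries hR
  have hsys := ShiftCLT.isCharSystem_dualChar hR
  have hzero : ∑' q, UnitAddTorus.mFourier q 0 * ShiftCLT.corr (ShiftCLT.dualMonomial R) c q =
      ∑' q, ShiftCLT.corr (ShiftCLT.dualMonomial R) c q := by
    simp [UnitAddTorus.mFourier]
  have hdens := ShiftCLT.isSpectralDensity hR hD hc0 hfc
  have hcont : ∀ n, Continuous fun x =>
      (√((D n).card : ℝ))⁻¹ * ∑ l ∈ D n, f (ShiftCLT.shiftAct R l x) := fun n =>
    continuous_const.mul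
      (continuous_finsetSum _ fun l _ => (hfc.comp_shift hsys l).continuous hsys)
  refine ⟨_, hdens, ?_, fun hdiam => ⟨fun n => (hcont n).aemeasurable, aemeasurable_id, ?_⟩⟩
  · simp only [hzero]
    exact hfc.tendsto_integral_sum_sq_div hsys hc0 hD
  -- Since `d ≥ 1`, the group `ℤ^d` is nontrivial, which forces `|D n|` to infinity.
  · have : Nonempty (Fin d) := ⟨⟨0, hd⟩⟩
    have hcard := ShiftCLT.tendsto_card_atTop_of_isAddFoelner hD
    have hnonneg := hdens.2.1 0
    simp only [hzero] at hnonneg ⊢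
    -- Lévy's continuity theorem; it also covers variance `0`, where the limit law is the Dirac
    -- mass.
    refine ProbabilityMeasure.tendsto_iff_tendsto_charFun.2 fun t => ?_
    have hlim := hfc.tendsto_integral_exp_of_foelner hsys hc0 hD hcard
      (ShiftCLT.eventually_card_minZeroSums_le hR hcard hdiam) t
    simp only [ProbabilityMeasure.coe_mk, Measure.map_id, charFun_gaussianReal]
    rw [Real.coe_toNNReal _ hnonneg, Complex.ofReal_zero, mul_zero, zero_mul, zero_sub]
    refine hlim.congr fun n => ?_
    rw [charFun_apply_real, integral_map (hcont n).aemeasurable (by fun_prop)]
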